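/- Let $p_0<p_1<0$, $g>0$, $\sigma>0$, let $\rho_1<\rho_2$ be real constants (the densities of air and water) and put $[\![\rho]\!]:=\rho_1-\rho_2<0$. Let $\gamma$ be a continuous real function on $[0,-p_1]$ (the vorticity strength function), and let $\Gamma$ be a positive function on $[p_1,0]$ with $(\Gamma^2)'(p)=2\gamma(-p)$ on $[p_1,0]$ and $\int_{p_1}^0 \frac{dp}{\Gamma(p)}=\ell$. Let $\lambda>0$ and let $a(p)=\lambda$ for $p_0<p<p_1$ and $a(p)=\Gamma(p)$ for $p_1<p<0$. For a function $f$ write $[\![f]\!]=f(p_1^+)-f(p_1^-)$. On $\mathbb H=L^2((p_0,0))\times\mathbb C$ consider the indefinite inner product $$[(u_1,b_1),(u_2,b_2)]=\int_{p_0}^0 a\,u_1\overline{u_2}\,dp-\frac1{2\sigma}b_1\overline{b_2},$$ and let $K$ be the operator with domain $$D(K)=\{(u,b)\in (H^2((p_0,p_1))\cap H^2((p_1,0))\cap C^0([p_0,0]))\times\mathbb C:\ u(p_0)=u(0)=0,\ \sigma u(p_1)=b\}$$ given by $$K(u,b)=\Big(-\frac1a(a^3u')',\ 2[\![a^3u']\!]-2g[\![\rho]\!]\,u(p_1)\Big).$$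 Then: 1. $K$ is self-adjoint with respect to $[\cdot,\cdot]$, that is, $D(K)$ is dense and $K$ equals its adjoint with respect to $[\cdot,\cdot]$. 2. Every eigenvalue $\mu\in\mathbb C$ of $K$ is geometrically simple: $\dim\ker(K-\mu)=1$. If moreover $\mu$ is not real, or $\mu$ has an eigenvector $x$ with $[x,x]\neq0$, then $\mu$ is algebraically simple: $\dim\bigcup_n\ker(K-\mu)^n=1$. 3. There is a one-dimensional subspace $M\subseteq D(K)$ with $K(M)\subseteq M$ which is maximal (with respect to inclusion) among the subspaces of $\mathbb H$ on which $[x,x]\le0$ for all $x$. 4. Let $\lambda_0$ be the real number with $\lambda_0^3=-g[\![\rho]\!](p_1-p_0)$. If $\lambda>\lambda_0$, then $K$ is positive, that is, $[Kx,x]>0$ for all $0\ne x\in D(K)$; $K$ has exactly one negative eigenvalue; and every eigenvalue of $K$ is algebraically simple. -/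

import Mathlib

open MeasureTheory Set

namespace WindWave

noncomputable section

/-! ### Weak derivatives and Sobolev spaces on an open subset of the line -/

/-- `v` is the weak (distributional) derivative of `u` on `Ω`. -/
def IsWeakDeriv (Ω : Set ℝ) (u v : ℝ → ℂ) : Prop :=
  ∀ φ : ℝ → ℝ, ContDiff ℝ (⊤ : ℕ∞) φ → HasCompactSupport φ → tsupport φ ⊆ Ω →
    ∫ x in Ω, deriv φ x • u x = -∫ x in Ω, φ x • v x

/-- Membership in the Sobolev space `H¹(Ω)`. -/
def MemH1 (Ω : Set ℝ) (u : ℝ → ℂ) : Prop :=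
  MemLp u 2 (volume.restrict Ω) ∧
    ∃ v : ℝ → ℂ, MemLp v 2 (volume.restrict Ω) ∧ IsWeakDeriv Ω u v

/-- Membership in the Sobolev space `H²(Ω)`. -/
def MemH2 (Ω : Set ℝ) (u : ℝ → ℂ) : Prop :=
  MemLp u 2 (volume.restrict Ω) ∧ ∃ v : ℝ → ℂ, MemH1 Ω v ∧ IsWeakDeriv Ω u v

/-- The weak derivative in `L²(Ω)` of a function (unique almost everywhere on `Ω`); it is an
arbitrary function when there is none. -/
def weakDeriv (Ω : Set ℝ) (u : ℝ → ℂ) : ℝ → ℂ :=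
  Classical.epsilon fun v => MemLp v 2 (volume.restrict Ω) ∧ IsWeakDeriv Ω u v

/-- The continuous representative on `[α, β]` of a function on `(α, β)` (its values on `[α, β]` are
unique); it is an arbitrary function when there is none. Its values at `α` and `β` are the
one-sided traces. -/
def contRep (α β : ℝ) (u : ℝ → ℂ) : ℝ → ℂ :=
  Classical.epsilon fun U => ContinuousOn U (Icc α β) ∧ u =ᵐ[volume.restrict (Ioo α β)] U

section Sobolev

variable {α β : ℝ} {u v w f g : ℝ → ℂ} {Ω : Set ℝ}

theorem IsWeakDeriv.congr (h : IsWeakDeriv Ω u v) (hf : u =ᵐ[volume.restrict Ω] f) :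
    IsWeakDeriv Ω f v := by
  intro φ h1 h2 h3
  rw [← h φ h1 h2 h3]
  refine integral_congr_ae ?_
  filter_upwards [hf] with x hx
  rw [hx]

theorem isWeakDeriv_congr (hf : u =ᵐ[volume.restrict Ω] f) :
    IsWeakDeriv Ω u v ↔ IsWeakDeriv Ω f v :=
  ⟨fun h => h.congr hf, fun h => h.congr hf.symm⟩

theorem weakDeriv_congr (hf : u =ᵐ[volume.restrict Ω] f) : weakDeriv Ω u = weakDeriv Ω f := by
  unfold weakDeriv
  simp only [isWeakDeriv_congr hf]

theorem contRep_congr (hf : u =ᵐ[volume.restrict (Ioo α β)] f) :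
    contRep α β u = contRep α β f := by
  unfold contRep
  have : ∀ U : ℝ → ℂ, u =ᵐ[volume.restrict (Ioo α β)] U ↔ f =ᵐ[volume.restrict (Ioo α β)] U :=
    fun U => ⟨fun h => hf.symm.trans h, fun h => hf.trans h⟩
  simp only [this]

theorem MemH2.congr (h : MemH2 Ω u) (hf : u =ᵐ[volume.restrict Ω] f) : MemH2 Ω f :=
  ⟨h.1.ae_eq hf, h.2.imp fun _ hv => ⟨hv.1, hv.2.congr hf⟩⟩

theorem integrable_of_memLp (hu : MemLp u 2 (volume.restrict (Ioo α β))) :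
    IntegrableOn u (Ioo α β) := by
  have : IsFiniteMeasure (volume.restrict (Ioo α β)) := ⟨by simp⟩
  exact hu.integrable (by norm_num)

theorem integrable_smul_test {φ : ℝ → ℝ} (hφ : Continuous φ)
    (hu : MemLp u 2 (volume.restrict (Ioo α β))) :
    IntegrableOn (fun x => φ x • u x) (Ioo α β) := by
  have h1 : IntegrableOn u (Ioo α β) := integrable_of_memLp hu
  rcases le_or_gt β α with h | h
  · simp [Ioo_eq_empty (not_lt.2 h)]
  have h2 := (integrableOn_Icc_iff_integrableOn_Ioo (μ := volume)).2 h1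
  exact ((h2.continuousOn_smul hφ.continuousOn isCompact_Icc)).mono_set Ioo_subset_Icc_self

theorem IsWeakDeriv.add (h : IsWeakDeriv (Ioo α β) u v) (h' : IsWeakDeriv (Ioo α β) f g)
    (hu : MemLp u 2 (volume.restrict (Ioo α β))) (hv : MemLp v 2 (volume.restrict (Ioo α β)))
    (hf : MemLp f 2 (volume.restrict (Ioo α β))) (hg : MemLp g 2 (volume.restrict (Ioo α β))) :
    IsWeakDeriv (Ioo α β) (u + f) (v + g) := by
  intro φ h1 h2 h3
  have hφ' : Continuous (deriv φ) := h1.continuous_deriv (by simp)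
  simp only [Pi.add_apply, smul_add]
  rw [integral_add (integrable_smul_test hφ' hu) (integrable_smul_test hφ' hf),
    integral_add (integrable_smul_test h1.continuous hv) (integrable_smul_test h1.continuous hg),
    h φ h1 h2 h3, h' φ h1 h2 h3]
  ring

theorem IsWeakDeriv.smul (c : ℂ) (h : IsWeakDeriv Ω u v) : IsWeakDeriv Ω (c • u) (c • v) := by
  intro φ h1 h2 h3
  simp only [Pi.smul_apply, smul_comm _ c]
  rw [integral_smul, integral_smul, h φ h1 h2 h3, smul_neg]

/-- A function which is orthogonal to all test functions on an interval vanishes there. -/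
theorem ae_zero_of_test (hu : MemLp u 2 (volume.restrict (Ioo α β)))
    (h : ∀ φ : ℝ → ℝ, ContDiff ℝ (⊤ : ℕ∞) φ → HasCompactSupport φ → tsupport φ ⊆ Ioo α β →
      ∫ x in Ioo α β, φ x • u x = 0) : u =ᵐ[volume.restrict (Ioo α β)] 0 := by
  have h1 : LocallyIntegrableOn u (Ioo α β) volume :=
    (integrable_of_memLp hu).locallyIntegrableOn
  have := isOpen_Ioo.ae_eq_zero_of_integral_contDiff_smul_eq_zero h1 (fun φ a b c => by
    rw [← h φ a b c, ← integral_indicator measurableSet_Ioo]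
    refine integral_congr_ae (Filter.Eventually.of_forall fun x => ?_)
    by_cases hx : x ∈ Ioo α β
    · simp [hx]
    · have : φ x = 0 := by
        by_contra h0
        exact hx (c (subset_tsupport _ h0))
      simp [hx, this])
  rwa [Filter.EventuallyEq, ae_restrict_iff' measurableSet_Ioo]

theorem weakDeriv_unique (hv : MemLp v 2 (volume.restrict (Ioo α β)))
    (hw : MemLp w 2 (volume.restrict (Ioo α β)))
    (h : IsWeakDeriv (Ioo α β) u v) (h' : IsWeakDeriv (Ioo α β) u w) :
    v =ᵐ[volume.restrict (Ioo α β)] w := by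
  have := ae_zero_of_test (hv.sub hw) (fun φ h1 h2 h3 => by
    simp only [Pi.sub_apply, smul_sub]
    rw [integral_sub (integrable_smul_test h1.continuous hv)
      (integrable_smul_test h1.continuous hw)]
    have a := h φ h1 h2 h3
    have b := h' φ h1 h2 h3
    rw [a] at b
    rw [sub_eq_zero]
    exact neg_injective b)
  filter_upwards [this] with x hx
  exact sub_eq_zero.1 hx

theorem weakDeriv_spec (h : ∃ v, MemLp v 2 (volume.restrict Ω) ∧ IsWeakDeriv Ω u v) :
    MemLp (weakDeriv Ω u) 2 (volume.restrict Ω) ∧ IsWeakDeriv Ω u (weakDeriv Ω u) := by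
  exact Classical.epsilon_spec h

theorem weakDeriv_ae_eq (hv : MemLp v 2 (volume.restrict (Ioo α β)))
    (h : IsWeakDeriv (Ioo α β) u v) :
    weakDeriv (Ioo α β) u =ᵐ[volume.restrict (Ioo α β)] v :=
  weakDeriv_unique (weakDeriv_spec ⟨v, hv, h⟩).1 hv (weakDeriv_spec ⟨v, hv, h⟩).2 h

theorem weakDeriv_add (hu : MemH1 (Ioo α β) u) (hf : MemH1 (Ioo α β) f) :
    weakDeriv (Ioo α β) (u + f) =ᵐ[volume.restrict (Ioo α β)]
      weakDeriv (Ioo α β) u + weakDeriv (Ioo α β) f := by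
  have h1 := weakDeriv_spec hu.2
  have h2 := weakDeriv_spec hf.2
  exact weakDeriv_ae_eq (h1.1.add h2.1) (h1.2.add h2.2 hu.1 h1.1 hf.1 h2.1)

theorem weakDeriv_smul (c : ℂ) (hu : MemH1 (Ioo α β) u) :
    weakDeriv (Ioo α β) (c • u) =ᵐ[volume.restrict (Ioo α β)] c • weakDeriv (Ioo α β) u := by
  have h1 := weakDeriv_spec hu.2
  exact weakDeriv_ae_eq (h1.1.const_smul c) (h1.2.smul c)

theorem MemH1.add (hu : MemH1 (Ioo α β) u) (hf : MemH1 (Ioo α β) f) :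
    MemH1 (Ioo α β) (u + f) := by
  have h1 := weakDeriv_spec hu.2
  have h2 := weakDeriv_spec hf.2
  exact ⟨hu.1.add hf.1, _, h1.1.add h2.1, h1.2.add h2.2 hu.1 h1.1 hf.1 h2.1⟩

theorem MemH1.smul (c : ℂ) (hu : MemH1 Ω u) : MemH1 Ω (c • u) := by
  have h1 := weakDeriv_spec hu.2
  exact ⟨hu.1.const_smul c, _, h1.1.const_smul c, h1.2.smul c⟩

theorem MemH2.memH1 (hu : MemH2 Ω u) : MemH1 Ω u :=
  ⟨hu.1, hu.2.imp fun _ h => ⟨h.1.1, h.2⟩⟩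

theorem MemH2.add (hu : MemH2 (Ioo α β) u) (hf : MemH2 (Ioo α β) f) :
    MemH2 (Ioo α β) (u + f) := by
  obtain ⟨h1, v, h2, h3⟩ := hu
  obtain ⟨k1, w, k2, k3⟩ := hf
  exact ⟨h1.add k1, v + w, h2.add k2, h3.add k3 h1 h2.1 k1 k2.1⟩

theorem MemH2.smul (c : ℂ) (hu : MemH2 Ω u) : MemH2 Ω (c • u) := by
  obtain ⟨h1, v, h2, h3⟩ := hu
  exact ⟨h1.const_smul c, c • v, h2.smul c, h3.smul c⟩

theorem memH2_zero : MemH2 Ω 0 := by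
  have : IsWeakDeriv Ω 0 0 := by intro φ _ _ _; simp
  exact ⟨MemLp.zero, 0, ⟨MemLp.zero, 0, MemLp.zero, this⟩, this⟩

theorem MemH1.congr (h : MemH1 Ω u) (hf : u =ᵐ[volume.restrict Ω] f) : MemH1 Ω f :=
  ⟨h.1.ae_eq hf, h.2.imp fun _ hv => ⟨hv.1, hv.2.congr hf⟩⟩

theorem MemH2.weakDeriv_memH1 (hu : MemH2 (Ioo α β) u) :
    MemH1 (Ioo α β) (weakDeriv (Ioo α β) u) := by
  obtain ⟨h1, v, h2, h3⟩ := hu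
  exact h2.congr (weakDeriv_ae_eq h2.1 h3).symm

/-- Integration by parts for a primitive and a `C¹` function. -/
theorem integral_deriv_smul_primitive {ψ ψ' : ℝ → ℝ} (hαβ : α ≤ β)
    (hw : IntervalIntegrable w volume α β) (hψ : ContinuousOn ψ (Icc α β))
    (hψ' : ContinuousOn ψ' (Icc α β)) (hd : ∀ x ∈ Ioo α β, HasDerivAt ψ (ψ' x) x) :
    ∫ x in α..β, ψ' x • ∫ t in α..x, w t =
      (∫ t in α..β, ψ β • w t) - ∫ t in α..β, ψ t • w t := by
  have hψ'i : IntervalIntegrable ψ' volume α β := (hψ'.intervalIntegrable_of_Icc hαβ)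
  have hw1 := (intervalIntegrable_iff_integrableOn_Ioc_of_le hαβ).1 hw
  have hψ1 := (intervalIntegrable_iff_integrableOn_Ioc_of_le hαβ).1 hψ'i
  have hint : Integrable (Function.uncurry fun x t : ℝ =>
      if t ≤ x then ψ' x • w t else 0)
      ((volume.restrict (Ioc α β)).prod (volume.restrict (Ioc α β))) := by
    have h0 := Integrable.smul_prod hψ1 hw1
    have h1 := h0.indicator (s := {z : ℝ × ℝ | z.2 ≤ z.1})
      (measurableSet_le measurable_snd measurable_fst)
    refine h1.congr (Filter.Eventually.of_forall fun z => ?_)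
    simp [indicator, Function.uncurry]
  have hswap := integral_integral_swap hint
  rw [intervalIntegral.integral_of_le hαβ, intervalIntegral.integral_of_le hαβ,
    intervalIntegral.integral_of_le hαβ]
  have hL : ∫ x in Ioc α β, ψ' x • ∫ t in α..x, w t =
      ∫ x in Ioc α β, ∫ t in Ioc α β, (if t ≤ x then ψ' x • w t else 0) := by
    refine setIntegral_congr_fun measurableSet_Ioc fun x hx => ?_
    have e : (fun t => if t ≤ x then ψ' x • w t else 0) =
        (Iic x).indicator (fun t => ψ' x • w t) := by
      ext t; simp [indicator]
    simp only [e]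
    rw [setIntegral_indicator measurableSet_Iic, Ioc_inter_Iic, min_eq_right hx.2,
      integral_smul, intervalIntegral.integral_of_le hx.1.le]
  have hR : ∫ t in Ioc α β, ∫ x in Ioc α β, (if t ≤ x then ψ' x • w t else 0) =
      ∫ t in Ioc α β, (ψ β • w t - ψ t • w t) := by
    refine setIntegral_congr_fun measurableSet_Ioc fun t ht => ?_
    have e : (fun x => if t ≤ x then ψ' x • w t else 0) =
        (Ici t).indicator (fun x => ψ' x • w t) := by
      ext x; simp [indicator]
    have e2 : Ioc α β ∩ Ici t = Icc t β := by
      ext x; simp only [mem_inter_iff, mem_Ioc, mem_Ici, mem_Icc]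
      constructor
      · rintro ⟨⟨_, h⟩, h'⟩; exact ⟨h', h⟩
      · rintro ⟨h, h'⟩; exact ⟨⟨lt_of_lt_of_le ht.1 h, h'⟩, h⟩
    simp only [e]
    rw [setIntegral_indicator measurableSet_Ici, e2, integral_smul_const,
      integral_Icc_eq_integral_Ioc, ← intervalIntegral.integral_of_le ht.2,
      intervalIntegral.integral_eq_sub_of_hasDerivAt_of_le ht.2
        (hψ.mono (Icc_subset_Icc_left ht.1.le))
        (fun x hx => hd x ⟨ht.1.trans hx.1, hx.2⟩)
        ((hψ'.mono (Icc_subset_Icc_left ht.1.le)).intervalIntegrable_of_Icc ht.2), sub_smul]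
  rw [hL, hswap, hR, integral_sub]
  · exact hw1.smul (ψ β)
  · exact ((((integrableOn_Icc_iff_integrableOn_Ioc (μ := volume)).2 hw1).continuousOn_smul hψ
      isCompact_Icc)).mono_set Ioc_subset_Icc_self

/-- A test function of integral zero is the derivative of a test function. -/
theorem exists_primitive_test (hαβ : α < β) {η : ℝ → ℝ} (h1 : ContDiff ℝ (⊤ : ℕ∞) η)
    (h2 : HasCompactSupport η) (h3 : tsupport η ⊆ Ioo α β) (h0 : ∫ x in α..β, η x = 0) :
    ∃ χ : ℝ → ℝ, ContDiff ℝ (⊤ : ℕ∞) χ ∧ HasCompactSupport χ ∧ tsupport χ ⊆ Ioo α β ∧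
      deriv χ = η := by
  have hc := h1.continuous
  have hmid : (α + β) / 2 ∈ Ioo α β := ⟨by linarith, by linarith⟩
  have hK : IsCompact (insert ((α + β) / 2) (tsupport η)) := h2.isCompact.insert _
  have hKs : insert ((α + β) / 2) (tsupport η) ⊆ Ioo α β := insert_subset hmid h3
  obtain ⟨a, haK, ha⟩ := hK.exists_isLeast ⟨_, mem_insert _ _⟩
  obtain ⟨b, hbK, hb⟩ := hK.exists_isGreatest ⟨_, mem_insert _ _⟩
  have hzero : ∀ x, x ∉ Icc a b → η x = 0 := by
    intro x hx
    by_contra hne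
    have : x ∈ insert ((α + β) / 2) (tsupport η) :=
      mem_insert_of_mem _ (subset_tsupport _ hne)
    exact hx ⟨ha this, hb this⟩
  have hder : ∀ x, HasDerivAt (fun x => ∫ t in α..x, η t) (η x) x := fun x =>
    intervalIntegral.integral_hasDerivAt_right (hc.intervalIntegrable _ _)
      hc.stronglyMeasurable.stronglyMeasurableAtFilter hc.continuousAt
  have hderiv : deriv (fun x => ∫ t in α..x, η t) = η := funext fun x => (hder x).deriv
  have hsupp : Function.support (fun x => ∫ t in α..x, η t) ⊆ Icc a b := by
    intro x hx
    by_contra hx'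
    apply hx
    rw [mem_Icc, not_and_or, not_le, not_le] at hx'
    rcases hx' with hx' | hx'
    · refine (intervalIntegral.integral_congr (g := fun _ => 0) fun t ht => ?_).trans (by simp)
      apply hzero
      rintro ⟨h, -⟩
      have := ht.2
      have h4 := (hKs haK).1
      rcases le_max_iff.1 this with h5 | h5 <;> linarith
    · have e : ∫ t in β..x, η t = 0 := by
        refine (intervalIntegral.integral_congr (g := fun _ => 0) fun t ht => ?_).trans (by simp)
        apply hzero
        rintro ⟨-, h⟩
        have := ht.1
        have h4 := (hKs hbK).2
        rcases min_le_iff.1 this with h5 | h5 <;> linarith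
      change ∫ t in α..x, η t = 0
      rw [← intervalIntegral.integral_add_adjacent_intervals (hc.intervalIntegrable α β)
        (hc.intervalIntegrable β x), h0, e, add_zero]
  have hts : tsupport (fun x => ∫ t in α..x, η t) ⊆ Icc a b := closure_minimal hsupp isClosed_Icc
  refine ⟨fun x => ∫ t in α..x, η t, ?_, ?_, ?_, hderiv⟩
  · rw [contDiff_infty_iff_deriv]
    exact ⟨fun x => (hder x).differentiableAt, by rw [hderiv]; exact h1⟩
  · exact HasCompactSupport.of_support_subset_isCompact isCompact_Icc hsupp
  · exact hts.trans fun x hx => ⟨lt_of_lt_of_le (hKs haK).1 hx.1, lt_of_le_of_lt hx.2 (hKs hbK).2⟩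

theorem setIntegral_test {φ : ℝ → ℝ} (h3 : tsupport φ ⊆ Ioo α β) (hαβ : α < β) :
    ∫ x in α..β, φ x = ∫ x, φ x := by
  rw [intervalIntegral.integral_of_le hαβ.le]
  refine setIntegral_eq_integral_of_forall_compl_eq_zero fun x hx => ?_
  by_contra h0
  exact hx (Ioo_subset_Ioc_self (h3 (subset_tsupport _ h0)))

/-- A function with vanishing weak derivative on an interval is constant. -/
theorem ae_const_of_isWeakDeriv_zero (hαβ : α < β) (hu : MemLp u 2 (volume.restrict (Ioo α β)))
    (h : IsWeakDeriv (Ioo α β) u 0) : ∃ c : ℂ, u =ᵐ[volume.restrict (Ioo α β)] fun _ => c := by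
  let B : ContDiffBump ((α + β) / 2 : ℝ) :=
    ⟨(β - α) / 8, (β - α) / 4, by linarith, by linarith⟩
  let φ₀ : ℝ → ℝ := B.normed volume
  have b1 : ContDiff ℝ (⊤ : ℕ∞) φ₀ := B.contDiff_normed
  have b2 : HasCompactSupport φ₀ := B.hasCompactSupport_normed
  have b3 : tsupport φ₀ ⊆ Ioo α β := by
    have : tsupport φ₀ = Metric.closedBall ((α + β) / 2) B.rOut := B.tsupport_normed_eq
    rw [this, Real.closedBall_eq_Icc]
    change Icc ((α + β) / 2 - (β - α) / 4) ((α + β) / 2 + (β - α) / 4) ⊆ Ioo α β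
    intro x hx
    exact ⟨by linarith [hx.1], by linarith [hx.2]⟩
  have b4 : ∫ x, φ₀ x = 1 := B.integral_normed
  have b5 : ∫ x in α..β, φ₀ x = 1 := by rw [setIntegral_test b3 hαβ, b4]
  refine ⟨∫ x in Ioo α β, φ₀ x • u x, ?_⟩
  set c := ∫ x in Ioo α β, φ₀ x • u x with hc
  have hcm : MemLp (fun _ : ℝ => c) 2 (volume.restrict (Ioo α β)) := by
    have : IsFiniteMeasure (volume.restrict (Ioo α β)) := ⟨by simp⟩
    exact memLp_const c
  have key := ae_zero_of_test (hu.sub hcm) fun φ h1 h2 h3 => by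
    set m := ∫ x in α..β, φ x with hm
    have hmI : ∫ x in Ioo α β, φ x = m := by
      rw [hm, intervalIntegral.integral_of_le hαβ.le, integral_Ioc_eq_integral_Ioo]
    obtain ⟨χ, x1, x2, x3, x4⟩ := exists_primitive_test hαβ (η := φ - m • φ₀)
      (h1.sub (b1.const_smul m)) (h2.sub (b2.smul_left (f := fun _ => m)))
      ((tsupport_sub _ _).trans (union_subset h3 ((tsupport_smul_subset_right (fun _ => m) φ₀).trans b3)))
      (by
        simp only [Pi.sub_apply, Pi.smul_apply]
        have j2 : IntervalIntegrable (fun x => m • φ₀ x) volume α β :=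
          (b1.continuous.const_smul m).intervalIntegrable _ _
        rw [intervalIntegral.integral_sub (h1.continuous.intervalIntegrable _ _) j2,
          intervalIntegral.integral_smul, b5]
        simp [hm])
    have hχ := h χ x1 x2 x3
    rw [x4] at hχ
    simp only [Pi.sub_apply, Pi.smul_apply, sub_smul, Pi.zero_apply, smul_zero, integral_zero,
      neg_zero, smul_assoc] at hχ
    have i1 := integrable_smul_test h1.continuous hu
    have i2 := integrable_smul_test b1.continuous hu
    have i3 : IntegrableOn (fun x => m • φ₀ x • u x) (Ioo α β) := i2.smul m
    rw [integral_sub i1 i3, integral_smul, ← hc] at hχ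
    simp only [Pi.sub_apply, smul_sub]
    rw [integral_sub i1 (integrable_smul_test h1.continuous hcm), integral_smul_const, hmI]
    exact hχ
  filter_upwards [key] with x hx
  exact sub_eq_zero.1 hx

/-- An `H¹` function on an interval is the primitive of its weak derivative. -/
theorem exists_primitive_rep (hαβ : α < β) (hu : MemLp u 2 (volume.restrict (Ioo α β)))
    (hv : MemLp v 2 (volume.restrict (Ioo α β))) (h : IsWeakDeriv (Ioo α β) u v) :
    ∃ c : ℂ, u =ᵐ[volume.restrict (Ioo α β)] fun x => c + ∫ t in α..x, v t := by
  have hvi : IntervalIntegrable v volume α β := by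
    rw [intervalIntegrable_iff_integrableOn_Ioo_of_le hαβ.le]
    exact integrable_of_memLp hv
  have hcont : ContinuousOn (fun x => ∫ t in α..x, v t) (Icc α β) := by
    rw [← uIcc_of_le hαβ.le]
    exact intervalIntegral.continuousOn_primitive_interval
      (by rw [uIcc_of_le hαβ.le, integrableOn_Icc_iff_integrableOn_Ioo]
          exact integrable_of_memLp hv)
  have hfin : IsFiniteMeasure (volume.restrict (Ioo α β)) := ⟨by simp⟩
  have hV : MemLp (fun x => ∫ t in α..x, v t) 2 (volume.restrict (Ioo α β)) := by
    obtain ⟨C, hC⟩ := isCompact_Icc.exists_bound_of_continuousOn hcont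
    refine MemLp.of_bound ((hcont.mono Ioo_subset_Icc_self).aestronglyMeasurable
      measurableSet_Ioo) C ?_
    filter_upwards [ae_restrict_mem measurableSet_Ioo] with x hx
    exact hC x (Ioo_subset_Icc_self hx)
  have hVw : IsWeakDeriv (Ioo α β) (fun x => ∫ t in α..x, v t) v := by
    intro φ h1 h2 h3
    have hd : ∀ x, HasDerivAt φ (deriv φ x) x := fun x =>
      (h1.differentiable (by simp) x).hasDerivAt
    have hβ : φ β = 0 := by
      by_contra h0
      exact lt_irrefl _ (h3 (subset_tsupport _ h0)).2
    have := integral_deriv_smul_primitive hαβ.le hvi h1.continuous.continuousOn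
      (h1.continuous_deriv (by simp)).continuousOn (fun x _ => hd x)
    rw [hβ] at this
    simp only [zero_smul, intervalIntegral.integral_zero, zero_sub] at this
    rwa [intervalIntegral.integral_of_le hαβ.le, intervalIntegral.integral_of_le hαβ.le,
      integral_Ioc_eq_integral_Ioo, integral_Ioc_eq_integral_Ioo] at this
  have hdiff : IsWeakDeriv (Ioo α β) (u + (-1 : ℂ) • fun x => ∫ t in α..x, v t) 0 := by
    have := h.add (hVw.smul (-1)) hu hv (hV.const_smul _) (hv.const_smul _)
    simpa using this
  obtain ⟨c, hc⟩ := ae_const_of_isWeakDeriv_zero hαβ (hu.add (hV.const_smul _)) hdiff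
  refine ⟨c, ?_⟩
  filter_upwards [hc] with x hx
  rw [← hx]
  simp

theorem MemH1.exists_contRep (hαβ : α < β) (hu : MemH1 (Ioo α β) u) :
    ∃ U : ℝ → ℂ, ContinuousOn U (Icc α β) ∧ u =ᵐ[volume.restrict (Ioo α β)] U := by
  obtain ⟨h1, v, h2, h3⟩ := hu
  obtain ⟨c, hc⟩ := exists_primitive_rep hαβ h1 h2 h3
  refine ⟨_, ?_, hc⟩
  refine continuousOn_const.add ?_
  rw [← uIcc_of_le hαβ.le]
  exact intervalIntegral.continuousOn_primitive_interval
    (by rw [uIcc_of_le hαβ.le, integrableOn_Icc_iff_integrableOn_Ioo]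
        exact integrable_of_memLp h2)

/-- Product of an `H¹` function and a `C¹` function on an interval. -/
theorem MemH1.mul_C1 (hαβ : α < β) (hu : MemH1 (Ioo α β) u) {G G' : ℝ → ℝ}
    (hG : ContinuousOn G (Icc α β)) (hG' : ContinuousOn G' (Icc α β))
    (hd : ∀ x ∈ Ioo α β, HasDerivAt G (G' x) x) : MemH1 (Ioo α β) (fun x => G x • u x) := by
  have bdd : ∀ {f : ℝ → ℝ} {z : ℝ → ℂ}, ContinuousOn f (Icc α β) →
      MemLp z 2 (volume.restrict (Ioo α β)) →
      MemLp (fun x => f x • z x) 2 (volume.restrict (Ioo α β)) := by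
    intro f z hf hz
    obtain ⟨C, hC⟩ := isCompact_Icc.exists_bound_of_continuousOn hf
    have hf' : MemLp f ⊤ (volume.restrict (Ioo α β)) := by
      refine memLp_top_of_bound ((hf.mono Ioo_subset_Icc_self).aestronglyMeasurable
        measurableSet_Ioo) C ?_
      filter_upwards [ae_restrict_mem measurableSet_Ioo] with x hx
      exact hC x (Ioo_subset_Icc_self hx)
    exact hz.smul hf'
  obtain ⟨h1, v, h2, h3⟩ := hu
  obtain ⟨c, hc⟩ := exists_primitive_rep hαβ h1 h2 h3
  have hvi : IntervalIntegrable v volume α β := by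
    rw [intervalIntegrable_iff_integrableOn_Ioo_of_le hαβ.le]
    exact integrable_of_memLp h2
  refine ⟨bdd hG h1, fun x => G' x • u x + G x • v x, (bdd hG' h1).add (bdd hG h2), ?_⟩
  intro φ k1 k2 k3
  have hφd : ∀ x, HasDerivAt φ (deriv φ x) x := fun x =>
    (k1.differentiable (by simp) x).hasDerivAt
  have hφ' : Continuous (deriv φ) := k1.continuous_deriv (by simp)
  have hφα : φ α = 0 := by
    by_contra h0
    exact lt_irrefl _ (k3 (subset_tsupport _ h0)).1
  have hφβ : φ β = 0 := by
    by_contra h0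
    exact lt_irrefl _ (k3 (subset_tsupport _ h0)).2
  have hψ' : ContinuousOn (fun x => deriv φ x * G x + φ x * G' x) (Icc α β) :=
    (hφ'.continuousOn.mul hG).add (k1.continuous.continuousOn.mul hG')
  have hψ : ContinuousOn (fun x => φ x * G x) (Icc α β) := k1.continuous.continuousOn.mul hG
  have hψd : ∀ x ∈ Ioo α β,
      HasDerivAt (fun x => φ x * G x) (deriv φ x * G x + φ x * G' x) x :=
    fun x hx => (hφd x).mul (hd x hx)
  have key := integral_deriv_smul_primitive hαβ.le hvi hψ hψ' hψd
  have hint0 : ∫ x in α..β, (deriv φ x * G x + φ x * G' x) = 0 := by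
    rw [intervalIntegral.integral_eq_sub_of_hasDerivAt_of_le hαβ.le hψ hψd
      (hψ'.intervalIntegrable_of_Icc hαβ.le), hφα, hφβ]
    simp
  simp only [hφβ, zero_mul, zero_smul, intervalIntegral.integral_zero, zero_sub] at key
  rw [intervalIntegral.integral_of_le hαβ.le, intervalIntegral.integral_of_le hαβ.le,
      integral_Ioc_eq_integral_Ioo, integral_Ioc_eq_integral_Ioo] at key
  rw [intervalIntegral.integral_of_le hαβ.le, integral_Ioc_eq_integral_Ioo] at hint0
  have i1 : IntegrableOn (fun x => deriv φ x • G x • u x) (Ioo α β) :=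
    integrable_smul_test hφ' (bdd hG h1)
  have i2 : IntegrableOn (fun x => φ x • G' x • u x) (Ioo α β) :=
    integrable_smul_test k1.continuous (bdd hG' h1)
  have i3 : IntegrableOn (fun x => φ x • G x • v x) (Ioo α β) :=
    integrable_smul_test k1.continuous (bdd hG h2)
  have e1 : ∫ x in Ioo α β, (deriv φ x * G x + φ x * G' x) • u x =
      -∫ x in Ioo α β, φ x • G x • v x := by
    have hfin : IsFiniteMeasure (volume.restrict (Ioo α β)) := ⟨by simp⟩
    have hψi : IntegrableOn (fun x => deriv φ x * G x + φ x * G' x) (Ioo α β) :=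
      (hψ'.integrableOn_Icc).mono_set Ioo_subset_Icc_self
    have ea : ∫ x in Ioo α β, (deriv φ x * G x + φ x * G' x) • u x =
        ∫ x in Ioo α β, ((deriv φ x * G x + φ x * G' x) • c +
          (deriv φ x * G x + φ x * G' x) • ∫ t in α..x, v t) := by
      refine integral_congr_ae ?_
      filter_upwards [hc] with x hx
      rw [hx, smul_add]
    have ib : IntegrableOn (fun x => (deriv φ x * G x + φ x * G' x) • u x) (Ioo α β) := by
      refine (i1.add i2).congr (Filter.Eventually.of_forall fun x => ?_)
      simp [add_smul, mul_smul]
    have ic : IntegrableOn (fun x => (deriv φ x * G x + φ x * G' x) • c) (Ioo α β) :=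
      hψi.smul_const c
    have id : IntegrableOn (fun x => (deriv φ x * G x + φ x * G' x) • ∫ t in α..x, v t)
        (Ioo α β) := by
      refine (ib.sub ic).congr ?_
      filter_upwards [hc] with x hx
      simp only [Pi.sub_apply]
      rw [hx, smul_add, add_sub_cancel_left]
    rw [ea, integral_add ic id, integral_smul_const, hint0, zero_smul, zero_add, key]
    simp only [mul_smul]
  have e2 : ∫ x in Ioo α β, (deriv φ x * G x + φ x * G' x) • u x =
      (∫ x in Ioo α β, deriv φ x • G x • u x) + ∫ x in Ioo α β, φ x • G' x • u x := by
    rw [← integral_add i1 i2]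
    simp only [add_smul, mul_smul]
  have e3 : ∫ x in Ioo α β, φ x • (G' x • u x + G x • v x) =
      (∫ x in Ioo α β, φ x • G' x • u x) + ∫ x in Ioo α β, φ x • G x • v x := by
    rw [← integral_add i2 i3]
    simp only [smul_add]
  rw [e3, neg_add, ← e1, e2]
  ring

theorem contRep_spec (h : ∃ U, ContinuousOn U (Icc α β) ∧ u =ᵐ[volume.restrict (Ioo α β)] U) :
    ContinuousOn (contRep α β u) (Icc α β) ∧
      u =ᵐ[volume.restrict (Ioo α β)] contRep α β u :=
  Classical.epsilon_spec h

theorem contRep_eq (hαβ : α < β) {U : ℝ → ℂ} (hU : ContinuousOn U (Icc α β))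
    (h : u =ᵐ[volume.restrict (Ioo α β)] U) : EqOn (contRep α β u) U (Icc α β) := by
  have hs := contRep_spec ⟨U, hU, h⟩
  have h1 : contRep α β u =ᵐ[volume.restrict (Icc α β)] U := by
    rw [← restrict_Ioo_eq_restrict_Icc]
    exact hs.2.symm.trans h
  exact Measure.eqOn_Icc_of_ae_eq volume hαβ.ne h1 hs.1 hU

theorem contRep_add (hαβ : α < β)
    (hu : ∃ U, ContinuousOn U (Icc α β) ∧ u =ᵐ[volume.restrict (Ioo α β)] U)
    (hf : ∃ U, ContinuousOn U (Icc α β) ∧ f =ᵐ[volume.restrict (Ioo α β)] U) :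
    EqOn (contRep α β (u + f)) (contRep α β u + contRep α β f) (Icc α β) :=
  contRep_eq hαβ ((contRep_spec hu).1.add (contRep_spec hf).1)
    ((contRep_spec hu).2.add (contRep_spec hf).2)

theorem contRep_smul (hαβ : α < β) (c : ℂ)
    (hu : ∃ U, ContinuousOn U (Icc α β) ∧ u =ᵐ[volume.restrict (Ioo α β)] U) :
    EqOn (contRep α β (c • u)) (c • contRep α β u) (Icc α β) :=
  contRep_eq hαβ ((contRep_spec hu).1.const_smul c) ((contRep_spec hu).2.const_smul c)

end Sobolev

/-! ### Unbounded operators in a space with an indefinite inner product -/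

section Operators

variable {E : Type*} [AddCommGroup E] [Module ℂ E]

/-- `T` is densely defined and equal to its adjoint with respect to the inner product `B`
(linear in the first argument): `(v, w)` lies in the graph of the adjoint iff
`B (T u) v = B u w` for all `u` in the domain of `T`. -/
def IsSelfAdjointFor [TopologicalSpace E] (B : E → E → ℂ) (T : E →ₗ.[ℂ] E) : Prop :=
  Dense (T.domain : Set E) ∧
    {y : E × E | ∀ u : T.domain, B (T u) y.1 = B u y.2} = (T.graph : Set (E × E))

/-- The generalized eigenspaces `ker (T - μ)ⁿ` of an unbounded operator, with their natural
domains: `u ∈ ker (T - μ)ⁿ⁺¹` iff `u` lies in the domain of `T` and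
`T u - μ u ∈ ker (T - μ)ⁿ`. -/
def genEigenspace (T : E →ₗ.[ℂ] E) (μ : ℂ) : ℕ → Submodule ℂ E
  | 0 => ⊥
  | n + 1 => ((genEigenspace T μ n).comap (T.toFun - μ • T.domain.subtype)).map T.domain.subtype

/-- The eigenspace `ker (T - μ)`. -/
def eigenspace (T : E →ₗ.[ℂ] E) (μ : ℂ) : Submodule ℂ E := genEigenspace T μ 1

theorem mem_genEigenspace_succ (T : E →ₗ.[ℂ] E) (μ : ℂ) (n : ℕ) (x : E) :
    x ∈ genEigenspace T μ (n + 1) ↔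
      ∃ u : T.domain, (u : E) = x ∧ T u - μ • (u : E) ∈ genEigenspace T μ n := by
  simp only [genEigenspace, Submodule.mem_map, Submodule.mem_comap]
  exact ⟨fun ⟨u, h, e⟩ => ⟨u, e, h⟩, fun ⟨u, e, h⟩ => ⟨u, h, e⟩⟩

theorem mem_eigenspace (T : E →ₗ.[ℂ] E) (μ : ℂ) (x : E) :
    x ∈ eigenspace T μ ↔ ∃ u : T.domain, (u : E) = x ∧ T u = μ • (u : E) := by
  rw [eigenspace, mem_genEigenspace_succ]
  simp [genEigenspace, sub_eq_zero]

/-- `μ` is an eigenvalue of `T`. -/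
def IsEigenvalue (T : E →ₗ.[ℂ] E) (μ : ℂ) : Prop :=
  ∃ u : T.domain, (u : E) ≠ 0 ∧ T u = μ • (u : E)

/-- The eigenspace of `μ` is one-dimensional. -/
def IsGeomSimple (T : E →ₗ.[ℂ] E) (μ : ℂ) : Prop :=
  Module.finrank ℂ (eigenspace T μ) = 1

/-- The root subspace `⋃ₙ ker (T - μ)ⁿ` of `μ` is one-dimensional. -/
def IsAlgSimple (T : E →ₗ.[ℂ] E) (μ : ℂ) : Prop :=
  Module.finrank ℂ (⨆ n, genEigenspace T μ n : Submodule ℂ E) = 1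

/-- `[u, u] ≤ 0` on the subspace `M`. -/
def IsNegSemidef (B : E → E → ℂ) (M : Submodule ℂ E) : Prop :=
  ∀ u ∈ M, (B u u).re ≤ 0

/-- `M` lies in the domain of `T` and `T M ⊆ M`. -/
def IsInvariant (T : E →ₗ.[ℂ] E) (M : Submodule ℂ E) : Prop :=
  M ≤ T.domain ∧ ∀ u : T.domain, (u : E) ∈ M → T u ∈ M

/-- `[T u, u]` is real and positive for all non-zero `u` in the domain of `T`. -/
def IsPositiveFor (B : E → E → ℂ) (T : E →ₗ.[ℂ] E) : Prop :=
  ∀ u : T.domain, (u : E) ≠ 0 → (B (T u) u).im = 0 ∧ 0 < (B (T u) u).re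

end Operators

/-! ### The operator of the linearized two-layer problem -/

/-- The physical data: the bed is `p = p₀`, the interface `p = p₁` and the lid `p = 0`; the air
lies in `p₁ < p < 0` and has density `ρ₁`, the water lies in `p₀ < p < p₁` and has density `ρ₂`;
`g` is the gravitational constant, `σ` the surface tension, `γ` the vorticity strength function in
the air, `ℓ` the height of the lid and `Γ` the relative circulation, which is determined by
`(Γ²)' = 2 γ(-p)` and `∫ 1 / Γ = ℓ` and is positive (no stagnation). -/
structure Flow where
  p₀ : ℝ
  p₁ : ℝ
  g : ℝ
  ρ₁ : ℝ
  ρ₂ : ℝ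
  σ : ℝ
  ℓ : ℝ
  γ : ℝ → ℝ
  Γ : ℝ → ℝ
  p₀_lt_p₁ : p₀ < p₁
  p₁_neg : p₁ < 0
  g_pos : 0 < g
  ρ₁_lt_ρ₂ : ρ₁ < ρ₂
  σ_pos : 0 < σ
  γ_cont : ContinuousOn γ (Icc 0 (-p₁))
  Γ_pos : ∀ p ∈ Icc p₁ 0, 0 < Γ p
  Γ_deriv : ∀ p ∈ Icc p₁ 0, HasDerivWithinAt (fun s => Γ s ^ 2) (2 * γ (-p)) (Icc p₁ 0) p
  Γ_integral : ∫ p in p₁..0, 1 / Γ p = ℓ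

namespace Flow

variable (F : Flow)

/-- The jump of the density across the interface (air minus water). -/
def jumpρ : ℝ := F.ρ₁ - F.ρ₂

/-- The coefficient `a`: the relative circulation in the air and `lam` in the water. -/
def a (lam : ℝ) (p : ℝ) : ℝ := if p < F.p₁ then lam else F.Γ p

/-- The space `L²((p₀, 0)) × ℂ`, with its product topology. -/
abbrev H : Type := Lp ℂ 2 (volume.restrict (Ioo F.p₀ 0)) × ℂ

/-- The indefinite inner product
`[(u₁, b₁), (u₂, b₂)] = ∫ a u₁ ū₂ - (1 / (2 σ)) b₁ b̄₂`. -/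
def bracket (lam : ℝ) (x y : F.H) : ℂ :=
  (∫ p in Ioo F.p₀ 0, (F.a lam p : ℂ) * x.1 p * (starRingEnd ℂ) (y.1 p)) -
    1 / (2 * (F.σ : ℂ)) * x.2 * (starRingEnd ℂ) y.2

/-- The derivative on `(p₀, p₁) ∪ (p₁, 0)` of a function which is weakly differentiable on each
of the two intervals. -/
def D (u : ℝ → ℂ) (p : ℝ) : ℂ :=
  if p < F.p₁ then weakDeriv (Ioo F.p₀ F.p₁) u p else weakDeriv (Ioo F.p₁ 0) u p

/-- The function `a³ u'`. -/
def flux (lam : ℝ) (u : ℝ → ℂ) (p : ℝ) : ℂ := (F.a lam p : ℂ) ^ 3 * F.D u p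

/-- The jump of `f` across the interface, `f(p₁⁺) - f(p₁⁻)`. -/
def jump (f : ℝ → ℂ) : ℂ := contRep F.p₁ 0 f F.p₁ - contRep F.p₀ F.p₁ f F.p₁

/-- The value at `p` of the continuous representative on `[p₀, 0]`. -/
def val (u : ℝ → ℂ) (p : ℝ) : ℂ := contRep F.p₀ 0 u p

/-- The domain of `K`: the pairs `(u, b)` with `u` in
`H²((p₀, p₁)) ∩ H²((p₁, 0)) ∩ C⁰`, `u(p₀) = u(0) = 0` and `σ u(p₁) = b`. -/
def InDomain (x : F.H) : Prop :=
  MemH2 (Ioo F.p₀ F.p₁) x.1 ∧ MemH2 (Ioo F.p₁ 0) x.1 ∧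
    ∃ U : ℝ → ℂ, ContinuousOn U (Icc F.p₀ 0) ∧ x.1 =ᵐ[volume.restrict (Ioo F.p₀ 0)] U ∧
      U F.p₀ = 0 ∧ U 0 = 0 ∧ F.σ * U F.p₁ = x.2

/-- The function `-(1 / a) (a³ u')'`. -/
def interior (lam : ℝ) (u : ℝ → ℂ) (p : ℝ) : ℂ :=
  -(1 / (F.a lam p : ℂ)) * F.D (F.flux lam u) p

/-- The number `2 ⟦a³ u'⟧ - 2 g ⟦ρ⟧ u(p₁)`. -/
def boundary (lam : ℝ) (u : ℝ → ℂ) : ℂ :=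
  2 * F.jump (F.flux lam u) - 2 * F.g * F.jumpρ * F.val u F.p₁

theorem p₀_neg : F.p₀ < 0 := F.p₀_lt_p₁.trans F.p₁_neg

theorem left_le : volume.restrict (Ioo F.p₀ F.p₁) ≤ volume.restrict (Ioo F.p₀ 0) :=
  Measure.restrict_mono (Ioo_subset_Ioo_right F.p₁_neg.le) le_rfl

theorem right_le : volume.restrict (Ioo F.p₁ 0) ≤ volume.restrict (Ioo F.p₀ 0) :=
  Measure.restrict_mono (Ioo_subset_Ioo_left F.p₀_lt_p₁.le) le_rfl

theorem ae_left {P : ℝ → Prop} (h : ∀ᵐ p ∂volume.restrict (Ioo F.p₀ 0), P p) :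
    ∀ᵐ p ∂volume.restrict (Ioo F.p₀ F.p₁), P p := ae_mono F.left_le h

theorem ae_right {P : ℝ → Prop} (h : ∀ᵐ p ∂volume.restrict (Ioo F.p₀ 0), P p) :
    ∀ᵐ p ∂volume.restrict (Ioo F.p₁ 0), P p := ae_mono F.right_le h

theorem restrict_eq : volume.restrict (Ioo F.p₀ 0) =
    volume.restrict (Ioo F.p₀ F.p₁) + volume.restrict (Ioo F.p₁ 0) := by
  rw [restrict_Ioo_eq_restrict_Ioc, ← Ioc_union_Ioc_eq_Ioc F.p₀_lt_p₁.le F.p₁_neg.le,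
    Measure.restrict_union (Ioc_disjoint_Ioc_of_le le_rfl) measurableSet_Ioc,
    restrict_Ioo_eq_restrict_Ioc, restrict_Ioo_eq_restrict_Ioc]

theorem ae_glue {P : ℝ → Prop} (h1 : ∀ᵐ p ∂volume.restrict (Ioo F.p₀ F.p₁), P p)
    (h2 : ∀ᵐ p ∂volume.restrict (Ioo F.p₁ 0), P p) :
    ∀ᵐ p ∂volume.restrict (Ioo F.p₀ 0), P p := by
  rw [F.restrict_eq, ae_add_measure_iff]
  exact ⟨h1, h2⟩

theorem D_left (u : ℝ → ℂ) :
    F.D u =ᵐ[volume.restrict (Ioo F.p₀ F.p₁)] weakDeriv (Ioo F.p₀ F.p₁) u := by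
  filter_upwards [ae_restrict_mem measurableSet_Ioo] with p hp
  simp [D, hp.2]

theorem D_right (u : ℝ → ℂ) :
    F.D u =ᵐ[volume.restrict (Ioo F.p₁ 0)] weakDeriv (Ioo F.p₁ 0) u := by
  filter_upwards [ae_restrict_mem measurableSet_Ioo] with p hp
  simp [D, hp.1.le]

theorem Γ_eq {p : ℝ} (hp : p ∈ Icc F.p₁ 0) : F.Γ p = √(F.Γ p ^ 2) :=
  (Real.sqrt_sq (F.Γ_pos p hp).le).symm

theorem Γ_cont : ContinuousOn F.Γ (Icc F.p₁ 0) := by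
  have h : ContinuousOn (fun p => √(F.Γ p ^ 2)) (Icc F.p₁ 0) :=
    ContinuousOn.sqrt fun p hp => (F.Γ_deriv p hp).continuousWithinAt
  exact h.congr fun p hp => F.Γ_eq hp

theorem Γ_hasDerivAt {p : ℝ} (hp : p ∈ Ioo F.p₁ 0) :
    HasDerivAt (fun s => F.Γ s ^ 3) (3 * F.γ (-p) * F.Γ p) p := by
  have hp' := Ioo_subset_Icc_self hp
  have hn : Icc F.p₁ 0 ∈ nhds p := Icc_mem_nhds hp.1 hp.2
  have h0 := F.Γ_pos p hp'
  have h1 : HasDerivAt (fun s => F.Γ s ^ 2) (2 * F.γ (-p)) p := (F.Γ_deriv p hp').hasDerivAt hn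
  have h2 := (h1.sqrt (by positivity)).pow 3
  have h3 : HasDerivAt (fun s => F.Γ s ^ 3) _ p := h2.congr_of_eventuallyEq (by
    filter_upwards [hn] with s hs
    simp only [Pi.pow_apply]
    rw [← F.Γ_eq hs])
  convert h3 using 1
  rw [← F.Γ_eq hp']
  have : F.Γ p ≠ 0 := h0.ne'
  field_simp
  ring

theorem a_left (lam : ℝ) : ∀ᵐ p ∂volume.restrict (Ioo F.p₀ F.p₁), F.a lam p = lam := by
  filter_upwards [ae_restrict_mem measurableSet_Ioo] with p hp
  simp [a, hp.2]

theorem a_right (lam : ℝ) : ∀ᵐ p ∂volume.restrict (Ioo F.p₁ 0), F.a lam p = F.Γ p := by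
  filter_upwards [ae_restrict_mem measurableSet_Ioo] with p hp
  simp [a, hp.1.le]

theorem flux_left_memH1 (lam : ℝ) {u : ℝ → ℂ} (hu : MemH2 (Ioo F.p₀ F.p₁) u) :
    MemH1 (Ioo F.p₀ F.p₁) (F.flux lam u) := by
  refine (hu.weakDeriv_memH1.smul ((lam : ℂ) ^ 3)).congr ?_
  filter_upwards [F.D_left u, F.a_left lam] with p h1 h2
  simp [flux, h1, h2]

theorem flux_right_memH1 (lam : ℝ) {u : ℝ → ℂ} (hu : MemH2 (Ioo F.p₁ 0) u) :
    MemH1 (Ioo F.p₁ 0) (F.flux lam u) := by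
  have h := hu.weakDeriv_memH1.mul_C1 F.p₁_neg (G := fun p => F.Γ p ^ 3)
    (G' := fun p => 3 * F.γ (-p) * F.Γ p) (F.Γ_cont.pow 3)
    ((continuousOn_const.mul (F.γ_cont.comp continuousOn_neg
      (fun p hp => ⟨by linarith [hp.2], by linarith [hp.1]⟩))).mul F.Γ_cont)
    (fun p hp => F.Γ_hasDerivAt hp)
  refine h.congr ?_
  filter_upwards [F.D_right u, F.a_right lam] with p h1 h2
  simp [flux, h1, h2]

theorem D_add {u v : ℝ → ℂ} (hu : MemH1 (Ioo F.p₀ F.p₁) u) (hu' : MemH1 (Ioo F.p₁ 0) u)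
    (hv : MemH1 (Ioo F.p₀ F.p₁) v) (hv' : MemH1 (Ioo F.p₁ 0) v) :
    F.D (u + v) =ᵐ[volume.restrict (Ioo F.p₀ 0)] F.D u + F.D v := by
  refine F.ae_glue ?_ ?_
  · filter_upwards [F.D_left (u + v), F.D_left u, F.D_left v, weakDeriv_add hu hv]
      with p h1 h2 h3 h4
    simp only [Pi.add_apply, h1, h2, h3, h4]
  · filter_upwards [F.D_right (u + v), F.D_right u, F.D_right v, weakDeriv_add hu' hv']
      with p h1 h2 h3 h4
    simp only [Pi.add_apply, h1, h2, h3, h4]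

theorem D_smul (c : ℂ) {u : ℝ → ℂ} (hu : MemH1 (Ioo F.p₀ F.p₁) u)
    (hu' : MemH1 (Ioo F.p₁ 0) u) :
    F.D (c • u) =ᵐ[volume.restrict (Ioo F.p₀ 0)] c • F.D u := by
  refine F.ae_glue ?_ ?_
  · filter_upwards [F.D_left (c • u), F.D_left u, weakDeriv_smul c hu] with p h1 h2 h3
    simp only [Pi.smul_apply, h1, h2, h3]
  · filter_upwards [F.D_right (c • u), F.D_right u, weakDeriv_smul c hu'] with p h1 h2 h3
    simp only [Pi.smul_apply, h1, h2, h3]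

theorem D_congr {u v : ℝ → ℂ} (h : u =ᵐ[volume.restrict (Ioo F.p₀ 0)] v) : F.D u = F.D v := by
  funext p
  simp only [D, weakDeriv_congr (F.ae_left h), weakDeriv_congr (F.ae_right h)]

theorem flux_congr (lam : ℝ) {u v : ℝ → ℂ} (h : u =ᵐ[volume.restrict (Ioo F.p₀ 0)] v) :
    F.flux lam u = F.flux lam v := by
  funext p
  simp only [flux, F.D_congr h]

theorem jump_congr {u v : ℝ → ℂ} (h : u =ᵐ[volume.restrict (Ioo F.p₀ 0)] v) :
    F.jump u = F.jump v := by
  simp only [jump, contRep_congr (F.ae_left h), contRep_congr (F.ae_right h)]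

theorem jump_add {u v : ℝ → ℂ} (hu : MemH1 (Ioo F.p₀ F.p₁) u) (hu' : MemH1 (Ioo F.p₁ 0) u)
    (hv : MemH1 (Ioo F.p₀ F.p₁) v) (hv' : MemH1 (Ioo F.p₁ 0) v) :
    F.jump (u + v) = F.jump u + F.jump v := by
  unfold jump
  rw [contRep_add F.p₁_neg (hu'.exists_contRep F.p₁_neg) (hv'.exists_contRep F.p₁_neg)
      (left_mem_Icc.2 F.p₁_neg.le),
    contRep_add F.p₀_lt_p₁ (hu.exists_contRep F.p₀_lt_p₁) (hv.exists_contRep F.p₀_lt_p₁)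
      (right_mem_Icc.2 F.p₀_lt_p₁.le)]
  simp only [Pi.add_apply]
  ring

theorem jump_smul (c : ℂ) {u : ℝ → ℂ} (hu : MemH1 (Ioo F.p₀ F.p₁) u)
    (hu' : MemH1 (Ioo F.p₁ 0) u) : F.jump (c • u) = c * F.jump u := by
  unfold jump
  rw [contRep_smul F.p₁_neg c (hu'.exists_contRep F.p₁_neg) (left_mem_Icc.2 F.p₁_neg.le),
    contRep_smul F.p₀_lt_p₁ c (hu.exists_contRep F.p₀_lt_p₁) (right_mem_Icc.2 F.p₀_lt_p₁.le)]
  simp only [Pi.smul_apply, smul_eq_mul]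
  ring

theorem flux_add (lam : ℝ) {u v : ℝ → ℂ} (hu : MemH2 (Ioo F.p₀ F.p₁) u)
    (hu' : MemH2 (Ioo F.p₁ 0) u) (hv : MemH2 (Ioo F.p₀ F.p₁) v) (hv' : MemH2 (Ioo F.p₁ 0) v) :
    F.flux lam (u + v) =ᵐ[volume.restrict (Ioo F.p₀ 0)] F.flux lam u + F.flux lam v := by
  filter_upwards [F.D_add hu.memH1 hu'.memH1 hv.memH1 hv'.memH1] with p h
  simp only [flux, Pi.add_apply, h]
  ring

theorem flux_smul (lam : ℝ) (c : ℂ) {u : ℝ → ℂ} (hu : MemH2 (Ioo F.p₀ F.p₁) u)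
    (hu' : MemH2 (Ioo F.p₁ 0) u) :
    F.flux lam (c • u) =ᵐ[volume.restrict (Ioo F.p₀ 0)] c • F.flux lam u := by
  filter_upwards [F.D_smul c hu.memH1 hu'.memH1] with p h
  simp only [flux, Pi.smul_apply, smul_eq_mul, h]
  ring

theorem interior_congr (lam : ℝ) {u v : ℝ → ℂ} (h : u =ᵐ[volume.restrict (Ioo F.p₀ 0)] v) :
    F.interior lam u = F.interior lam v := by
  funext p
  simp only [interior, F.flux_congr lam h]

theorem boundary_congr (lam : ℝ) {u v : ℝ → ℂ} (h : u =ᵐ[volume.restrict (Ioo F.p₀ 0)] v) :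
    F.boundary lam u = F.boundary lam v := by
  simp only [boundary, F.flux_congr lam h, val, contRep_congr h]

theorem interior_add (lam : ℝ) {u v : ℝ → ℂ} (hu : MemH2 (Ioo F.p₀ F.p₁) u)
    (hu' : MemH2 (Ioo F.p₁ 0) u) (hv : MemH2 (Ioo F.p₀ F.p₁) v) (hv' : MemH2 (Ioo F.p₁ 0) v) :
    F.interior lam (u + v) =ᵐ[volume.restrict (Ioo F.p₀ 0)]
      F.interior lam u + F.interior lam v := by
  filter_upwards [F.D_add (F.flux_left_memH1 lam hu) (F.flux_right_memH1 lam hu')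
    (F.flux_left_memH1 lam hv) (F.flux_right_memH1 lam hv')] with p h
  simp only [interior, Pi.add_apply, F.D_congr (F.flux_add lam hu hu' hv hv'), h]
  ring

theorem interior_smul (lam : ℝ) (c : ℂ) {u : ℝ → ℂ} (hu : MemH2 (Ioo F.p₀ F.p₁) u)
    (hu' : MemH2 (Ioo F.p₁ 0) u) :
    F.interior lam (c • u) =ᵐ[volume.restrict (Ioo F.p₀ 0)] c • F.interior lam u := by
  filter_upwards [F.D_smul c (F.flux_left_memH1 lam hu) (F.flux_right_memH1 lam hu')] with p h
  simp only [interior, Pi.smul_apply, smul_eq_mul, F.D_congr (F.flux_smul lam c hu hu'), h]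
  ring

theorem memLp_interior (lam : ℝ) {u : ℝ → ℂ} (hu : MemH2 (Ioo F.p₀ F.p₁) u)
    (hu' : MemH2 (Ioo F.p₁ 0) u) :
    MemLp (F.interior lam u) 2 (volume.restrict (Ioo F.p₀ 0)) := by
  rw [F.restrict_eq]
  have h1 : MemLp (F.interior lam u) 2 (volume.restrict (Ioo F.p₀ F.p₁)) := by
    refine ((weakDeriv_spec (F.flux_left_memH1 lam hu).2).1.const_smul (-(1 / (lam : ℂ)))).ae_eq ?_
    filter_upwards [F.D_left (F.flux lam u), F.a_left lam] with p h1 h2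
    simp [interior, h1, h2]
  have h2 : MemLp (F.interior lam u) 2 (volume.restrict (Ioo F.p₁ 0)) := by
    have hc : ContinuousOn (fun p => -(1 / (F.Γ p : ℂ))) (Icc F.p₁ 0) := by
      refine (continuousOn_const.div
        (Complex.continuous_ofReal.comp_continuousOn F.Γ_cont) fun p hp => ?_).neg
      simpa using (F.Γ_pos p hp).ne'
    obtain ⟨C, hC⟩ := isCompact_Icc.exists_bound_of_continuousOn hc
    have ht : MemLp (fun p => -(1 / (F.Γ p : ℂ))) ⊤ (volume.restrict (Ioo F.p₁ 0)) := by
      refine memLp_top_of_bound ((hc.mono Ioo_subset_Icc_self).aestronglyMeasurable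
        measurableSet_Ioo) C ?_
      filter_upwards [ae_restrict_mem measurableSet_Ioo] with x hx
      exact hC x (Ioo_subset_Icc_self hx)
    refine ((weakDeriv_spec (F.flux_right_memH1 lam hu').2).1.smul (r := 2) ht).ae_eq ?_
    filter_upwards [F.D_right (F.flux lam u), F.a_right lam] with p h1 h2
    simp [interior, h1, h2]
  refine ⟨h1.1.add_measure h2.1, ?_⟩
  have k1 := (eLpNorm_lt_top_iff_lintegral_rpow_enorm_lt_top (by simp) (by simp)).1 h1.2
  have k2 := (eLpNorm_lt_top_iff_lintegral_rpow_enorm_lt_top (by simp) (by simp)).1 h2.2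
  rw [eLpNorm_lt_top_iff_lintegral_rpow_enorm_lt_top (by simp) (by simp), lintegral_add_measure]
  exact ENNReal.add_lt_top.2 ⟨k1, k2⟩

theorem InDomain.exists_rep {F : Flow} {x : F.H} (h : F.InDomain x) :
    ∃ U, ContinuousOn U (Icc F.p₀ 0) ∧ x.1 =ᵐ[volume.restrict (Ioo F.p₀ 0)] U :=
  h.2.2.imp fun _ hU => ⟨hU.1, hU.2.1⟩

theorem boundary_add (lam : ℝ) {x y : F.H} (hx : F.InDomain x) (hy : F.InDomain y) :
    F.boundary lam (x.1 + y.1 : ℝ → ℂ) = F.boundary lam x.1 + F.boundary lam y.1 := by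
  unfold boundary val
  rw [F.jump_congr (F.flux_add lam hx.1 hx.2.1 hy.1 hy.2.1),
    F.jump_add (F.flux_left_memH1 lam hx.1) (F.flux_right_memH1 lam hx.2.1)
      (F.flux_left_memH1 lam hy.1) (F.flux_right_memH1 lam hy.2.1),
    contRep_add F.p₀_neg hx.exists_rep hy.exists_rep ⟨F.p₀_lt_p₁.le, F.p₁_neg.le⟩]
  simp only [Pi.add_apply]
  ring

theorem boundary_smul (lam : ℝ) (c : ℂ) {x : F.H} (hx : F.InDomain x) :
    F.boundary lam (c • x.1 : ℝ → ℂ) = c * F.boundary lam x.1 := by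
  unfold boundary val
  rw [F.jump_congr (F.flux_smul lam c hx.1 hx.2.1),
    F.jump_smul c (F.flux_left_memH1 lam hx.1) (F.flux_right_memH1 lam hx.2.1),
    contRep_smul F.p₀_neg c hx.exists_rep ⟨F.p₀_lt_p₁.le, F.p₁_neg.le⟩]
  simp only [Pi.smul_apply, smul_eq_mul]
  ring

theorem inDomain_add {x y : F.H} (hx : F.InDomain x) (hy : F.InDomain y) :
    F.InDomain (x + y) := by
  have e : ((x + y).1 : ℝ → ℂ) =ᵐ[volume.restrict (Ioo F.p₀ 0)] (x.1 + y.1 : ℝ → ℂ) :=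
    Lp.coeFn_add x.1 y.1
  obtain ⟨hx1, hx2, U, hU, hxU, hU0, hU1, hUb⟩ := hx
  obtain ⟨hy1, hy2, V, hV, hyV, hV0, hV1, hVb⟩ := hy
  refine ⟨(hx1.add hy1).congr (F.ae_left e.symm), (hx2.add hy2).congr (F.ae_right e.symm),
    U + V, hU.add hV, e.trans (hxU.add hyV), by simp [hU0, hV0], by simp [hU1, hV1], ?_⟩
  simp only [Pi.add_apply, mul_add, hUb, hVb, Prod.snd_add]

theorem inDomain_smul (c : ℂ) {x : F.H} (hx : F.InDomain x) : F.InDomain (c • x) := by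
  have e : ((c • x).1 : ℝ → ℂ) =ᵐ[volume.restrict (Ioo F.p₀ 0)] (c • x.1 : ℝ → ℂ) :=
    Lp.coeFn_smul c x.1
  obtain ⟨hx1, hx2, U, hU, hxU, hU0, hU1, hUb⟩ := hx
  refine ⟨(hx1.smul c).congr (F.ae_left e.symm), (hx2.smul c).congr (F.ae_right e.symm),
    c • U, hU.const_smul c, e.trans (hxU.const_smul c), by simp [hU0], by simp [hU1], ?_⟩
  simp only [Pi.smul_apply, smul_eq_mul, Prod.smul_snd, ← hUb]
  ring

theorem inDomain_zero : F.InDomain 0 := by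
  have e : ((0 : F.H).1 : ℝ → ℂ) =ᵐ[volume.restrict (Ioo F.p₀ 0)] 0 := Lp.coeFn_zero _ _ _
  exact ⟨memH2_zero.congr (F.ae_left e.symm), memH2_zero.congr (F.ae_right e.symm), 0,
    continuousOn_const, e, rfl, rfl, by simp⟩

/-- The operator `K (u, b) = (-(1 / a) (a³ u')', 2 ⟦a³ u'⟧ - 2 g ⟦ρ⟧ u(p₁))`. -/
def K (lam : ℝ) : F.H →ₗ.[ℂ] F.H where
  domain :=
    { carrier := {x | F.InDomain x}
      add_mem' := F.inDomain_add
      zero_mem' := F.inDomain_zero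
      smul_mem' := fun c _ hx => F.inDomain_smul c hx }
  toFun :=
    { toFun := fun x =>
        ((F.memLp_interior lam x.2.1 x.2.2.1).toLp (F.interior lam x.1.1),
          F.boundary lam x.1.1)
      map_add' := by
        intro x y
        have e : ((x + y).1.1 : ℝ → ℂ) =ᵐ[volume.restrict (Ioo F.p₀ 0)]
          (x.1.1 + y.1.1 : ℝ → ℂ) := Lp.coeFn_add x.1.1 y.1.1
        refine Prod.ext ?_ ?_
        · simp only [Prod.fst_add]
          rw [← MemLp.toLp_add, MemLp.toLp_eq_toLp_iff, F.interior_congr lam e]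
          exact F.interior_add lam x.2.1 x.2.2.1 y.2.1 y.2.2.1
        · simp only [Prod.snd_add]
          rw [F.boundary_congr lam e]
          exact F.boundary_add lam x.2 y.2
      map_smul' := by
        intro c x
        have e : ((c • x).1.1 : ℝ → ℂ) =ᵐ[volume.restrict (Ioo F.p₀ 0)]
          (c • x.1.1 : ℝ → ℂ) := Lp.coeFn_smul c x.1.1
        refine Prod.ext ?_ ?_
        · simp only [Prod.smul_fst, RingHom.id_apply]
          rw [← MemLp.toLp_const_smul, MemLp.toLp_eq_toLp_iff, F.interior_congr lam e]
          exact F.interior_smul lam c x.2.1 x.2.2.1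
        · simp only [Prod.smul_snd, RingHom.id_apply, smul_eq_mul]
          rw [F.boundary_congr lam e]
          exact F.boundary_smul lam c x.2 }

end Flow
end

end WindWave

namespace WindWave

noncomputable section

/-! ### Symmetric operators in a space with an indefinite inner product -/

section Indefinite

open Filter Topology ComplexConjugate

variable {E : Type*} [AddCommGroup E] [Module ℂ E] {B : E →ₗ[ℂ] E →ₗ⋆[ℂ] ℂ}

/-! The form has one negative square: the functional `β` that reads off the component in `ℂ` has a
kernel on which the form is positive. Hence `β` is injective on every non-positive subspace, so such
a subspace is at most a line, and two orthogonal non-positive vectors are dependent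
(`smul_eq_smul_of_nonpos`). Most of the abstract part is this remark combined with the symmetry of
the operator.

Self-adjointness rests on solving a boundary value problem. Let L be `K` plus the rank-one gravity
term, so that L(u, b) = (-(1/a)(a³u')', 2⟦a³u'⟧). Two integrations give an explicit solution of L(u,
b) = h in terms of h and of the flux k at the bed, and the condition at the lid fixes k; so L is
onto. Integration by parts turns [Lu, v] into the integral of a³u' times the conjugate of v', so L
is symmetric (`form_source_symm`). A symmetric operator that is onto, in a space with a
nondegenerate form, is densely defined and equals its adjoint, and the symmetric gravity term does
no harm.

The invariant line is spanned by a non-positive eigenvector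
(`exists_nonpos_eigenvector_of_selfAdjoint`, the index-one case of Pontryagin's theorem). Compress
the operator to finite-dimensional subspaces of its domain which contain a fixed negative vector;
each compression has a non-positive eigenvector, which may be scaled to `β` = 1. These vectors are
bounded, so they converge weakly along an ultrafilter, and the limit is not zero since `β` = 1
persists. Their eigenvalues stay bounded, because otherwise the limit would be orthogonal to the
domain. Thus the limit is a weak eigenvector, and self-adjointness makes it a genuine one. It is
non-positive because the form is non-negative on the differences, which `β` kills.

Geometric simplicity is uniqueness for an initial value problem: an eigenfunction vanishes at the
bed and is determined by its flux there (`IsSol.eq_zero_of_eigen`). Algebraic simplicity excludes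
Jordan chains of length two: if the eigenvector is not neutral, pair the chain with it; if the
eigenvalue is not real, the chain would consist of mutually orthogonal neutral vectors, hence of
dependent ones.

For positivity, [Ku, u] equals the energy ∫ a³|u'|² plus g⟦ρ⟧|u(p₁)|², and the Cauchy–Schwarz
inequality in the water bounds λ³|u(p₁)|² by p₁ - p₀ times the energy. For a positive operator no
eigenvector is neutral, and eigenvectors for distinct negative eigenvalues would be orthogonal
negative vectors; so the non-positive eigenvector accounts for the only negative eigenvalue. -/

theorem form_eq_zero_symm (hB : ∀ x y, conj (B x y) = B y x) {x y : E} (h : B x y = 0) :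
    B y x = 0 := by
  rw [← hB, h, map_zero]

theorem form_comb_of_orthogonal (hB : ∀ x y, conj (B x y) = B y x) {x y : E} (hxy : B x y = 0)
    (c d : ℂ) : (B (c • x + d • y) (c • x + d • y)).re =
      Complex.normSq c * (B x x).re + Complex.normSq d * (B y y).re := by
  have hyx := form_eq_zero_symm hB hxy
  have e : B (c • x + d • y) (c • x + d • y) =
      (Complex.normSq c : ℂ) * B x x + (Complex.normSq d : ℂ) * B y y := by
    rw [Complex.normSq_eq_conj_mul_self, Complex.normSq_eq_conj_mul_self]
    simp [hxy, hyx]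
    ring
  rw [e, Complex.add_re, Complex.re_ofReal_mul, Complex.re_ofReal_mul]

/-- A symmetric endomorphism of a finite-dimensional space which contains a non-positive vector
has a non-positive eigenvector. -/
theorem exists_nonpos_eigenvector (hB : ∀ x y, conj (B x y) = B y x) {S : Module.End ℂ E}
    (hS : ∀ x y, B (S x) y = B x (S y)) (n : ℕ) :
    ∀ W : Submodule ℂ E, FiniteDimensional ℂ W → Module.finrank ℂ W ≤ n →
      (∀ x ∈ W, S x ∈ W) → (∃ v ∈ W, v ≠ 0 ∧ (B v v).re ≤ 0) →
      ∃ x ∈ W, x ≠ 0 ∧ (B x x).re ≤ 0 ∧ ∃ ν : ℂ, S x = ν • x := by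
  induction n with
  | zero =>
    rintro W _ hn - ⟨v, hv, hv0, -⟩
    have : W = ⊥ := Submodule.finrank_eq_zero.1 (Nat.le_zero.1 hn)
    rw [this, Submodule.mem_bot] at hv
    exact absurd hv hv0
  | succ n ih =>
    rintro W hW hn hSW ⟨v, hv, hv0, hvB⟩
    have : Nontrivial W := ⟨⟨v, hv⟩, 0, fun h => hv0 (congrArg Subtype.val h)⟩
    obtain ⟨ν, hν⟩ := Module.End.exists_eigenvalue (S.restrict hSW)
    obtain ⟨x, hx⟩ := hν.exists_hasEigenvector
    have hxS : S x = ν • (x : E) := congrArg Subtype.val hx.apply_eq_smul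
    have hx0 : (x : E) ≠ 0 := fun h => hx.2 (Subtype.ext h)
    rcases le_or_gt (B x x).re 0 with hle | hlt
    · exact ⟨x, x.2, hx0, hle, ν, hxS⟩
    have hxx : B x x ≠ 0 := fun h => by simp [h] at hlt
    -- If the eigenvector x is positive, its orthogonal complement in W is invariant by symmetry and
    -- of smaller dimension; the induction continues there.
    have hle : W ⊓ LinearMap.ker (B.flip x) ≤ W := inf_le_left
    have hfin : FiniteDimensional ℂ (W ⊓ LinearMap.ker (B.flip x) : Submodule ℂ E) :=
      Submodule.finiteDimensional_of_le hle
    have hltW : W ⊓ LinearMap.ker (B.flip x) < W := by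
      refine lt_of_le_of_ne hle fun h => hxx ?_
      have : (x : E) ∈ W ⊓ LinearMap.ker (B.flip x) := by rw [h]; exact x.2
      exact this.2
    obtain ⟨y, hy, h1⟩ := ih (W ⊓ LinearMap.ker (B.flip x)) hfin
      (by have := Submodule.finrank_lt_finrank_of_lt hltW; omega)
      (fun y hy => ⟨hSW y hy.1, by
        have : B y x = 0 := hy.2
        change B (S y) x = 0
        rw [hS, hxS, LinearMap.map_smulₛₗ, this, smul_zero]⟩)
      (by
        -- Subtracting the projection onto the positive vector x only lowers [v, v]. The difference
        -- is not zero, since a non-zero multiple of x would be positive.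
        set c := B v x / B x x with hc
        have hcx : B (v - c • (x : E)) x = 0 := by
          simp [hc, hxx]
        refine ⟨v - c • (x : E), ⟨W.sub_mem hv (W.smul_mem c x.2), hcx⟩, fun h => ?_, ?_⟩
        · rw [sub_eq_zero] at h
          have e : B v v = (Complex.normSq c : ℂ) * B x x := by
            rw [h, Complex.normSq_eq_conj_mul_self]
            simp
            ring
          have hcc : c ≠ 0 := fun h' => hv0 (by rw [h, h', zero_smul])
          rw [e, Complex.re_ofReal_mul] at hvB
          have := mul_pos (Complex.normSq_pos.2 hcc) hlt
          linarith
        · have e := form_comb_of_orthogonal hB hcx 1 c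
          rw [one_smul, sub_add_cancel, map_one, one_mul] at e
          have := mul_nonneg (Complex.normSq_nonneg c) hlt.le
          linarith)
    exact ⟨y, hy.1, h1⟩

/-! ### Galerkin compressions and Pontryagin's theorem for index one -/

variable {T : E →ₗ.[ℂ] E}

/-- The Galerkin approximation of a symmetric operator on a finite-dimensional subspace of its
domain has a non-positive eigenvector. -/
theorem exists_galerkin_eigenvector (hB : ∀ x y, conj (B x y) = B y x)
    (hT : ∀ u v : T.domain, B (T u) v = B u (T v)) (V : Submodule ℂ T.domain)
    [FiniteDimensional ℂ V]
    (hV : ∀ v ∈ V, (∀ y ∈ V, B (v : E) (y : E) = 0) → v = 0)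
    (hn : ∃ v ∈ V, v ≠ 0 ∧ (B (v : E) (v : E)).re ≤ 0) :
    ∃ x ∈ V, x ≠ 0 ∧ (B (x : E) (x : E)).re ≤ 0 ∧
      ∃ μ : ℂ, ∀ y ∈ V, B (T x) (y : E) = μ * B (x : E) (y : E) := by
  let b := Module.finBasis ℂ V
  let ΦB : V →ₗ[ℂ] (Fin (Module.finrank ℂ V) → ℂ) :=
    LinearMap.pi fun i => (B.flip (b i : T.domain)) ∘ₗ T.domain.subtype ∘ₗ V.subtype
  let ΦC : V →ₗ[ℂ] (Fin (Module.finrank ℂ V) → ℂ) :=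
    LinearMap.pi fun i => (B.flip (b i : T.domain)) ∘ₗ T.toFun ∘ₗ V.subtype
  have hspan : ∀ z : E, (∀ i, B z ((b i : T.domain) : E) = 0) →
      ∀ y : V, B z ((y : T.domain) : E) = 0 := by
    intro z hz y
    have : (B z).comp (T.domain.subtype ∘ₗ V.subtype) = 0 := b.ext hz
    exact LinearMap.congr_fun this y
  have hinj : Function.Injective ΦB := by
    rw [← LinearMap.ker_eq_bot, LinearMap.ker_eq_bot']
    intro v hv
    refine Subtype.ext (hV v v.2 fun y hy => ?_)
    exact hspan _ (fun i => congrFun hv i) ⟨y, hy⟩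
  -- The form is nondegenerate on V, so the Gram map `ΦB` is invertible; composing its inverse with
  -- the pairing of T x against the basis gives the compression `S` of T to V.
  let e : V ≃ₗ[ℂ] (Fin (Module.finrank ℂ V) → ℂ) :=
    LinearEquiv.ofInjectiveOfFinrankEq ΦB hinj (by simp)
  let S : Module.End ℂ V := e.symm.toLinearMap ∘ₗ ΦC
  have hSB : ∀ x y : V, B ((S x : T.domain) : E) ((y : T.domain) : E) =
      B (T x) ((y : T.domain) : E) := by
    intro x y
    have h1 : ΦB (S x) = ΦC x := e.apply_symm_apply (ΦC x)
    have := hspan (((S x : T.domain) : E) - T x) (fun i => by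
      have := congrFun h1 i
      rw [map_sub, LinearMap.sub_apply, sub_eq_zero]
      exact this) y
    rwa [map_sub, LinearMap.sub_apply, sub_eq_zero] at this
  let BV : V →ₗ[ℂ] V →ₗ⋆[ℂ] ℂ := LinearMap.mk₂'ₛₗ (RingHom.id ℂ) (starRingEnd ℂ)
    (fun x y => B ((x : T.domain) : E) ((y : T.domain) : E)) (by simp) (by simp) (by simp) (by simp)
  obtain ⟨v, hv, hv0, hvB⟩ := hn
  obtain ⟨x, -, hx0, hxB, ν, hν⟩ := exists_nonpos_eigenvector (B := BV) (S := S)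
    (fun x y => hB _ _)
    (fun x y => by
      change B ((S x : T.domain) : E) ((y : T.domain) : E) =
        B ((x : T.domain) : E) ((S y : T.domain) : E)
      rw [hSB, hT, ← hB, ← hSB, hB]) _ ⊤ inferInstance le_rfl (fun _ _ => trivial)
    ⟨⟨v, hv⟩, trivial, fun h => hv0 (congrArg Subtype.val h), hvB⟩
  refine ⟨x, x.2, fun h => hx0 (Subtype.ext h), hxB, ν, fun y hy => ?_⟩
  have := hSB x ⟨y, hy⟩
  rw [← this, hν]
  simp

variable {β : E →ₗ[ℂ] ℂ}

/-- The form in which index one is used throughout: `β` detects non-positive vectors, so a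
combination of such vectors that stays non-positive vanishes as soon as `β` kills it. -/
theorem eq_zero_of_nonpos (hβ : ∀ x, x ≠ 0 → β x = 0 → 0 < (B x x).re) {x : E}
    (h : β x = 0) (hx : (B x x).re ≤ 0) : x = 0 := by
  by_contra h0
  exact not_lt.2 hx (hβ x h0 h)

/-- Orthogonal non-positive vectors are linearly dependent. -/
theorem smul_eq_smul_of_nonpos (hB : ∀ x y, conj (B x y) = B y x)
    (hβ : ∀ x, x ≠ 0 → β x = 0 → 0 < (B x x).re) {x y : E}
    (hx : (B x x).re ≤ 0) (hy : (B y y).re ≤ 0) (hxy : B x y = 0) : β y • x = β x • y := by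
  -- This combination is killed by `β`, and orthogonality keeps it non-positive.
  have h := eq_zero_of_nonpos hβ (x := β y • x + (-β x) • y) (by simp; ring) (by
    rw [form_comb_of_orthogonal hB hxy]
    have h1 := mul_nonneg (Complex.normSq_nonneg (β y)) (neg_nonneg.2 hx)
    have h2 := mul_nonneg (Complex.normSq_nonneg (-β x)) (neg_nonneg.2 hy)
    linarith)
  rwa [neg_smul, ← sub_eq_add_neg, sub_eq_zero] at h

/-- A self-adjoint operator in a space whose indefinite inner product has one negative square has
a non-positive eigenvector. -/
theorem exists_nonpos_eigenvector_of_selfAdjoint (hB : ∀ x y, conj (B x y) = B y x)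
    (hβ : ∀ x, x ≠ 0 → β x = 0 → 0 < (B x x).re)
    (hw : ∀ (𝓤 : Ultrafilter (Finset T.domain)) (x : Finset T.domain → E),
      (∀ i, β (x i) = 1) → (∀ i, (B (x i) (x i)).re ≤ 0) →
      ∃ y, β y = 1 ∧ ∀ v, Tendsto (fun i => B (x i) v) 𝓤 (𝓝 (B y v)))
    (hT : ∀ u v : T.domain, B (T u) v = B u (T v))
    (hsa : ∀ y w, (∀ u : T.domain, B (T u) y = B u w) → ∃ u : T.domain, (u : E) = y ∧ T u = w)
    (hd : ∀ x, (∀ u : T.domain, B x u = 0) → x = 0)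
    (hn : ∃ n : T.domain, (B (n : E) (n : E)).re < 0) :
    ∃ x : T.domain, (x : E) ≠ 0 ∧ (B (x : E) (x : E)).re ≤ 0 ∧ ∃ μ : ℂ, T x = μ • (x : E) := by
  obtain ⟨n, hn⟩ := hn
  have hβn : β (n : E) ≠ 0 := by
    intro h
    have := eq_zero_of_nonpos hβ h hn.le
    rw [this] at hn
    simp at hn
  have hn0 : n ≠ 0 := by
    rintro rfl
    simp at hn
  -- The Galerkin step. The negative vector n is added to every subspace in order to make the form
  -- nondegenerate there and to provide a non-positive vector.
  have hex : ∀ s : Finset T.domain, ∃ x : E, ∃ μ : ℂ, β x = 1 ∧ (B x x).re ≤ 0 ∧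
      ∀ y ∈ s, B x (T y) = μ * B x y := by
    intro s
    have hfin : (insert n (s : Set T.domain)).Finite := s.finite_toSet.insert n
    have : FiniteDimensional ℂ (Submodule.span ℂ (insert n (s : Set T.domain))) :=
      FiniteDimensional.span_of_finite ℂ hfin
    have hnV : n ∈ Submodule.span ℂ (insert n (s : Set T.domain)) :=
      Submodule.subset_span (mem_insert _ _)
    obtain ⟨x, hx, hx0, hxB, μ, hμ⟩ := exists_galerkin_eigenvector hB hT
      (Submodule.span ℂ (insert n (s : Set T.domain)))
      -- A vector v in the radical is neutral and orthogonal to n, hence dependent with n; pairing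
      -- the relation with n gives β(v) = 0, so v = 0.
      (fun v hv h => by
        have h1 : B (v : E) (v : E) = 0 := h v hv
        have h2 : B (v : E) (n : E) = 0 := h n hnV
        have h3 := smul_eq_smul_of_nonpos hB hβ (by simp [h1]) hn.le h2
        have h4 : β (v : E) * B (n : E) (n : E) = 0 := by
          have := congrArg (fun z => B z (n : E)) h3
          simpa [h2] using this.symm
        have h5 : B (n : E) (n : E) ≠ 0 := fun h => by simp [h] at hn
        have h6 : β (v : E) = 0 := (mul_eq_zero.1 h4).resolve_right h5
        exact Subtype.ext (eq_zero_of_nonpos hβ h6 (by simp [h1])))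
      ⟨n, hnV, hn0, hn.le⟩
    have hβx : β (x : E) ≠ 0 := fun h => hx0 (Subtype.ext (eq_zero_of_nonpos hβ h hxB))
    refine ⟨(β (x : E))⁻¹ • (x : E), μ, by simp [hβx], ?_, fun y hy => ?_⟩
    · have := form_comb_of_orthogonal hB (x := (x : E)) (y := 0) (by simp) (β (x : E))⁻¹ 0
      simp only [smul_zero, add_zero, map_zero, zero_mul] at this
      rw [this]
      exact mul_nonpos_of_nonneg_of_nonpos (Complex.normSq_nonneg _) hxB
    · have := hμ y (Submodule.subset_span (mem_insert_of_mem _ hy))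
      rw [map_smul, LinearMap.smul_apply, LinearMap.smul_apply, ← hT, this, smul_eq_mul,
        smul_eq_mul]
      ring
  choose x μ h1 h2 h3 using hex
  -- Every fixed v in the domain lies in all sufficiently large s, so the Galerkin equation tested
  -- against v holds eventually along the ultrafilter.
  let 𝓤 : Ultrafilter (Finset T.domain) := Ultrafilter.of atTop
  have hU : (𝓤 : Filter (Finset T.domain)) ≤ atTop := Ultrafilter.of_le atTop
  obtain ⟨y, hy1, hy⟩ := hw 𝓤 x h1 h2
  have hy0 : y ≠ 0 := by
    rintro rfl
    simp at hy1
  have hev : ∀ v : T.domain, ∀ᶠ s in (𝓤 : Filter (Finset T.domain)),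
      B (x s) (T v) = μ s * B (x s) v := by
    intro v
    refine hU ?_
    filter_upwards [eventually_ge_atTop ({v} : Finset T.domain)] with s hs
    exact h3 s v (hs (Finset.mem_singleton_self v))
  -- Along an ultrafilter unbounded means tending to infinity. Dividing the Galerkin equation by the
  -- eigenvalue would then make the limit y orthogonal to the domain, against y ≠ 0.
  have hμ : ∃ R : ℝ, ∀ᶠ s in (𝓤 : Filter (Finset T.domain)), ‖μ s‖ ≤ R := by
    by_contra hcon
    simp only [not_exists, ← Ultrafilter.eventually_not, not_le] at hcon
    have hinf : Tendsto (fun s => ‖μ s‖) 𝓤 atTop :=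
      tendsto_atTop.2 fun R => (hcon R).mono fun s hs => hs.le
    have hinv : Tendsto (fun s => (μ s)⁻¹) 𝓤 (𝓝 0) := by
      rw [tendsto_zero_iff_norm_tendsto_zero]
      simp only [norm_inv]
      exact hinf.inv_tendsto_atTop
    refine hy0 (hd y fun v => tendsto_nhds_unique (hy v) ?_)
    have hlim := hinv.mul (hy (T v))
    rw [zero_mul] at hlim
    refine hlim.congr' ?_
    filter_upwards [hev v, hcon 0] with s hs hs0
    have : μ s ≠ 0 := norm_pos_iff.1 hs0
    rw [hs]
    field_simp
  obtain ⟨R, hR⟩ := hμ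
  obtain ⟨ν, -, hν⟩ := (isCompact_closedBall (0 : ℂ) R).ultrafilter_le_nhds (𝓤.map μ) (by
    rw [Filter.le_principal_iff, Ultrafilter.coe_map, Filter.mem_map]
    filter_upwards [hR] with s hs
    simpa using hs)
  have hν' : Tendsto μ 𝓤 (𝓝 ν) := hν
  have hlim : ∀ v : T.domain, B y (T v) = ν * B y v := fun v =>
    tendsto_nhds_unique (hy (T v))
      ((hν'.mul (hy v)).congr' ((hev v).mono fun s hs => hs.symm))
  -- The limit equation says that (y, ν y) lies in the graph of the adjoint, which is the graph of
  -- T.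
  obtain ⟨u, hu, hTu⟩ := hsa y (ν • y) fun v => by
    rw [← hB, hlim v]
    simp [hB]
  refine ⟨u, by rwa [hu], ?_, ν, by rw [hTu, hu]⟩
  rw [hu]
  have hre : Tendsto (fun s => 2 * (B (x s) y).re) 𝓤 (𝓝 (2 * (B y y).re)) :=
    ((Complex.continuous_re.tendsto _).comp (hy y)).const_mul 2
  -- Expand 0 ≤ [x_s - y, x_s - y], valid because β(x_s - y) = 0, and drop [x_s, x_s] ≤ 0. In the
  -- limit 2[y, y] ≤ [y, y], that is, [y, y] ≤ 0.
  have hle : 2 * (B y y).re ≤ (B y y).re := by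
    refine le_of_tendsto hre (Eventually.of_forall fun s => ?_)
    have hnn : 0 ≤ (B (x s - y) (x s - y)).re := by
      by_cases h0 : x s - y = 0
      · simp [h0]
      · exact (hβ _ h0 (by rw [map_sub, h1, hy1, sub_self])).le
    have e : (B (x s - y) (x s - y)).re =
        (B (x s) (x s)).re - 2 * (B (x s) y).re + (B y y).re := by
      have : (B y (x s)).re = (B (x s) y).re := by rw [← hB, Complex.conj_re]
      simp only [map_sub, LinearMap.sub_apply, Complex.sub_re, this]
      ring
    have := h2 s
    linarith
  linarith

end Indefinite

/-! ### Simplicity, maximal non-positive subspaces and positive operators in index one -/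

section Indefinite

open Filter Topology ComplexConjugate

variable {E : Type*} [AddCommGroup E] [Module ℂ E] {B : E →ₗ[ℂ] E →ₗ⋆[ℂ] ℂ}
  {T : E →ₗ.[ℂ] E} {β : E →ₗ[ℂ] ℂ} {μ : ℂ}

/-- Without Jordan chains of length two, the generalized eigenspaces never grow beyond the
eigenspace. -/
theorem isAlgSimple_of_isGeomSimple (hg : IsGeomSimple T μ)
    (h : ∀ y : T.domain, T y - μ • (y : E) ∈ eigenspace T μ → T y = μ • (y : E)) :
    IsAlgSimple T μ := by
  have key : ∀ n, genEigenspace T μ n ≤ eigenspace T μ := by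
    intro n
    induction n with
    | zero => exact bot_le
    | succ n ih =>
      intro x hx
      obtain ⟨u, hu, hu'⟩ := (mem_genEigenspace_succ T μ n x).1 hx
      exact (mem_eigenspace T μ x).2 ⟨u, hu, h u (ih hu')⟩
  have : (⨆ n, genEigenspace T μ n) = eigenspace T μ :=
    le_antisymm (iSup_le key) (le_iSup (genEigenspace T μ) 1)
  unfold IsAlgSimple
  rw [this]
  exact hg

theorem IsGeomSimple.exists_smul_eq (hg : IsGeomSimple T μ) {x y : E}
    (hx : x ∈ eigenspace T μ) (hx0 : x ≠ 0) (hy : y ∈ eigenspace T μ) : ∃ c : ℂ, c • x = y := by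
  obtain ⟨c, hc⟩ := (finrank_eq_one_iff_of_nonzero' (⟨x, hx⟩ : eigenspace T μ)
    (fun h => hx0 (congrArg Subtype.val h))).1 hg ⟨y, hy⟩
  exact ⟨c, congrArg Subtype.val hc⟩

/-- An eigenvector which is not neutral belongs to a real eigenvalue. -/
theorem im_eq_zero_of_form_ne_zero
    (hT : ∀ u v : T.domain, B (T u) v = B u (T v)) {x : T.domain} (hx : T x = μ • (x : E))
    (h : B (x : E) (x : E) ≠ 0) : μ.im = 0 := by
  have h1 := hT x x
  rw [hx, map_smul, LinearMap.smul_apply, LinearMap.map_smulₛₗ, smul_eq_mul, smul_eq_mul] at h1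
  exact Complex.conj_eq_iff_im.1 (mul_right_cancel₀ h h1).symm

/-- The eigenvalue is real, so the range of T - μ is orthogonal to the eigenvector x. A chain (T -
μ)y = c x then gives c[x, x] = 0, whence c = 0. -/
theorem isAlgSimple_of_form_ne_zero
    (hT : ∀ u v : T.domain, B (T u) v = B u (T v)) (hg : IsGeomSimple T μ) {x : E}
    (hx : x ∈ eigenspace T μ) (h : B x x ≠ 0) : IsAlgSimple T μ := by
  obtain ⟨u, rfl, hu⟩ := (mem_eigenspace T μ x).1 hx
  have hx0 : (u : E) ≠ 0 := by
    intro h0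
    simp [h0] at h
  have hμ : conj μ = μ := Complex.conj_eq_iff_im.2 (im_eq_zero_of_form_ne_zero hT hu h)
  refine isAlgSimple_of_isGeomSimple hg fun y hy => ?_
  obtain ⟨c, hc⟩ := hg.exists_smul_eq hx hx0 hy
  have e : B (T y - μ • (y : E)) (u : E) = 0 := by
    rw [map_sub, LinearMap.sub_apply, hT, hu]
    simp [hμ]
  rw [← hc, map_smul, LinearMap.smul_apply, smul_eq_mul] at e
  rw [(mul_eq_zero.1 e).resolve_right h, zero_smul] at hc
  exact sub_eq_zero.1 hc.symm

/-- For a chain (T - μ)y = x, symmetry and μ ≠ μ̄ give in turn [x, x] = 0, [y, x] = 0 and [y, y] =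
0. If x ≠ 0, index one makes y a multiple of x, hence an eigenvector, and then x = (T - μ)y = 0. -/
theorem isAlgSimple_of_im_ne_zero (hB : ∀ x y, conj (B x y) = B y x)
    (hβ : ∀ x, x ≠ 0 → β x = 0 → 0 < (B x x).re)
    (hT : ∀ u v : T.domain, B (T u) v = B u (T v)) (hg : IsGeomSimple T μ) (hμ : μ.im ≠ 0) :
    IsAlgSimple T μ := by
  have hμ' : μ - conj μ ≠ 0 := fun h => hμ (Complex.conj_eq_iff_im.1 (sub_eq_zero.1 h).symm)
  refine isAlgSimple_of_isGeomSimple hg fun y hy => ?_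
  obtain ⟨x, hx, hTx⟩ := (mem_eigenspace T μ _).1 hy
  have hTy : T y = μ • (y : E) + x := by rw [hx]; abel
  have hxx : B (x : E) (x : E) = 0 := by
    by_contra h
    exact hμ (im_eq_zero_of_form_ne_zero hT hTx h)
  have hyx : B (y : E) (x : E) = 0 := by
    have h1 := hT y x
    rw [hTy, hTx, map_add, LinearMap.add_apply, hxx, map_smul, LinearMap.smul_apply,
      LinearMap.map_smulₛₗ, add_zero, smul_eq_mul, smul_eq_mul] at h1
    refine (mul_eq_zero.1 ?_).resolve_left hμ'
    rw [sub_mul, h1, sub_self]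
  have hxy := form_eq_zero_symm hB hyx
  have hyy : B (y : E) (y : E) = 0 := by
    have h1 := hT y y
    rw [hTy, map_add, LinearMap.add_apply, hxy, map_smul, LinearMap.smul_apply, map_add,
      LinearMap.map_smulₛₗ, hyx, add_zero, add_zero, smul_eq_mul, smul_eq_mul] at h1
    refine (mul_eq_zero.1 ?_).resolve_left hμ'
    rw [sub_mul, h1, sub_self]
  suffices h0 : (x : E) = 0 by rw [hTy, h0, add_zero]
  by_contra h0
  have hβx : β (x : E) ≠ 0 := fun h => h0 (eq_zero_of_nonpos hβ h (by simp [hxx]))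
  have hd := smul_eq_smul_of_nonpos hB hβ (by simp [hxx]) (by simp [hyy]) hxy
  have hy' : y = ((β (x : E))⁻¹ * β (y : E)) • x := by
    refine Subtype.ext ?_
    rw [Submodule.coe_smul, mul_smul, hd, inv_smul_smul₀ hβx]
  apply h0
  rw [hx, hy', LinearPMap.map_smul, hTx, Submodule.coe_smul, smul_comm, sub_self]

/-- The line spanned by a non-zero non-positive vector is a maximal non-positive subspace. -/
theorem maximal_span_of_nonpos (hβ : ∀ x, x ≠ 0 → β x = 0 → 0 < (B x x).re) {x : E}
    (hx0 : x ≠ 0) (hx : (B x x).re ≤ 0) :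
    Maximal (IsNegSemidef fun x y => B x y) (Submodule.span ℂ {x}) := by
  have hβx : β x ≠ 0 := fun h => hx0 (eq_zero_of_nonpos hβ h hx)
  refine ⟨fun u hu => ?_, fun N hN hle y hy => ?_⟩
  · obtain ⟨c, rfl⟩ := Submodule.mem_span_singleton.1 hu
    have : B (c • x) (c • x) = (Complex.normSq c : ℂ) * B x x := by
      rw [Complex.normSq_eq_conj_mul_self]
      simp
      ring
    simp only [this, Complex.re_ofReal_mul]
    exact mul_nonpos_of_nonneg_of_nonpos (Complex.normSq_nonneg _) hx
  · have hxN : x ∈ N := hle (Submodule.mem_span_singleton_self x)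
    -- The multiple of x is chosen to cancel β(y); the difference lies in N, so it is non-positive
    -- and therefore zero.
    have h0 := eq_zero_of_nonpos hβ (x := y - ((β x)⁻¹ * β y) • x) (by simp; field_simp; simp)
      (hN _ (N.sub_mem hy (N.smul_mem _ hxN)))
    exact Submodule.mem_span_singleton.2 ⟨_, (sub_eq_zero.1 h0).symm⟩

theorem isInvariant_span_eigenvector {x : T.domain} (hx : T x = μ • (x : E)) :
    IsInvariant T (Submodule.span ℂ {(x : E)}) := by
  refine ⟨(Submodule.span_singleton_le_iff_mem _ _).2 x.2, fun u hu => ?_⟩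
  obtain ⟨c, hc⟩ := Submodule.mem_span_singleton.1 hu
  have : u = c • x := Subtype.ext hc.symm
  rw [this, LinearPMap.map_smul, hx]
  exact Submodule.smul_mem _ _ (Submodule.smul_mem _ _ (Submodule.mem_span_singleton_self _))

/-- On an eigenvector [Tx, x] = μ[x, x], so positivity excludes neutral eigenvectors. -/
theorem IsPositiveFor.form_ne_zero (hp : IsPositiveFor (fun x y => B x y) T) {x : T.domain}
    (hx0 : (x : E) ≠ 0) (hx : T x = μ • (x : E)) : B (x : E) (x : E) ≠ 0 := by
  intro h
  have := (hp x hx0).2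
  simp [hx, h] at this

/-- For a positive operator the sign of a real eigenvalue is the sign of [x, x] on its eigenvectors,
so the given non-positive eigenvector has a negative eigenvalue. A second negative eigenvalue would
supply an orthogonal negative vector, which index one forbids. -/
theorem IsPositiveFor.existsUnique_neg_eigenvalue (hB : ∀ x y, conj (B x y) = B y x)
    (hβ : ∀ x, x ≠ 0 → β x = 0 → 0 < (B x x).re)
    (hT : ∀ u v : T.domain, B (T u) v = B u (T v)) (hp : IsPositiveFor (fun x y => B x y) T)
    (hex : ∃ x : T.domain, (x : E) ≠ 0 ∧ (B (x : E) (x : E)).re ≤ 0 ∧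
      ∃ μ : ℂ, T x = μ • (x : E)) :
    ∃! μ : ℝ, μ < 0 ∧ IsEigenvalue T (μ : ℂ) := by
  have hpos : ∀ (x : T.domain) (ν : ℝ), (x : E) ≠ 0 → T x = (ν : ℂ) • (x : E) →
      0 < ν * (B (x : E) (x : E)).re := by
    intro x ν hx0 hx
    have := (hp x hx0).2
    simpa [hx] using this
  obtain ⟨x, hx0, hxB, ν, hx⟩ := hex
  have hν : ν = (ν.re : ℂ) := by
    have := im_eq_zero_of_form_ne_zero hT hx (hp.form_ne_zero hx0 hx)
    exact Complex.ext rfl (by simp [this])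
  rw [hν] at hx
  refine ⟨ν.re, ⟨?_, x, hx0, hx⟩, ?_⟩
  · by_contra h
    exact absurd (hpos x _ hx0 hx) (not_lt.2 (mul_nonpos_of_nonneg_of_nonpos (not_lt.1 h) hxB))
  · rintro κ ⟨hκ, y, hy0, hy⟩
    have hyB : (B (y : E) (y : E)).re ≤ 0 := by
      by_contra h
      exact absurd (hpos y _ hy0 hy) (not_lt.2 (mul_nonpos_of_nonpos_of_nonneg hκ.le (not_le.1 h).le))
    by_contra hne
    have hxy : B (x : E) (y : E) = 0 := by
      have h1 := hT x y
      rw [hx, hy, map_smul, LinearMap.smul_apply, LinearMap.map_smulₛₗ, smul_eq_mul, smul_eq_mul,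
        Complex.conj_ofReal, ← sub_eq_zero, ← sub_mul, mul_eq_zero, sub_eq_zero] at h1
      exact h1.resolve_left fun h => hne (Complex.ofReal_injective h).symm
    have hd := smul_eq_smul_of_nonpos hB hβ hxB hyB hxy
    have hβx : β (x : E) ≠ 0 := fun h => hx0 (eq_zero_of_nonpos hβ h hxB)
    have : β (x : E) * B (y : E) (y : E) = 0 := by
      have := congrArg (fun z => B z (y : E)) hd
      simpa [hxy] using this.symm
    exact hp.form_ne_zero hy0 hy ((mul_eq_zero.1 this).resolve_left hβx)

end Indefinite

/-! ### The indefinite form on L² × ℂ: coercivity, weak limits, density -/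

namespace Flow

open Filter Topology ComplexConjugate

variable (F : Flow) {lam : ℝ}

theorem a_pos (hlam : 0 < lam) {p : ℝ} (hp : p ∈ Icc F.p₀ 0) : 0 < F.a lam p := by
  unfold a
  split_ifs with h
  · exact hlam
  · exact F.Γ_pos p ⟨not_lt.1 h, hp.2⟩

/-- The coefficient takes the value `lam` and values of `Γ` on a compact interval where `Γ` is
positive. Allowing a general φ treats a, 1/a and 1/a³ at once. -/
theorem exists_bound_coeff (lam : ℝ) {φ : ℝ → ℝ} (hφ : ContinuousOn φ (Ioi 0)) :
    ∃ C, 0 ≤ C ∧ ∀ p ∈ Icc F.p₀ 0, |φ (F.a lam p)| ≤ C := by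
  obtain ⟨C, hC⟩ := isCompact_Icc.exists_bound_of_continuousOn (hφ.comp F.Γ_cont F.Γ_pos)
  refine ⟨max |φ lam| C, (abs_nonneg _).trans (le_max_left _ _), fun p hp => ?_⟩
  unfold a
  split_ifs with h
  · exact le_max_left _ _
  · exact (hC p ⟨not_lt.1 h, hp.2⟩).trans (le_max_right _ _)

theorem aestronglyMeasurable_coeff (lam : ℝ) {φ : ℝ → ℝ} (hφ : ContinuousOn φ (Ioi 0)) :
    AEStronglyMeasurable (fun p => φ (F.a lam p)) (volume.restrict (Ioo F.p₀ 0)) := by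
  rw [F.restrict_eq]
  refine AEStronglyMeasurable.add_measure ?_ ?_
  · refine (aestronglyMeasurable_const (b := φ lam)).congr ?_
    filter_upwards [F.a_left lam] with p hp
    rw [hp]
  · refine ((hφ.comp F.Γ_cont F.Γ_pos).mono
      Ioo_subset_Icc_self).aestronglyMeasurable measurableSet_Ioo |>.congr ?_
    filter_upwards [F.a_right lam] with p hp
    rw [hp]; rfl

theorem memLp_coeff_mul (lam : ℝ) {φ : ℝ → ℝ} (hφ : ContinuousOn φ (Ioi 0)) {u : ℝ → ℂ}
    (hu : MemLp u 2 (volume.restrict (Ioo F.p₀ 0))) :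
    MemLp (fun p => (φ (F.a lam p) : ℂ) * u p) 2 (volume.restrict (Ioo F.p₀ 0)) := by
  obtain ⟨C, -, hC⟩ := F.exists_bound_coeff lam hφ
  refine MemLp.of_le_mul (c := C) hu
    ((Complex.continuous_ofReal.comp_aestronglyMeasurable
      (F.aestronglyMeasurable_coeff lam hφ)).mul hu.1) ?_
  filter_upwards [ae_restrict_mem measurableSet_Ioo] with p hp
  rw [norm_mul, Complex.norm_real]
  exact mul_le_mul_of_nonneg_right (hC p (Ioo_subset_Icc_self hp)) (norm_nonneg _)

/-- Multiplication by a function of the coefficient `a`. -/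
def coeffMul (lam : ℝ) {φ : ℝ → ℝ} (hφ : ContinuousOn φ (Ioi 0)) :
    Lp ℂ 2 (volume.restrict (Ioo F.p₀ 0)) →L[ℂ] Lp ℂ 2 (volume.restrict (Ioo F.p₀ 0)) :=
  LinearMap.mkContinuous
    { toFun := fun u => (F.memLp_coeff_mul lam hφ (Lp.memLp u)).toLp
      map_add' := fun u v => by
        rw [← MemLp.toLp_add, MemLp.toLp_eq_toLp_iff]
        filter_upwards [Lp.coeFn_add u v] with p hp
        simp only [Pi.add_apply, hp, mul_add]
      map_smul' := fun c u => by
        rw [RingHom.id_apply, ← MemLp.toLp_const_smul, MemLp.toLp_eq_toLp_iff]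
        filter_upwards [Lp.coeFn_smul c u] with p hp
        simp only [Pi.smul_apply, hp, smul_eq_mul]
        ring }
    (F.exists_bound_coeff lam hφ).choose fun u => by
      refine Lp.norm_le_mul_norm_of_ae_le_mul ?_
      filter_upwards [(F.memLp_coeff_mul lam hφ (Lp.memLp u)).coeFn_toLp,
        ae_restrict_mem measurableSet_Ioo] with p hp hpI
      change ‖(F.memLp_coeff_mul lam hφ (Lp.memLp u)).toLp _ p‖ ≤ _
      rw [hp, norm_mul, Complex.norm_real]
      exact mul_le_mul_of_nonneg_right
        ((F.exists_bound_coeff lam hφ).choose_spec.2 p (Ioo_subset_Icc_self hpI)) (norm_nonneg _)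

theorem coeffMul_ae (lam : ℝ) {φ : ℝ → ℝ} (hφ : ContinuousOn φ (Ioi 0))
    (u : Lp ℂ 2 (volume.restrict (Ioo F.p₀ 0))) :
    F.coeffMul lam hφ u =ᵐ[volume.restrict (Ioo F.p₀ 0)]
      fun p => (φ (F.a lam p) : ℂ) * u p :=
  (F.memLp_coeff_mul lam hφ (Lp.memLp u)).coeFn_toLp

/-- The indefinite inner product as a sesquilinear form. -/
def form (lam : ℝ) : F.H →ₗ[ℂ] F.H →ₗ⋆[ℂ] ℂ :=
  LinearMap.mk₂'ₛₗ (RingHom.id ℂ) (starRingEnd ℂ)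
    -- The inner product is conjugate-linear in its first slot, so y comes first to make the form
    -- linear in x.
    (fun x y => inner ℂ y.1 (F.coeffMul lam continuousOn_id x.1) -
      1 / (2 * (F.σ : ℂ)) * x.2 * conj y.2)
    (fun x y z => by simp only [Prod.fst_add, Prod.snd_add, map_add, inner_add_right]; ring)
    (fun c x y => by
      simp only [Prod.smul_fst, Prod.smul_snd, map_smul, inner_smul_right, smul_eq_mul,
        RingHom.id_apply]
      ring)
    (fun x y z => by simp only [Prod.fst_add, Prod.snd_add, map_add, inner_add_left]; ring)
    (fun c x y => by
      simp only [Prod.smul_fst, Prod.smul_snd, map_mul, inner_smul_left, smul_eq_mul]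
      ring)

theorem form_def (lam : ℝ) (x y : F.H) :
    F.form lam x y = inner ℂ y.1 (F.coeffMul lam continuousOn_id x.1) -
      1 / (2 * (F.σ : ℂ)) * x.2 * conj y.2 := rfl

theorem inner_coeffMul (lam : ℝ) {φ : ℝ → ℝ} (hφ : ContinuousOn φ (Ioi 0))
    (u v : Lp ℂ 2 (volume.restrict (Ioo F.p₀ 0))) :
    inner ℂ v (F.coeffMul lam hφ u) =
      ∫ p in Ioo F.p₀ 0, (φ (F.a lam p) : ℂ) * u p * conj (v p) := by
  rw [L2.inner_def]
  refine integral_congr_ae ?_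
  filter_upwards [F.coeffMul_ae lam hφ u] with p hp
  rw [hp, RCLike.inner_apply]

theorem form_eq_bracket (lam : ℝ) (x y : F.H) : F.form lam x y = F.bracket lam x y := by
  rw [form_def, inner_coeffMul]
  rfl

theorem bracket_eq_form (lam : ℝ) : F.bracket lam = fun x y => F.form lam x y := by
  funext x y
  rw [form_eq_bracket]

theorem conj_form (lam : ℝ) (x y : F.H) : conj (F.form lam x y) = F.form lam y x := by
  rw [form_eq_bracket, form_eq_bracket, bracket, bracket, map_sub, ← integral_conj]
  congr 1
  · refine integral_congr_ae (Eventually.of_forall fun p => ?_)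
    simp only [map_mul, Complex.conj_ofReal, Complex.conj_conj]
    ring
  · simp only [map_mul, map_div₀, map_one, map_ofNat, Complex.conj_ofReal, Complex.conj_conj]
    ring

theorem continuous_form_self (lam : ℝ) : Continuous fun x => F.form lam x x := by
  simp only [form_def]
  fun_prop

/-- The positive part of the form is coercive. -/
theorem exists_coercive (hlam : 0 < lam) : ∃ m, 0 < m ∧
    ∀ u : Lp ℂ 2 (volume.restrict (Ioo F.p₀ 0)),
      m * ‖u‖ ^ 2 ≤ (inner ℂ u (F.coeffMul lam continuousOn_id u)).re := by
  obtain ⟨C, hC0, hC⟩ := F.exists_bound_coeff lam (φ := fun x => x⁻¹)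
    (continuousOn_inv₀.mono fun x hx => ne_of_gt hx)
  -- An upper bound C for 1/a gives a lower bound for a; C + 1 replaces C to have a positive number
  -- to invert.
  have hm : ∀ p ∈ Icc F.p₀ 0, (C + 1)⁻¹ ≤ F.a lam p := by
    intro p hp
    have h1 := hC p hp
    rw [abs_of_pos (inv_pos.2 (F.a_pos hlam hp))] at h1
    exact inv_le_of_inv_le₀ (F.a_pos hlam hp) (by linarith)
  refine ⟨(C + 1)⁻¹, by positivity, fun u => ?_⟩
  have h1 : ‖u‖ ^ 2 = (inner ℂ u u).re := (inner_self_eq_norm_sq (𝕜 := ℂ) u).symm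
  have i1 := (L2.integrable_inner (𝕜 := ℂ) u u).re
  have i2 := (L2.integrable_inner (𝕜 := ℂ) u (F.coeffMul lam continuousOn_id u)).re
  have e1 : (inner ℂ u u).re = ∫ p in Ioo F.p₀ 0, RCLike.re (inner ℂ (u p) (u p)) := by
    rw [L2.inner_def]
    exact (integral_re (L2.integrable_inner (𝕜 := ℂ) u u)).symm
  have e2 : (inner ℂ u (F.coeffMul lam continuousOn_id u)).re =
      ∫ p in Ioo F.p₀ 0, RCLike.re (inner ℂ (u p) (F.coeffMul lam continuousOn_id u p)) := by
    rw [L2.inner_def]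
    exact (integral_re (L2.integrable_inner (𝕜 := ℂ) u _)).symm
  rw [h1, e1, e2, ← integral_const_mul]
  refine integral_mono_ae (i1.const_mul _) i2 ?_
  filter_upwards [F.coeffMul_ae lam continuousOn_id u, ae_restrict_mem measurableSet_Ioo]
    with p hp hpI
  simp only [hp, RCLike.inner_apply]
  have e3 : ((id (F.a lam p) : ℝ) : ℂ) * u p * conj (u p) =
      ((F.a lam p * Complex.normSq (u p) : ℝ) : ℂ) := by
    rw [mul_assoc, Complex.mul_conj]
    push_cast
    rfl
  rw [e3, Complex.mul_conj]
  exact mul_le_mul_of_nonneg_right (hm p (Ioo_subset_Icc_self hpI)) (Complex.normSq_nonneg _)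

theorem form_self_re (lam : ℝ) (x : F.H) : (F.form lam x x).re =
    (inner ℂ x.1 (F.coeffMul lam continuousOn_id x.1)).re - 1 / (2 * F.σ) * ‖x.2‖ ^ 2 := by
  have : 1 / (2 * (F.σ : ℂ)) * x.2 * conj x.2 = ((1 / (2 * F.σ) * ‖x.2‖ ^ 2 : ℝ) : ℂ) := by
    rw [mul_assoc, Complex.mul_conj, Complex.normSq_eq_norm_sq]
    push_cast
    rfl
  rw [form_def, this, Complex.sub_re, Complex.ofReal_re]

/-- Index one for this form, with the second projection in the role of `β`: on its kernel only the
weighted L² norm remains. -/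
theorem form_pos (hlam : 0 < lam) (x : F.H) (hx : x ≠ 0)
    (h : LinearMap.snd ℂ (Lp ℂ 2 (volume.restrict (Ioo F.p₀ 0))) ℂ x = 0) :
    0 < (F.form lam x x).re := by
  obtain ⟨m, hm, h1⟩ := F.exists_coercive hlam
  have h2 : x.2 = 0 := h
  have h3 : x.1 ≠ 0 := fun h3 => hx (Prod.ext h3 h2)
  rw [form_self_re, h2]
  have := mul_pos hm (pow_pos (norm_pos_iff.2 h3) 2)
  have := h1 x.1
  simp
  linarith

/-- A vector orthogonal to everything vanishes. -/
theorem form_nondegenerate (hlam : 0 < lam) {x : F.H} (h : ∀ y, F.form lam x y = 0) : x = 0 := by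
  have h2 : x.2 = 0 := by
    have := h (0, 1)
    have hσ := F.σ_pos.ne'
    simpa [form_def, hσ] using this
  by_contra hx
  have := F.form_pos hlam x hx h2
  simp [h x] at this

/-- Bounded nets of non-positive vectors have weak limits. -/
theorem exists_weak_limit (hlam : 0 < lam) {ι : Type*} (𝓤 : Ultrafilter ι) (x : ι → F.H)
    (h1 : ∀ i, (x i).2 = 1) (h2 : ∀ i, (F.form lam (x i) (x i)).re ≤ 0) :
    ∃ y : F.H, y.2 = 1 ∧ ∀ v, Tendsto (fun i => F.form lam (x i) v) 𝓤 (𝓝 (F.form lam y v)) := by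
  obtain ⟨m, hm, hco⟩ := F.exists_coercive hlam
  -- With second component 1, non-positivity bounds the weighted norm squared of the first component
  -- by 1/(2σ), and coercivity bounds its L² norm by R.
  set R := √(1 / (2 * F.σ) / m) with hR
  have hb : ∀ i, ‖(x i).1‖ ≤ R := by
    intro i
    have h3 := h2 i
    rw [form_self_re, h1 i] at h3
    refine Real.le_sqrt_of_sq_le ?_
    rw [le_div_iff₀ hm]
    have := hco (x i).1
    simp at h3 ⊢
    linarith
  -- Weak compactness of the ball: Riesz representation followed by Banach–Alaoglu.
  let ψ : ι → WeakDual ℂ (Lp ℂ 2 (volume.restrict (Ioo F.p₀ 0))) := fun i =>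
    StrongDual.toWeakDual (InnerProductSpace.toDual ℂ _ (x i).1)
  obtain ⟨ℓ, -, hℓ⟩ := (WeakDual.isCompact_closedBall (𝕜 := ℂ)
    (0 : StrongDual ℂ (Lp ℂ 2 (volume.restrict (Ioo F.p₀ 0)))) R).ultrafilter_le_nhds (𝓤.map ψ) (by
      rw [Filter.le_principal_iff, Ultrafilter.coe_map, Filter.mem_map]
      refine Filter.univ_mem' fun i => ?_
      change InnerProductSpace.toDual ℂ _ (x i).1 ∈ Metric.closedBall _ _
      rw [mem_closedBall_zero_iff, LinearIsometryEquiv.norm_map]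
      exact hb i)
  have hℓ' : Tendsto ψ 𝓤 (𝓝 ℓ) := hℓ
  set w := (InnerProductSpace.toDual ℂ _).symm (WeakDual.toStrongDual ℓ) with hw
  have hlim : ∀ v : Lp ℂ 2 (volume.restrict (Ioo F.p₀ 0)),
      Tendsto (fun i => inner ℂ (x i).1 v) 𝓤 (𝓝 (inner ℂ w v)) := by
    intro v
    have := ((WeakDual.eval_continuous v).tendsto ℓ).comp hℓ'
    rw [hw, InnerProductSpace.toDual_symm_apply]
    exact this
  refine ⟨(w, 1), rfl, fun v => ?_⟩
  -- Conjugation moves the weight a onto the fixed vector v, so that z occurs only in the inner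
  -- product whose limit is known.
  have key : ∀ z : F.H, z.2 = 1 → F.form lam z v =
      conj (inner ℂ z.1 (F.coeffMul lam continuousOn_id v.1) -
        1 / (2 * (F.σ : ℂ)) * v.2) := by
    intro z hz
    rw [← conj_form, form_def, hz, map_one, mul_one]
  rw [key (w, 1) rfl]
  simp only [fun i => key (x i) (h1 i)]
  exact (Complex.continuous_conj.tendsto _).comp ((hlim _).sub_const _)

/-- A subspace without orthogonal vectors is dense. -/
theorem dense_of_orthogonal_eq_zero (hlam : 0 < lam) (V : Submodule ℂ F.H)
    (h : ∀ v, (∀ u ∈ V, F.form lam u v = 0) → v = 0) : Dense (V : Set F.H) := by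
  rw [Submodule.dense_iff_topologicalClosure_eq_top, eq_top_iff]
  rintro x -
  by_contra hx
  obtain ⟨f, r, hf, hr⟩ := RCLike.geometric_hahn_banach_closed_point (𝕜 := ℂ)
    (V.topologicalClosure.restrictScalars ℝ).convex V.isClosed_topologicalClosure hx
  -- A functional whose real part is bounded above on a subspace vanishes there: otherwise some
  -- multiple of u is sent to r exactly.
  have hfV : ∀ u ∈ V, f u = 0 := by
    intro u hu
    by_contra h0
    have := hf ((r / f u) • u) (V.le_topologicalClosure (V.smul_mem _ hu))
    simp [h0] at this
  have hinv : ContinuousOn (fun x : ℝ => x⁻¹) (Ioi 0) :=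
    continuousOn_inv₀.mono fun x hx => ne_of_gt hx
  set w := (InnerProductSpace.toDual ℂ _).symm (f.comp (ContinuousLinearMap.inl ℂ _ ℂ)) with hw
  -- The vector representing f through the indefinite form: the Riesz vector is divided by a, and
  -- the factor -2σ cancels the weight -1/(2σ) of the second component.
  set v : F.H := (F.coeffMul lam hinv w, -(2 * (F.σ : ℂ)) * conj (f (0, 1))) with hv
  have hfv : ∀ u : F.H, F.form lam u v = f u := by
    intro u
    have e1 : inner ℂ (F.coeffMul lam hinv w) (F.coeffMul lam continuousOn_id u.1) =
        inner ℂ w u.1 := by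
      rw [L2.inner_def, L2.inner_def]
      refine integral_congr_ae ?_
      filter_upwards [F.coeffMul_ae lam hinv w, F.coeffMul_ae lam continuousOn_id u.1,
        ae_restrict_mem measurableSet_Ioo] with p h1 h2 h3
      have h4 : ((F.a lam p : ℝ) : ℂ) ≠ 0 :=
        Complex.ofReal_ne_zero.2 (F.a_pos hlam (Ioo_subset_Icc_self h3)).ne'
      rw [h1, h2, RCLike.inner_apply, RCLike.inner_apply, map_mul, Complex.conj_ofReal]
      simp only [id]
      push_cast
      field_simp
    have e2 : inner ℂ w u.1 = f (u.1, 0) := by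
      rw [hw, InnerProductSpace.toDual_symm_apply]
      rfl
    have e3 : f u = f (u.1, 0) + u.2 * f (0, 1) := by
      have : u = (u.1, (0 : ℂ)) + u.2 • ((0, 1) : F.H) := by
        refine Prod.ext ?_ ?_ <;> simp
      conv_lhs => rw [this]
      rw [map_add, map_smul, smul_eq_mul]
    have hσ : (F.σ : ℂ) ≠ 0 := Complex.ofReal_ne_zero.2 F.σ_pos.ne'
    rw [form_def, e1, e2, e3]
    simp only [map_mul, map_neg, map_ofNat, Complex.conj_ofReal, Complex.conj_conj, hv]
    field_simp
    ring
  have hv0 : v = 0 := h v fun u hu => by rw [hfv, hfV u hu]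
  have h0 := hf 0 (Submodule.zero_mem _)
  rw [← hfv, hv0] at hr
  simp at hr h0
  linarith

end Flow

/-! ### Continuous representatives and primitives on an interval -/

section Sobolev

open Filter

variable {α β : ℝ} {u v w f g : ℝ → ℂ} {Ω : Set ℝ}

theorem IsWeakDeriv.congr_right (h : IsWeakDeriv Ω u v) (hv : v =ᵐ[volume.restrict Ω] w) :
    IsWeakDeriv Ω u w := by
  intro φ h1 h2 h3
  rw [h φ h1 h2 h3]
  congr 1
  refine integral_congr_ae ?_
  filter_upwards [hv] with x hx
  rw [hx]

theorem eqOn_Icc_of_ae_eq (hαβ : α < β) (hf : ContinuousOn f (Icc α β))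
    (hg : ContinuousOn g (Icc α β)) (h : f =ᵐ[volume.restrict (Ioo α β)] g) :
    EqOn f g (Icc α β) :=
  Measure.eqOn_Icc_of_ae_eq volume hαβ.ne (by rwa [← restrict_Ioo_eq_restrict_Icc]) hf hg

theorem memLp_of_continuousOn (hf : ContinuousOn f (Icc α β)) :
    MemLp f 2 (volume.restrict (Ioo α β)) := by
  have hfin : IsFiniteMeasure (volume.restrict (Ioo α β)) := ⟨by simp⟩
  obtain ⟨C, hC⟩ := isCompact_Icc.exists_bound_of_continuousOn hf
  refine MemLp.of_bound ((hf.mono Ioo_subset_Icc_self).aestronglyMeasurable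
    measurableSet_Ioo) C ?_
  filter_upwards [ae_restrict_mem measurableSet_Ioo] with x hx
  exact hC x (Ioo_subset_Icc_self hx)

theorem intervalIntegrable_of_memLp (hv : MemLp v 2 (volume.restrict (Ioo α β))) {s t : ℝ}
    (hs : s ∈ Icc α β) (ht : t ∈ Icc α β) : IntervalIntegrable v volume s t := by
  have h1 := (integrableOn_Icc_iff_integrableOn_Ioo (μ := volume)).2 (integrable_of_memLp hv)
  rw [intervalIntegrable_iff]
  exact h1.mono_set (uIoc_subset_uIcc.trans (uIcc_subset_Icc hs ht))

theorem continuousOn_primitive_of_memLp (hαβ : α ≤ β)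
    (hv : MemLp v 2 (volume.restrict (Ioo α β))) :
    ContinuousOn (fun x => ∫ t in α..x, v t) (Icc α β) := by
  rw [← uIcc_of_le hαβ]
  exact intervalIntegral.continuousOn_primitive_interval
    (by rw [uIcc_of_le hαβ, integrableOn_Icc_iff_integrableOn_Ioo]
        exact integrable_of_memLp hv)

/-- A primitive is weakly differentiable. -/
theorem isWeakDeriv_primitive (hαβ : α < β) (hv : MemLp v 2 (volume.restrict (Ioo α β)))
    (c : ℂ) : IsWeakDeriv (Ioo α β) (fun x => c + ∫ t in α..x, v t) v := by
  have hvi := intervalIntegrable_of_memLp hv (left_mem_Icc.2 hαβ.le) (right_mem_Icc.2 hαβ.le)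
  intro φ h1 h2 h3
  have hd : ∀ x, HasDerivAt φ (deriv φ x) x := fun x =>
    (h1.differentiable (by simp) x).hasDerivAt
  have hφ' : Continuous (deriv φ) := h1.continuous_deriv (by simp)
  have hα : φ α = 0 := by
    by_contra h0
    exact lt_irrefl _ (h3 (subset_tsupport _ h0)).1
  have hβ : φ β = 0 := by
    by_contra h0
    exact lt_irrefl _ (h3 (subset_tsupport _ h0)).2
  have key := integral_deriv_smul_primitive hαβ.le hvi h1.continuous.continuousOn
    hφ'.continuousOn (fun x _ => hd x)
  have h0 : ∫ x in α..β, deriv φ x = 0 := by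
    rw [intervalIntegral.integral_eq_sub_of_hasDerivAt (fun x _ => hd x)
      (hφ'.intervalIntegrable _ _), hα, hβ, sub_zero]
  simp only [hβ, zero_smul, intervalIntegral.integral_zero, zero_sub] at key
  have hsum : ∫ x in α..β, deriv φ x • (c + ∫ t in α..x, v t) =
      -∫ t in α..β, φ t • v t := by
    simp only [smul_add]
    rw [intervalIntegral.integral_add, key, intervalIntegral.integral_smul_const, h0, zero_smul,
      zero_add]
    · exact (hφ'.smul continuous_const).intervalIntegrable _ _
    · refine ContinuousOn.intervalIntegrable_of_Icc hαβ.le ?_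
      exact hφ'.continuousOn.smul (continuousOn_primitive_of_memLp hαβ.le hv)
  rwa [intervalIntegral.integral_of_le hαβ.le, intervalIntegral.integral_of_le hαβ.le,
    integral_Ioc_eq_integral_Ioo, integral_Ioc_eq_integral_Ioo] at hsum

end Sobolev

/-! ### The boundary value problem for `K` without its gravity term -/

namespace Flow

open Filter Topology ComplexConjugate

variable (F : Flow) {lam : ℝ}

theorem p₀_mem : F.p₀ ∈ Icc F.p₀ 0 := left_mem_Icc.2 F.p₀_neg.le

theorem p₁_mem : F.p₁ ∈ Icc F.p₀ 0 := ⟨F.p₀_lt_p₁.le, F.p₁_neg.le⟩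

theorem zero_mem : (0 : ℝ) ∈ Icc F.p₀ 0 := right_mem_Icc.2 F.p₀_neg.le

theorem continuousOn_inv_pow_three : ContinuousOn (fun x : ℝ => (x ^ 3)⁻¹) (Ioi 0) :=
  (continuousOn_id.pow 3).inv₀ fun _ hx => pow_ne_zero 3 (ne_of_gt hx)

theorem memLp_a_mul (lam : ℝ) (u : Lp ℂ 2 (volume.restrict (Ioo F.p₀ 0))) :
    MemLp (fun p => (F.a lam p : ℂ) * u p) 2 (volume.restrict (Ioo F.p₀ 0)) :=
  F.memLp_coeff_mul lam continuousOn_id (Lp.memLp u)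

/-- The flux `a³ u'` of the solution of `-(1 / a) (a³ u')' = h.1`, `2 ⟦a³ u'⟧ = h.2` with the value
`k` at the bed. -/
def solFlux (lam : ℝ) (h : F.H) (k : ℂ) (p : ℝ) : ℂ :=
  k - (∫ t in F.p₀..p, (F.a lam t : ℂ) * h.1 t) + if F.p₁ < p then h.2 / 2 else 0

/-- The derivative of the solution with flux `solFlux`. -/
def solSlope (lam : ℝ) (h : F.H) (k : ℂ) (p : ℝ) : ℂ :=
  (((F.a lam p ^ 3)⁻¹ : ℝ) : ℂ) * F.solFlux lam h k p

/-- The solution with flux `solFlux` which vanishes at the bed. -/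
def sol (lam : ℝ) (h : F.H) (k : ℂ) (p : ℝ) : ℂ := ∫ t in F.p₀..p, F.solSlope lam h k t

theorem memLp_solFlux (lam : ℝ) (h : F.H) (k : ℂ) :
    MemLp (F.solFlux lam h k) 2 (volume.restrict (Ioo F.p₀ 0)) := by
  have hfin : IsFiniteMeasure (volume.restrict (Ioo F.p₀ 0)) := ⟨by simp⟩
  have h1 : MemLp (fun p => k - ∫ t in F.p₀..p, (F.a lam t : ℂ) * h.1 t) 2
      (volume.restrict (Ioo F.p₀ 0)) :=
    memLp_of_continuousOn (continuousOn_const.sub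
      (continuousOn_primitive_of_memLp F.p₀_neg.le (F.memLp_a_mul lam h.1)))
  have h2 : MemLp (fun p => if F.p₁ < p then h.2 / 2 else 0) 2
      (volume.restrict (Ioo F.p₀ 0)) := by
    refine MemLp.of_bound (Measurable.ite measurableSet_Ioi measurable_const
      measurable_const).aestronglyMeasurable ‖h.2 / 2‖ (Eventually.of_forall fun p => ?_)
    split_ifs
    · exact le_rfl
    · rw [norm_zero]
      exact norm_nonneg _
  exact h1.add h2

theorem memLp_solSlope (lam : ℝ) (h : F.H) (k : ℂ) :
    MemLp (F.solSlope lam h k) 2 (volume.restrict (Ioo F.p₀ 0)) :=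
  F.memLp_coeff_mul lam continuousOn_inv_pow_three (F.memLp_solFlux lam h k)

theorem continuousOn_sol (lam : ℝ) (h : F.H) (k : ℂ) :
    ContinuousOn (F.sol lam h k) (Icc F.p₀ 0) :=
  continuousOn_primitive_of_memLp F.p₀_neg.le (F.memLp_solSlope lam h k)

theorem solFlux_left (lam : ℝ) (h : F.H) (k : ℂ) :
    (fun p => k + ∫ t in F.p₀..p, -((F.a lam t : ℂ) * h.1 t))
      =ᵐ[volume.restrict (Ioo F.p₀ F.p₁)] F.solFlux lam h k := by
  filter_upwards [ae_restrict_mem measurableSet_Ioo] with p hp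
  rw [solFlux, if_neg (not_lt.2 hp.2.le), intervalIntegral.integral_neg]
  ring

theorem solFlux_right (lam : ℝ) (h : F.H) (k : ℂ) :
    (fun p => (k - (∫ t in F.p₀..F.p₁, (F.a lam t : ℂ) * h.1 t) + h.2 / 2) +
      ∫ t in F.p₁..p, -((F.a lam t : ℂ) * h.1 t))
      =ᵐ[volume.restrict (Ioo F.p₁ 0)] F.solFlux lam h k := by
  filter_upwards [ae_restrict_mem measurableSet_Ioo] with p hp
  have hpI : p ∈ Icc F.p₀ 0 := ⟨F.p₀_lt_p₁.le.trans hp.1.le, hp.2.le⟩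
  rw [solFlux, if_pos hp.1, intervalIntegral.integral_neg,
    ← intervalIntegral.integral_add_adjacent_intervals
      (intervalIntegrable_of_memLp (F.memLp_a_mul lam h.1) F.p₀_mem F.p₁_mem)
      (intervalIntegrable_of_memLp (F.memLp_a_mul lam h.1) F.p₁_mem hpI)]
  ring

/-- `x` is the solution with data `h` and flux `k` at the bed. -/
structure IsSol (lam : ℝ) (x h : F.H) (k : ℂ) : Prop where
  ae_eq : x.1 =ᵐ[volume.restrict (Ioo F.p₀ 0)] F.sol lam h k
  lid : F.sol lam h k 0 = 0
  interface : F.σ * F.sol lam h k F.p₁ = x.2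

/-- Shooting from the bed: the value at the lid is affine in the flux k, with slope J = ∫ a⁻³ > 0,
so exactly one k meets the condition at the lid. -/
theorem exists_isSol (hlam : 0 < lam) (h : F.H) : ∃ (x : F.H) (k : ℂ), F.IsSol lam x h k := by
  have hfin : IsFiniteMeasure (volume.restrict (Ioo F.p₀ 0)) := ⟨by simp⟩
  have hone : MemLp (fun p => (((F.a lam p ^ 3)⁻¹ : ℝ) : ℂ) * (1 : ℂ)) 2
      (volume.restrict (Ioo F.p₀ 0)) :=
    F.memLp_coeff_mul lam continuousOn_inv_pow_three (memLp_const (1 : ℂ))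
  set J : ℂ := ∫ t in F.p₀..0, (((F.a lam t ^ 3)⁻¹ : ℝ) : ℂ) * (1 : ℂ) with hJ
  have hJ0 : J ≠ 0 := by
    have e : J = ((∫ t in F.p₀..0, (F.a lam t ^ 3)⁻¹ : ℝ) : ℂ) := by
      rw [hJ, ← intervalIntegral.integral_ofReal]
      simp
    rw [e, Complex.ofReal_ne_zero]
    refine (intervalIntegral.intervalIntegral_pos_of_pos_on ?_ (fun p hp => ?_) F.p₀_neg).ne'
    · rw [intervalIntegrable_iff_integrableOn_Ioo_of_le F.p₀_neg.le]
      refine (integrable_of_memLp hone).re.congr (Eventually.of_forall fun p => ?_)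
      simp only [mul_one]
      exact Complex.ofReal_re _
    · have := F.a_pos hlam (Ioo_subset_Icc_self hp)
      positivity
  have hlin : ∀ k, F.sol lam h k 0 = k * J + F.sol lam h 0 0 := by
    intro k
    rw [sol, sol, hJ, ← intervalIntegral.integral_const_mul, ← intervalIntegral.integral_add]
    · refine intervalIntegral.integral_congr fun p _ => ?_
      simp only [solSlope, solFlux]
      ring
    · exact (intervalIntegrable_of_memLp hone F.p₀_mem F.zero_mem).const_mul k
    · exact intervalIntegrable_of_memLp (F.memLp_solSlope lam h 0) F.p₀_mem F.zero_mem
  set k := -(F.sol lam h 0 0) / J with hk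
  have hm := memLp_of_continuousOn (F.continuousOn_sol lam h k)
  refine ⟨(hm.toLp, F.σ * F.sol lam h k F.p₁), k, hm.coeFn_toLp, ?_, rfl⟩
  rw [hlin, hk]
  field_simp
  ring

/-- The ratio of the gravity term of `K` to the second component. -/
def gravityCoeff : ℂ := 2 * F.g * F.jumpρ / F.σ

/-- A solution lies in the domain of `K`, which recovers the data up to the gravity term. -/
theorem IsSol.exists_domain {F : Flow} (hlam : 0 < lam) {x h : F.H} {k : ℂ}
    (hx : F.IsSol lam x h k) : ∃ u : (F.K lam).domain, (u : F.H) = x ∧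
      F.K lam u = h - F.gravityCoeff • ((0, x.2) : F.H) := by
  have hσ : (F.σ : ℂ) ≠ 0 := Complex.ofReal_ne_zero.2 F.σ_pos.ne'
  have mf := (F.memLp_a_mul lam h.1).neg
  have mfl := mf.mono_measure F.left_le
  have mfr := mf.mono_measure F.right_le
  have ms := F.memLp_solSlope lam h k
  have mW := F.memLp_solFlux lam h k
  have wl : IsWeakDeriv (Ioo F.p₀ F.p₁) (F.solFlux lam h k)
      (fun t => -((F.a lam t : ℂ) * h.1 t)) :=
    (isWeakDeriv_primitive F.p₀_lt_p₁ mfl k).congr (F.solFlux_left lam h k)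
  have wr : IsWeakDeriv (Ioo F.p₁ 0) (F.solFlux lam h k)
      (fun t => -((F.a lam t : ℂ) * h.1 t)) :=
    (isWeakDeriv_primitive F.p₁_neg mfr _).congr (F.solFlux_right lam h k)
  have Wl : MemH1 (Ioo F.p₀ F.p₁) (F.solFlux lam h k) := ⟨mW.mono_measure F.left_le, _, mfl, wl⟩
  have Wr : MemH1 (Ioo F.p₁ 0) (F.solFlux lam h k) := ⟨mW.mono_measure F.right_le, _, mfr, wr⟩
  have Sl : MemH1 (Ioo F.p₀ F.p₁) (F.solSlope lam h k) := by
    refine (Wl.smul (((lam ^ 3)⁻¹ : ℝ) : ℂ)).congr ?_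
    filter_upwards [F.a_left lam] with p hp
    simp only [solSlope, hp, Pi.smul_apply, smul_eq_mul]
  have hΓ : ∀ p ∈ Icc F.p₁ 0, F.Γ p ^ 3 ≠ 0 := fun p hp => pow_ne_zero 3 (F.Γ_pos p hp).ne'
  -- In the air a⁻³ is continuously differentiable up to the ends, because Γ² is and Γ > 0; so
  -- multiplication by it preserves H¹.
  have Sr : MemH1 (Ioo F.p₁ 0) (F.solSlope lam h k) := by
    have h1 := Wr.mul_C1 F.p₁_neg (G := fun p => (F.Γ p ^ 3)⁻¹)
      (G' := fun p => -(3 * F.γ (-p) * F.Γ p) / (F.Γ p ^ 3) ^ 2)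
      ((F.Γ_cont.pow 3).inv₀ hΓ)
      (((continuousOn_const.mul (F.γ_cont.comp continuousOn_neg
        (fun p hp => ⟨by linarith [hp.2], by linarith [hp.1]⟩))).mul F.Γ_cont).neg.div
        ((F.Γ_cont.pow 3).pow 2) fun p hp => pow_ne_zero 2 (hΓ p hp))
      (fun p hp => (F.Γ_hasDerivAt hp).inv (hΓ p (Ioo_subset_Icc_self hp)))
    refine h1.congr ?_
    filter_upwards [F.a_right lam] with p hp
    simp only [solSlope, hp, Complex.real_smul]
  have ul : IsWeakDeriv (Ioo F.p₀ F.p₁) x.1 (F.solSlope lam h k) := by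
    refine (isWeakDeriv_primitive F.p₀_lt_p₁ (ms.mono_measure F.left_le) 0).congr ?_
    filter_upwards [F.ae_left hx.ae_eq] with p hp
    rw [hp, zero_add, sol]
  have ur : IsWeakDeriv (Ioo F.p₁ 0) x.1 (F.solSlope lam h k) := by
    refine (isWeakDeriv_primitive F.p₁_neg (ms.mono_measure F.right_le)
      (F.sol lam h k F.p₁)).congr ?_
    filter_upwards [F.ae_right hx.ae_eq, ae_restrict_mem measurableSet_Ioo] with p hp hpI
    rw [hp, sol, sol, intervalIntegral.integral_add_adjacent_intervals
      (intervalIntegrable_of_memLp ms F.p₀_mem F.p₁_mem)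
      (intervalIntegrable_of_memLp ms F.p₁_mem ⟨F.p₀_lt_p₁.le.trans hpI.1.le, hpI.2.le⟩)]
  have mx := Lp.memLp x.1
  have hdom : F.InDomain x := by
    refine ⟨⟨mx.mono_measure F.left_le, _, Sl, ul⟩, ⟨mx.mono_measure F.right_le, _, Sr, ur⟩,
      F.sol lam h k, F.continuousOn_sol lam h k, hx.ae_eq, ?_, hx.lid, hx.interface⟩
    simp [sol]
  have hD : F.D x.1 =ᵐ[volume.restrict (Ioo F.p₀ 0)] F.solSlope lam h k :=
    F.ae_glue ((F.D_left _).trans (weakDeriv_ae_eq (ms.mono_measure F.left_le) ul))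
      ((F.D_right _).trans (weakDeriv_ae_eq (ms.mono_measure F.right_le) ur))
  have ha : ∀ᵐ p ∂volume.restrict (Ioo F.p₀ 0), (F.a lam p : ℂ) ≠ 0 := by
    filter_upwards [ae_restrict_mem measurableSet_Ioo] with p hp
    exact Complex.ofReal_ne_zero.2 (F.a_pos hlam (Ioo_subset_Icc_self hp)).ne'
  have hflux : F.flux lam x.1 =ᵐ[volume.restrict (Ioo F.p₀ 0)] F.solFlux lam h k := by
    filter_upwards [hD, ha] with p hp hp0
    rw [flux, hp, solSlope]
    push_cast
    field_simp
  have hDD : F.D (F.flux lam x.1) =ᵐ[volume.restrict (Ioo F.p₀ 0)]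
      fun t => -((F.a lam t : ℂ) * h.1 t) := by
    rw [F.D_congr hflux]
    exact F.ae_glue ((F.D_left _).trans (weakDeriv_ae_eq mfl wl))
      ((F.D_right _).trans (weakDeriv_ae_eq mfr wr))
  have hcont : ContinuousOn (fun p => k - ∫ t in F.p₀..p, (F.a lam t : ℂ) * h.1 t)
      (Icc F.p₀ 0) :=
    continuousOn_const.sub (continuousOn_primitive_of_memLp F.p₀_neg.le (F.memLp_a_mul lam h.1))
  -- The integral part of the flux is continuous across the interface, so its jump is the step h.2 /
  -- 2 put into `solFlux`.
  have hjump : F.jump (F.flux lam x.1) = h.2 / 2 := by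
    rw [F.jump_congr hflux, jump,
      contRep_eq F.p₁_neg (U := fun p => k - (∫ t in F.p₀..p, (F.a lam t : ℂ) * h.1 t) + h.2 / 2)
        ((hcont.mono (Icc_subset_Icc_left F.p₀_lt_p₁.le)).add continuousOn_const) ?_
        (left_mem_Icc.2 F.p₁_neg.le),
      contRep_eq F.p₀_lt_p₁ (hcont.mono (Icc_subset_Icc_right F.p₁_neg.le)) ?_
        (right_mem_Icc.2 F.p₀_lt_p₁.le)]
    · ring
    · filter_upwards [ae_restrict_mem measurableSet_Ioo] with p hp
      rw [solFlux, if_neg (not_lt.2 hp.2.le), add_zero]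
    · filter_upwards [ae_restrict_mem measurableSet_Ioo] with p hp
      rw [solFlux, if_pos hp.1]
  refine ⟨⟨x, hdom⟩, rfl, Prod.ext ?_ ?_⟩
  · change (F.memLp_interior lam hdom.1 hdom.2.1).toLp (F.interior lam x.1) =
      h.1 - F.gravityCoeff • (0 : Lp ℂ 2 (volume.restrict (Ioo F.p₀ 0)))
    rw [smul_zero, sub_zero]
    refine Lp.ext ((F.memLp_interior lam hdom.1 hdom.2.1).coeFn_toLp.trans ?_)
    filter_upwards [hDD, ha] with p hp hp0
    rw [interior, hp]
    field_simp
  · change F.boundary lam x.1 = h.2 - F.gravityCoeff * x.2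
    rw [boundary, hjump, val, contRep_eq F.p₀_neg (F.continuousOn_sol lam h k) hx.ae_eq F.p₁_mem,
      ← hx.interface, gravityCoeff]
    field_simp

/-- An element of the domain of `K` is the solution with its own data. -/
theorem exists_isSol_of_domain (hlam : 0 < lam) (u : (F.K lam).domain) :
    ∃ k : ℂ, F.IsSol lam u (F.K lam u + F.gravityCoeff • ((0, (u : F.H).2) : F.H)) k := by
  obtain ⟨x, hx⟩ := u
  have hσ : (F.σ : ℂ) ≠ 0 := Complex.ofReal_ne_zero.2 F.σ_pos.ne'
  set h : F.H := F.K lam ⟨x, hx⟩ + F.gravityCoeff • ((0, x.2) : F.H) with hh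
  obtain ⟨hl, hr, U, hU, hxU, hU0, hU1, hUb⟩ := id hx
  have ha : ∀ᵐ p ∂volume.restrict (Ioo F.p₀ 0), (F.a lam p : ℂ) ≠ 0 := by
    filter_upwards [ae_restrict_mem measurableSet_Ioo] with p hp
    exact Complex.ofReal_ne_zero.2 (F.a_pos hlam (Ioo_subset_Icc_self hp)).ne'
  have hh1 : h.1 =ᵐ[volume.restrict (Ioo F.p₀ 0)] F.interior lam x.1 := by
    have e : h.1 = (F.memLp_interior lam hl hr).toLp (F.interior lam x.1) := by
      rw [hh, Prod.fst_add, Prod.smul_fst, smul_zero, add_zero]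
      rfl
    rw [e]
    exact MemLp.coeFn_toLp _
  have hval : F.val x.1 F.p₁ = U F.p₁ := contRep_eq F.p₀_neg hU hxU F.p₁_mem
  have hh2 : h.2 / 2 = F.jump (F.flux lam x.1) := by
    have e : h.2 = F.boundary lam x.1 + F.gravityCoeff * x.2 := rfl
    rw [e, boundary, hval, gravityCoeff, ← hUb]
    field_simp
    ring
  have hDD : F.D (F.flux lam x.1) =ᵐ[volume.restrict (Ioo F.p₀ 0)]
      fun t => -((F.a lam t : ℂ) * h.1 t) := by
    filter_upwards [hh1, ha] with p hp hp0
    rw [hp, interior]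
    field_simp
  have fl := F.flux_left_memH1 lam hl
  have fr := F.flux_right_memH1 lam hr
  have mf := (F.memLp_a_mul lam h.1).neg
  have mfl := mf.mono_measure F.left_le
  have mfr := mf.mono_measure F.right_le
  -- Here k is the trace of the flux at the bed and k' its trace at the interface from the air side;
  -- the jump condition then expresses k' through k.
  obtain ⟨k, hk⟩ := exists_primitive_rep F.p₀_lt_p₁ fl.1 mfl
    ((weakDeriv_spec fl.2).2.congr_right ((F.D_left _).symm.trans (F.ae_left hDD)))
  obtain ⟨k', hk'⟩ := exists_primitive_rep F.p₁_neg fr.1 mfr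
    ((weakDeriv_spec fr.2).2.congr_right ((F.D_right _).symm.trans (F.ae_right hDD)))
  have hjump : F.jump (F.flux lam x.1) =
      k' - (k - ∫ t in F.p₀..F.p₁, (F.a lam t : ℂ) * h.1 t) := by
    rw [jump, contRep_eq F.p₁_neg (continuousOn_const.add
        (continuousOn_primitive_of_memLp F.p₁_neg.le mfr)) hk' (left_mem_Icc.2 F.p₁_neg.le),
      contRep_eq F.p₀_lt_p₁ (continuousOn_const.add
        (continuousOn_primitive_of_memLp F.p₀_lt_p₁.le mfl)) hk (right_mem_Icc.2 F.p₀_lt_p₁.le)]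
    simp only [Pi.neg_apply, Pi.add_apply, intervalIntegral.integral_neg,
      intervalIntegral.integral_same]
    ring
  have hflux : F.flux lam x.1 =ᵐ[volume.restrict (Ioo F.p₀ 0)] F.solFlux lam h k := by
    refine F.ae_glue (hk.trans (F.solFlux_left lam h k)) (hk'.trans (EventuallyEq.trans ?_
      (F.solFlux_right lam h k)))
    refine Eventually.of_forall fun p => ?_
    have : k' = k - (∫ t in F.p₀..F.p₁, (F.a lam t : ℂ) * h.1 t) + h.2 / 2 := by
      rw [hh2, hjump]
      ring
    rw [this]
    rfl
  have hD : F.D x.1 =ᵐ[volume.restrict (Ioo F.p₀ 0)] F.solSlope lam h k := by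
    filter_upwards [hflux, ha] with p hp hp0
    rw [solSlope, ← hp, flux]
    push_cast
    field_simp
  have ms := F.memLp_solSlope lam h k
  have msl := ms.mono_measure F.left_le
  have msr := ms.mono_measure F.right_le
  -- The second integration: the condition at the bed gives c = 0, and the continuity of U at the
  -- interface makes d the value reached from the water.
  obtain ⟨c, hc⟩ := exists_primitive_rep F.p₀_lt_p₁ hl.1 msl
    ((weakDeriv_spec hl.memH1.2).2.congr_right ((F.D_left _).symm.trans (F.ae_left hD)))
  obtain ⟨d, hd⟩ := exists_primitive_rep F.p₁_neg hr.1 msr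
    ((weakDeriv_spec hr.memH1.2).2.congr_right ((F.D_right _).symm.trans (F.ae_right hD)))
  have hxl : x.1 =ᵐ[volume.restrict (Ioo F.p₀ F.p₁)] U := F.ae_left hxU
  have hxr : x.1 =ᵐ[volume.restrict (Ioo F.p₁ 0)] U := F.ae_right hxU
  have eL := eqOn_Icc_of_ae_eq F.p₀_lt_p₁ (hU.mono (Icc_subset_Icc_right F.p₁_neg.le))
    (continuousOn_const.add (continuousOn_primitive_of_memLp F.p₀_lt_p₁.le msl))
    (hxl.symm.trans hc)
  have eR := eqOn_Icc_of_ae_eq F.p₁_neg (hU.mono (Icc_subset_Icc_left F.p₀_lt_p₁.le))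
    (continuousOn_const.add (continuousOn_primitive_of_memLp F.p₁_neg.le msr))
    (hxr.symm.trans hd)
  have hc0 : c = 0 := by
    have := eL (left_mem_Icc.2 F.p₀_lt_p₁.le)
    simpa [hU0] using this.symm
  have eU1 : U F.p₁ = F.sol lam h k F.p₁ := by
    have := eL (right_mem_Icc.2 F.p₀_lt_p₁.le)
    simpa [hc0, sol] using this
  have hd0 : d = F.sol lam h k F.p₁ := by
    have := eR (left_mem_Icc.2 F.p₁_neg.le)
    simpa [eU1] using this.symm
  have eU : EqOn U (F.sol lam h k) (Icc F.p₀ 0) := by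
    intro p hp
    rcases le_total p F.p₁ with h1 | h1
    · have := eL ⟨hp.1, h1⟩
      simpa [hc0, sol] using this
    · rw [eR ⟨h1, hp.2⟩, hd0, Pi.add_apply, sol, sol, intervalIntegral.integral_add_adjacent_intervals
        (intervalIntegrable_of_memLp ms F.p₀_mem F.p₁_mem)
        (intervalIntegrable_of_memLp ms F.p₁_mem hp)]
  refine ⟨k, ?_, ?_, ?_⟩
  · filter_upwards [hxU, ae_restrict_mem measurableSet_Ioo] with p hp hpI
    rw [hp, eU (Ioo_subset_Icc_self hpI)]
  · rw [← eU F.zero_mem, hU1]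
  · rw [← eU F.p₁_mem, hUb]

end Flow

/-- Exchange of the order of integration over a triangle. -/
theorem integral_mul_primitive {α β : ℝ} (hαβ : α ≤ β) {f g : ℝ → ℂ}
    (hf : IntervalIntegrable f volume α β) (hg : IntervalIntegrable g volume α β) :
    ∫ x in α..β, f x * ∫ t in α..x, g t = ∫ t in α..β, (∫ x in t..β, f x) * g t := by
  have hf1 := (intervalIntegrable_iff_integrableOn_Ioc_of_le hαβ).1 hf
  have hg1 := (intervalIntegrable_iff_integrableOn_Ioc_of_le hαβ).1 hg
  have hint : Integrable (Function.uncurry fun x t : ℝ => if t ≤ x then f x * g t else 0)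
      ((volume.restrict (Ioc α β)).prod (volume.restrict (Ioc α β))) := by
    have h1 := (Integrable.mul_prod hf1 hg1).indicator (s := {z : ℝ × ℝ | z.2 ≤ z.1})
      (measurableSet_le measurable_snd measurable_fst)
    refine h1.congr (Filter.Eventually.of_forall fun z => ?_)
    simp [indicator, Function.uncurry]
  have hswap := integral_integral_swap hint
  rw [intervalIntegral.integral_of_le hαβ, intervalIntegral.integral_of_le hαβ]
  have hL : ∫ x in Ioc α β, f x * ∫ t in α..x, g t =
      ∫ x in Ioc α β, ∫ t in Ioc α β, (if t ≤ x then f x * g t else 0) := by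
    refine setIntegral_congr_fun measurableSet_Ioc fun x hx => ?_
    have e : (fun t => if t ≤ x then f x * g t else 0) =
        (Iic x).indicator (fun t => f x * g t) := by
      ext t; simp [indicator]
    simp only [e]
    rw [setIntegral_indicator measurableSet_Iic, Ioc_inter_Iic, min_eq_right hx.2,
      integral_const_mul, intervalIntegral.integral_of_le hx.1.le]
  have hR : ∫ t in Ioc α β, ∫ x in Ioc α β, (if t ≤ x then f x * g t else 0) =
      ∫ t in Ioc α β, (∫ x in t..β, f x) * g t := by
    refine setIntegral_congr_fun measurableSet_Ioc fun t ht => ?_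
    have e : (fun x => if t ≤ x then f x * g t else 0) =
        (Ici t).indicator (fun x => f x * g t) := by
      ext x; simp [indicator]
    have e2 : Ioc α β ∩ Ici t = Icc t β := by
      ext x; simp only [mem_inter_iff, mem_Ioc, mem_Ici, mem_Icc]
      constructor
      · rintro ⟨⟨_, h⟩, h'⟩; exact ⟨h', h⟩
      · rintro ⟨h, h'⟩; exact ⟨⟨lt_of_lt_of_le ht.1 h, h'⟩, h⟩
    simp only [e]
    rw [setIntegral_indicator measurableSet_Ici, e2, integral_mul_const,
      integral_Icc_eq_integral_Ioc, ← intervalIntegral.integral_of_le ht.2]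
  rw [hL, hswap, hR]

theorem conj_intervalIntegral (f : ℝ → ℂ) (α β : ℝ) :
    (starRingEnd ℂ) (∫ t in α..β, f t) = ∫ t in α..β, (starRingEnd ℂ) (f t) := by
  simp only [intervalIntegral, map_sub, integral_conj]

/-! ### Integration by parts for the indefinite form -/

namespace Flow

open Filter Topology ComplexConjugate

variable (F : Flow) {lam : ℝ}

theorem memLp_conj {v : ℝ → ℂ} {μ : Measure ℝ} (hv : MemLp v 2 μ) :
    MemLp (fun p => conj (v p)) 2 μ :=
  hv.of_le (Complex.continuous_conj.comp_aestronglyMeasurable hv.1)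
    (Eventually.of_forall fun p => by simp)

/-- Pairing of the data of a solution with another solution. -/
theorem IsSol.form_eq {F : Flow} {h y h' : F.H} {k' : ℂ} (k : ℂ)
    (hy : F.IsSol lam y h' k') :
    F.form lam h y =
      ∫ p in F.p₀..0, F.solFlux lam h k p * conj (F.solSlope lam h' k' p) := by
  have mf := F.memLp_a_mul lam h.1
  have mv := memLp_conj (F.memLp_solSlope lam h' k')
  set v : ℝ → ℂ := fun p => conj (F.solSlope lam h' k' p) with hv
  set f : ℝ → ℂ := fun p => (F.a lam p : ℂ) * h.1 p with hf
  have ivv : ∀ {s t : ℝ}, s ∈ Icc F.p₀ 0 → t ∈ Icc F.p₀ 0 → IntervalIntegrable v volume s t :=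
    fun hs ht => intervalIntegrable_of_memLp mv hs ht
  have ivf : ∀ {s t : ℝ}, s ∈ Icc F.p₀ 0 → t ∈ Icc F.p₀ 0 → IntervalIntegrable f volume s t :=
    fun hs ht => intervalIntegrable_of_memLp mf hs ht
  have ivA : IntervalIntegrable (fun t => (∫ s in F.p₀..t, f s) * v t) volume F.p₀ 0 :=
    (ivv F.p₀_mem F.zero_mem).continuousOn_mul (by
        rw [uIcc_of_le F.p₀_neg.le]
        exact continuousOn_primitive_of_memLp F.p₀_neg.le mf)
  have ivC : IntervalIntegrable (fun p => k * v p - (∫ s in F.p₀..p, f s) * v p) volume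
      F.p₀ 0 := ((ivv F.p₀_mem F.zero_mem).const_mul k).sub ivA
  have hconj : ∀ p, conj (F.sol lam h' k' p) = ∫ t in F.p₀..p, v t := fun p =>
    conj_intervalIntegral _ _ _
  -- Because y vanishes at bed and lid, v has mean zero. This is why k may be arbitrary here: a
  -- constant in the flux pairs to zero.
  have hlid : ∫ t in F.p₀..0, v t = 0 := by rw [← hconj, hy.lid, map_zero]
  have e1 : ∫ p in Ioo F.p₀ 0, (F.a lam p : ℂ) * h.1 p * conj (y.1 p) =
      -∫ t in F.p₀..0, (∫ s in F.p₀..t, f s) * v t := by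
    have e2 : ∫ p in Ioo F.p₀ 0, (F.a lam p : ℂ) * h.1 p * conj (y.1 p) =
        ∫ p in F.p₀..0, f p * ∫ t in F.p₀..p, v t := by
      rw [intervalIntegral.integral_of_le F.p₀_neg.le, integral_Ioc_eq_integral_Ioo]
      refine integral_congr_ae ?_
      filter_upwards [hy.ae_eq] with p hp
      rw [hp, hconj]
    rw [e2, integral_mul_primitive F.p₀_neg.le (ivf F.p₀_mem F.zero_mem)
      (ivv F.p₀_mem F.zero_mem)]
    -- Replace the integral of f from t to the lid by the total minus the part before t; the total
    -- multiplies the integral of v, which is zero.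
    have e3 : ∫ t in F.p₀..0, (∫ s in t..0, f s) * v t =
        ∫ t in F.p₀..0, ((∫ s in F.p₀..0, f s) * v t - (∫ s in F.p₀..t, f s) * v t) := by
      refine intervalIntegral.integral_congr fun t ht => ?_
      rw [uIcc_of_le F.p₀_neg.le] at ht
      rw [← intervalIntegral.integral_add_adjacent_intervals (ivf F.p₀_mem ht)
        (ivf ht F.zero_mem)]
      ring
    rw [e3, intervalIntegral.integral_sub, intervalIntegral.integral_const_mul, hlid, mul_zero,
      zero_sub]
    · exact (ivv F.p₀_mem F.zero_mem).const_mul _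
    · exact ivA
  have hmem : F.p₁ ∈ uIcc F.p₀ 0 := by rw [uIcc_of_le F.p₀_neg.le]; exact F.p₁_mem
  have ivCl := ivC.mono_set (uIcc_subset_uIcc left_mem_uIcc hmem)
  have ivCr := ivC.mono_set (uIcc_subset_uIcc hmem right_mem_uIcc)
  have hσ : (F.σ : ℂ) ≠ 0 := Complex.ofReal_ne_zero.2 F.σ_pos.ne'
  -- The condition σ y(p₁) = b cancels the weight 1/(2σ) down to 1/2. Since v has mean zero, the
  -- integral over the water is minus the one over the air, and the term becomes the contribution of
  -- the jump of the flux.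
  have e4 : 1 / (2 * (F.σ : ℂ)) * h.2 * conj y.2 = h.2 / 2 * ∫ t in F.p₀..F.p₁, v t := by
    rw [← hy.interface, map_mul, hconj, Complex.conj_ofReal]
    field_simp
  have hsplit : ∫ t in F.p₀..F.p₁, v t = -∫ t in F.p₁..0, v t := by
    rw [eq_neg_iff_add_eq_zero, intervalIntegral.integral_add_adjacent_intervals
      (ivv F.p₀_mem F.p₁_mem) (ivv F.p₁_mem F.zero_mem), hlid]
  have e5 : ∫ p in F.p₀..0, F.solFlux lam h k p * v p =
      (∫ p in F.p₀..F.p₁, (k * v p - (∫ s in F.p₀..p, f s) * v p)) +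
        ∫ p in F.p₁..0, (k * v p - (∫ s in F.p₀..p, f s) * v p + h.2 / 2 * v p) := by
    have hl : EqOn (fun p => F.solFlux lam h k p * v p)
        (fun p => k * v p - (∫ s in F.p₀..p, f s) * v p) (uIoc F.p₀ F.p₁) := by
      intro p hp
      rw [uIoc_of_le F.p₀_lt_p₁.le] at hp
      simp only [solFlux, if_neg (not_lt.2 hp.2), hf]
      ring
    have hr : EqOn (fun p => F.solFlux lam h k p * v p)
        (fun p => k * v p - (∫ s in F.p₀..p, f s) * v p + h.2 / 2 * v p) (uIoc F.p₁ 0) := by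
      intro p hp
      rw [uIoc_of_le F.p₁_neg.le] at hp
      simp only [solFlux, if_pos hp.1, hf]
      ring
    have ivl := ivCl.congr hl.symm
    have ivr := (ivCr.add ((ivv F.p₁_mem F.zero_mem).const_mul (h.2 / 2))).congr hr.symm
    rw [← intervalIntegral.integral_add_adjacent_intervals ivl ivr]
    congr 1
    · exact intervalIntegral.integral_congr_ae (Eventually.of_forall fun p hp => hl hp)
    · exact intervalIntegral.integral_congr_ae (Eventually.of_forall fun p hp => hr hp)
  rw [intervalIntegral.integral_add ivCr ((ivv F.p₁_mem F.zero_mem).const_mul _),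
    intervalIntegral.integral_const_mul, ← add_assoc,
    intervalIntegral.integral_add_adjacent_intervals ivCl ivCr,
    intervalIntegral.integral_sub ((ivv F.p₀_mem F.zero_mem).const_mul k) ivA,
    intervalIntegral.integral_const_mul, hlid, mul_zero, zero_sub] at e5
  rw [form_eq_bracket, bracket, e1, e4, hsplit, e5]
  ring

end Flow

/-! ### Self-adjointness of `K` and its non-positive eigenvector -/

namespace Flow

open Filter Topology ComplexConjugate

variable (F : Flow) {lam : ℝ}

theorem conj_gravityCoeff : conj F.gravityCoeff = F.gravityCoeff := by
  simp only [gravityCoeff, map_div₀, map_mul, map_ofNat, Complex.conj_ofReal]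

theorem form_snd_left (lam : ℝ) (b : ℂ) (y : F.H) :
    F.form lam (0, b) y = -(1 / (2 * (F.σ : ℂ)) * b * conj y.2) := by
  simp [form_def]

/-- The gravity term is symmetric because its coefficient is real and it acts only on the second
component. -/
theorem form_gravity_symm (lam : ℝ) (x y : F.H) :
    F.form lam (F.gravityCoeff • ((0, x.2) : F.H)) y =
      F.form lam x (F.gravityCoeff • ((0, y.2) : F.H)) := by
  rw [← F.conj_form lam _ x]
  simp only [map_smul, LinearMap.smul_apply, form_snd_left, smul_eq_mul, map_mul, map_neg,
    conj_gravityCoeff, Complex.conj_conj, map_div₀, map_one, map_ofNat, Complex.conj_ofReal]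
  ring

/-- With W = a³u' the pairing is the integral of a⁻³ W_u times the conjugate of W_v, which is
Hermitian in u and v. -/
theorem form_source_symm (hlam : 0 < lam) (u v : (F.K lam).domain) :
    F.form lam (F.K lam u + F.gravityCoeff • ((0, (u : F.H).2) : F.H)) v =
      F.form lam u (F.K lam v + F.gravityCoeff • ((0, (v : F.H).2) : F.H)) := by
  obtain ⟨k, hk⟩ := F.exists_isSol_of_domain hlam u
  obtain ⟨k', hk'⟩ := F.exists_isSol_of_domain hlam v
  rw [hk'.form_eq k, ← F.conj_form lam _ (u : F.H), hk.form_eq k', conj_intervalIntegral]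
  refine intervalIntegral.integral_congr fun p _ => ?_
  simp only [solSlope, map_mul, Complex.conj_conj, Complex.conj_ofReal]
  ring

theorem form_K_symm (hlam : 0 < lam) (u v : (F.K lam).domain) :
    F.form lam (F.K lam u) v = F.form lam u (F.K lam v) := by
  have h := F.form_source_symm hlam u v
  rw [map_add, LinearMap.add_apply, map_add, F.form_gravity_symm] at h
  exact add_right_cancel h

theorem exists_source_eq (hlam : 0 < lam) (h : F.H) : ∃ u : (F.K lam).domain,
    F.K lam u + F.gravityCoeff • ((0, (u : F.H).2) : F.H) = h := by
  obtain ⟨x, k, hx⟩ := F.exists_isSol hlam h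
  obtain ⟨u, rfl, hu⟩ := hx.exists_domain hlam
  exact ⟨u, by rw [hu, sub_add_cancel]⟩

theorem eq_zero_of_form_source (hlam : 0 < lam) {x : F.H} (h : ∀ u : (F.K lam).domain,
    F.form lam (F.K lam u + F.gravityCoeff • ((0, (u : F.H).2) : F.H)) x = 0) : x = 0 := by
  refine F.form_nondegenerate hlam fun y => form_eq_zero_symm (F.conj_form lam) ?_
  obtain ⟨u, rfl⟩ := F.exists_source_eq hlam y
  exact h u

/-- The usual argument for a symmetric operator that is onto: solve for z with the right-hand side
that y ought to have. Then y - z is orthogonal to the whole range, so y = z lies in the domain. -/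
theorem exists_domain_of_adjoint (hlam : 0 < lam) (y w : F.H)
    (h : ∀ u : (F.K lam).domain, F.form lam (F.K lam u) y = F.form lam u w) :
    ∃ u : (F.K lam).domain, (u : F.H) = y ∧ F.K lam u = w := by
  obtain ⟨z, hz⟩ := F.exists_source_eq hlam (w + F.gravityCoeff • ((0, y.2) : F.H))
  have hyz : y - z = 0 := by
    refine F.eq_zero_of_form_source hlam fun u => ?_
    rw [map_sub, F.form_source_symm hlam u z, hz, map_add, LinearMap.add_apply, h,
      F.form_gravity_symm, map_add, sub_self]
  have hy : (z : F.H) = y := (sub_eq_zero.1 hyz).symm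
  refine ⟨z, hy, ?_⟩
  rw [hy] at hz
  exact add_right_cancel hz

/-- Write x as the image of v under `K` plus gravity. By symmetry v is orthogonal to the range,
which is everything, so v = 0 and x = 0. -/
theorem eq_zero_of_orthogonal_domain (hlam : 0 < lam) {x : F.H}
    (h : ∀ u : (F.K lam).domain, F.form lam u x = 0) : x = 0 := by
  obtain ⟨v, hv⟩ := F.exists_source_eq hlam x
  have hv0 : (v : F.H) = 0 := F.eq_zero_of_form_source hlam fun u => by
    rw [F.form_source_symm hlam, hv, h]
  have hv0' : v = 0 := Subtype.ext hv0
  rw [← hv, hv0']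
  simp

theorem dense_domain (hlam : 0 < lam) : Dense ((F.K lam).domain : Set F.H) :=
  F.dense_of_orthogonal_eq_zero hlam _ fun _ h =>
    F.eq_zero_of_orthogonal_domain hlam fun u => h u u.2

theorem K_isSelfAdjointFor (hlam : 0 < lam) : IsSelfAdjointFor (F.bracket lam) (F.K lam) := by
  rw [bracket_eq_form]
  refine ⟨F.dense_domain hlam, Set.ext fun y => ?_⟩
  rw [SetLike.mem_coe, LinearPMap.mem_graph_iff]
  constructor
  · intro h
    exact F.exists_domain_of_adjoint hlam y.1 y.2 h
  · rintro ⟨v, h1, h2⟩ u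
    simp only [← h1, ← h2]
    exact F.form_K_symm hlam u v

/-- Negativity is an open condition satisfied by (0, 1), so it meets the dense domain. The vector
(0, 1) itself is not in the domain. -/
theorem exists_negative_domain (hlam : 0 < lam) :
    ∃ n : (F.K lam).domain, (F.form lam (n : F.H) (n : F.H)).re < 0 := by
  have hopen : IsOpen {x : F.H | (F.form lam x x).re < 0} :=
    isOpen_lt (Complex.continuous_re.comp (F.continuous_form_self lam)) continuous_const
  have hne : {x : F.H | (F.form lam x x).re < 0}.Nonempty := by
    refine ⟨(0, 1), ?_⟩
    have := F.σ_pos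
    simp [form_self_re, this]
  obtain ⟨n, hn, hnd⟩ := (F.dense_domain hlam).exists_mem_open hopen hne
  exact ⟨⟨n, hn⟩, hnd⟩

theorem exists_nonpos_eigenvector_K (hlam : 0 < lam) :
    ∃ x : (F.K lam).domain, (x : F.H) ≠ 0 ∧ (F.form lam (x : F.H) (x : F.H)).re ≤ 0 ∧
      ∃ μ : ℂ, F.K lam x = μ • (x : F.H) :=
  exists_nonpos_eigenvector_of_selfAdjoint (F.conj_form lam) (F.form_pos hlam)
    (fun 𝓤 x h1 h2 => F.exists_weak_limit hlam 𝓤 x h1 h2) (F.form_K_symm hlam)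
    (F.exists_domain_of_adjoint hlam)
    (fun _ h => F.eq_zero_of_orthogonal_domain hlam fun u =>
      form_eq_zero_symm (F.conj_form lam) (h u))
    (F.exists_negative_domain hlam)

/-! ### Simplicity of the eigenvalues -/

theorem solFlux_sub_smul (lam : ℝ) (h h' : F.H) (c k k' : ℂ) {p : ℝ} (hp : p ∈ Icc F.p₀ 0) :
    F.solFlux lam (h' - c • h) (k' - c * k) p =
      F.solFlux lam h' k' p - c * F.solFlux lam h k p := by
  have hint : ∫ t in F.p₀..p, (F.a lam t : ℂ) * (h' - c • h).1 t =
      (∫ t in F.p₀..p, (F.a lam t : ℂ) * h'.1 t) -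
        c * ∫ t in F.p₀..p, (F.a lam t : ℂ) * h.1 t := by
    rw [← intervalIntegral.integral_const_mul, ← intervalIntegral.integral_sub
      (intervalIntegrable_of_memLp (F.memLp_a_mul lam h'.1) F.p₀_mem hp)
      ((intervalIntegrable_of_memLp (F.memLp_a_mul lam h.1) F.p₀_mem hp).const_mul c),
      intervalIntegral.integral_of_le hp.1, intervalIntegral.integral_of_le hp.1,
      integral_Ioc_eq_integral_Ioo, integral_Ioc_eq_integral_Ioo]
    have hae : ∀ᵐ t ∂volume.restrict (Ioo F.p₀ p), (h' - c • h).1 t = h'.1 t - c * h.1 t := by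
      refine ae_mono (Measure.restrict_mono (Ioo_subset_Ioo_right hp.2) le_rfl) ?_
      filter_upwards [Lp.coeFn_sub h'.1 (c • h.1), Lp.coeFn_smul c h.1] with t h1 h2
      rw [Prod.fst_sub, Prod.smul_fst, h1, Pi.sub_apply, h2, Pi.smul_apply, smul_eq_mul]
    refine integral_congr_ae ?_
    filter_upwards [hae] with t ht
    rw [ht]
    ring
  rw [solFlux, solFlux, solFlux, hint]
  simp only [Prod.snd_sub, Prod.smul_snd, smul_eq_mul]
  split_ifs <;> ring

theorem sol_sub_smul (lam : ℝ) (h h' : F.H) (c k k' : ℂ) {p : ℝ} (hp : p ∈ Icc F.p₀ 0) :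
    F.sol lam (h' - c • h) (k' - c * k) p = F.sol lam h' k' p - c * F.sol lam h k p := by
  rw [sol, sol, sol, ← intervalIntegral.integral_const_mul, ← intervalIntegral.integral_sub
    (intervalIntegrable_of_memLp (F.memLp_solSlope lam h' k') F.p₀_mem hp)
    ((intervalIntegrable_of_memLp (F.memLp_solSlope lam h k) F.p₀_mem hp).const_mul c)]
  refine intervalIntegral.integral_congr fun t ht => ?_
  rw [uIcc_of_le hp.1] at ht
  simp only [solSlope, F.solFlux_sub_smul lam h h' c k k' ⟨ht.1, ht.2.trans hp.2⟩]
  ring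

/-- The solution depends linearly on its data and its bed flux together; this allows the bed fluxes
of two eigenfunctions to be cancelled. -/
theorem IsSol.sub_smul {F : Flow} {x h y h' : F.H} {k k' : ℂ} (hx : F.IsSol lam x h k)
    (hy : F.IsSol lam y h' k') (c : ℂ) :
    F.IsSol lam (y - c • x) (h' - c • h) (k' - c * k) := by
  refine ⟨?_, ?_, ?_⟩
  · filter_upwards [Lp.coeFn_sub y.1 (c • x.1), Lp.coeFn_smul c x.1, hx.ae_eq, hy.ae_eq,
      ae_restrict_mem measurableSet_Ioo] with p h1 h2 h3 h4 h5
    rw [Prod.fst_sub, Prod.smul_fst, h1, Pi.sub_apply, h2, Pi.smul_apply, smul_eq_mul, h3, h4,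
      F.sol_sub_smul lam h h' c k k' (Ioo_subset_Icc_self h5)]
  · rw [F.sol_sub_smul lam h h' c k k' F.zero_mem, hx.lid, hy.lid, mul_zero, sub_zero]
  · rw [F.sol_sub_smul lam h h' c k k' F.p₁_mem, Prod.snd_sub, Prod.smul_snd, ← hx.interface,
      ← hy.interface, smul_eq_mul]
    ring

theorem IsSol.eq_zero_of_sol {F : Flow} {x h : F.H} {k : ℂ} (hx : F.IsSol lam x h k)
    (h0 : ∀ p ∈ Icc F.p₀ 0, F.sol lam h k p = 0) : x = 0 := by
  refine Prod.ext (Lp.ext ?_) ?_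
  · refine EventuallyEq.trans ?_ (Lp.coeFn_zero _ _ _).symm
    filter_upwards [hx.ae_eq, ae_restrict_mem measurableSet_Ioo] with p h1 h2
    rw [h1, h0 p (Ioo_subset_Icc_self h2)]
    rfl
  · rw [← hx.interface, h0 _ F.p₁_mem, mul_zero]
    rfl

/-- The solution of the eigenvalue equation with zero flux at the bed vanishes. -/
theorem IsSol.eq_zero_of_eigen {F : Flow} {x h : F.H} (hx : F.IsSol lam x h 0) {μ d : ℂ}
    (h1 : h.1 = μ • x.1) (h2 : h.2 = d * x.2) : x = 0 := by
  obtain ⟨M, hM0, hM⟩ := F.exists_bound_coeff lam (φ := id) continuousOn_id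
  obtain ⟨N, hN0, hN⟩ := F.exists_bound_coeff lam continuousOn_inv_pow_three
  have hC0 : 0 ≤ M * ‖μ‖ * (-F.p₀) + ‖d * F.σ / 2‖ := by
    have := F.p₀_neg
    have : 0 ≤ -F.p₀ := by linarith
    positivity
  -- C controls the flux by the solution: the first term comes from integrating a μ U over an
  -- interval of length at most -p₀, the second from the interface, where h.2 / 2 = (d σ / 2) U(p₁).
  set C := M * ‖μ‖ * (-F.p₀) + ‖d * F.σ / 2‖ with hC
  -- The exponential weight is steep enough to turn the Volterra estimate into a contraction by a
  -- factor at most 1/2; the summand 1 keeps κ positive.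
  set κ := 2 * (N * C) + 1 with hκ
  have hNC : 0 ≤ N * C := mul_nonneg hN0 hC0
  have hκ0 : 0 < κ := by linarith
  set U := F.sol lam h 0 with hU
  have hcU : ContinuousOn U (Icc F.p₀ 0) := F.continuousOn_sol lam h 0
  obtain ⟨q, hq, hmax⟩ := isCompact_Icc.exists_isMaxOn ⟨F.p₀, F.p₀_mem⟩
    (f := fun t => ‖U t‖ * Real.exp (-(κ * t))) (hcU.norm.mul (by fun_prop))
  set S := ‖U q‖ * Real.exp (-(κ * q)) with hS
  have hS0 : 0 ≤ S := by positivity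
  have hUS : ∀ t ∈ Icc F.p₀ 0, ‖U t‖ ≤ S * Real.exp (κ * t) := by
    intro t ht
    have h3 : ‖U t‖ * Real.exp (-(κ * t)) ≤ S := hmax ht
    calc ‖U t‖ = ‖U t‖ * Real.exp (-(κ * t)) * Real.exp (κ * t) := by
          rw [mul_assoc, ← Real.exp_add]; simp
      _ ≤ _ := mul_le_mul_of_nonneg_right h3 (Real.exp_pos _).le
  have hmono : ∀ {s t : ℝ}, s ≤ t → S * Real.exp (κ * s) ≤ S * Real.exp (κ * t) :=
    fun hst => mul_le_mul_of_nonneg_left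
      (Real.exp_le_exp.2 (mul_le_mul_of_nonneg_left hst hκ0.le)) hS0
  have hflux : ∀ t ∈ Icc F.p₀ 0, ‖F.solFlux lam h 0 t‖ ≤ C * (S * Real.exp (κ * t)) := by
    intro t ht
    have hE : 0 ≤ S * Real.exp (κ * t) := by positivity
    have i1 : ‖∫ s in F.p₀..t, (F.a lam s : ℂ) * h.1 s‖ ≤
        M * ‖μ‖ * (-F.p₀) * (S * Real.exp (κ * t)) := by
      have e : ∫ s in F.p₀..t, (F.a lam s : ℂ) * h.1 s =
          ∫ s in F.p₀..t, (F.a lam s : ℂ) * (μ * U s) := by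
        rw [intervalIntegral.integral_of_le ht.1, intervalIntegral.integral_of_le ht.1,
          integral_Ioc_eq_integral_Ioo, integral_Ioc_eq_integral_Ioo]
        have hae : ∀ᵐ s ∂volume.restrict (Ioo F.p₀ t), h.1 s = μ * U s := by
          refine ae_mono (Measure.restrict_mono (Ioo_subset_Ioo_right ht.2) le_rfl) ?_
          rw [h1]
          filter_upwards [Lp.coeFn_smul μ x.1, hx.ae_eq] with s h3 h4
          rw [h3, Pi.smul_apply, h4, smul_eq_mul]
        refine integral_congr_ae ?_
        filter_upwards [hae] with s hs
        rw [hs]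
      rw [e]
      have := intervalIntegral.norm_integral_le_of_norm_le_const (a := F.p₀) (b := t)
        (f := fun s => (F.a lam s : ℂ) * (μ * U s))
        (C := M * (‖μ‖ * (S * Real.exp (κ * t)))) (fun s hs => by
          rw [uIoc_of_le ht.1] at hs
          have hsI : s ∈ Icc F.p₀ 0 := ⟨hs.1.le, hs.2.trans ht.2⟩
          rw [norm_mul, norm_mul, Complex.norm_real]
          have h3 := (hUS s hsI).trans (hmono hs.2)
          have h4 : ‖F.a lam s‖ ≤ M := hM s hsI
          gcongr)
      refine this.trans ?_
      have h5 : |t - F.p₀| ≤ -F.p₀ := by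
        rw [abs_of_nonneg (by linarith [ht.1])]
        linarith [ht.2]
      calc M * (‖μ‖ * (S * Real.exp (κ * t))) * |t - F.p₀|
          ≤ M * (‖μ‖ * (S * Real.exp (κ * t))) * (-F.p₀) := by gcongr
        _ = _ := by ring
    -- The interface acts only on points above it, where the weight exp(κ t) is at least its value
    -- at p₁; this keeps the equation of Volterra type despite the jump.
    have i2 : ‖if F.p₁ < t then h.2 / 2 else 0‖ ≤ ‖d * F.σ / 2‖ * (S * Real.exp (κ * t)) := by
      split_ifs with h3
      · have e : h.2 / 2 = d * F.σ / 2 * U F.p₁ := by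
          rw [h2, ← hx.interface]
          ring
        rw [e, norm_mul]
        exact mul_le_mul_of_nonneg_left ((hUS _ F.p₁_mem).trans (hmono h3.le)) (norm_nonneg _)
      · rw [norm_zero]
        positivity
    rw [solFlux, zero_sub]
    refine (norm_add_le _ _).trans ?_
    rw [norm_neg, hC, add_mul]
    exact add_le_add i1 i2
  have hexp : ∀ p, ∫ t in F.p₀..p, Real.exp (κ * t) ≤ Real.exp (κ * p) / κ := by
    intro p
    have hd : ∀ t ∈ uIcc F.p₀ p, HasDerivAt (fun t => Real.exp (κ * t) / κ) (Real.exp (κ * t)) t := by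
      intro t _
      have := (((hasDerivAt_id t).const_mul κ).exp).div_const κ
      refine this.congr_deriv ?_
      change Real.exp (κ * t) * (κ * 1) / κ = Real.exp (κ * t)
      field_simp
    rw [intervalIntegral.integral_eq_sub_of_hasDerivAt hd
      ((by fun_prop : Continuous fun t => Real.exp (κ * t)).intervalIntegrable _ _)]
    have : 0 < Real.exp (κ * F.p₀) / κ := by positivity
    linarith
  have hUq : ‖U q‖ ≤ N * C * S * (Real.exp (κ * q) / κ) := by
    have := intervalIntegral.norm_integral_le_of_norm_le (f := F.solSlope lam h 0)
      (g := fun t => N * C * S * Real.exp (κ * t)) (μ := volume) hq.1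
      (Eventually.of_forall fun t ht => by
        have htI : t ∈ Icc F.p₀ 0 := ⟨ht.1.le, ht.2.trans hq.2⟩
        rw [solSlope, norm_mul, Complex.norm_real]
        have h3 : ‖(F.a lam t ^ 3)⁻¹‖ ≤ N := hN t htI
        have h4 := hflux t htI
        calc _ ≤ N * (C * (S * Real.exp (κ * t))) := by gcongr
          _ = _ := by ring)
      ((by fun_prop : Continuous fun t => N * C * S * Real.exp (κ * t)).intervalIntegrable _ _)
    refine this.trans ?_
    rw [intervalIntegral.integral_const_mul]
    have := hexp q
    gcongr
  -- Evaluated at the point q where the weighted norm attains its maximum S, the estimate bounds S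
  -- by half of itself, so S = 0.
  have hSle : S ≤ S * (N * C / κ) := by
    calc S = ‖U q‖ * Real.exp (-(κ * q)) := hS
      _ ≤ N * C * S * (Real.exp (κ * q) / κ) * Real.exp (-(κ * q)) := by gcongr
      _ = S * (N * C / κ) * (Real.exp (κ * q) * Real.exp (-(κ * q))) := by ring
      _ = _ := by rw [← Real.exp_add]; simp
  have hhalf : N * C / κ ≤ 1 / 2 := by
    rw [div_le_iff₀ hκ0]
    linarith
  have hS00 : S = 0 := by
    have := mul_le_mul_of_nonneg_left hhalf hS0
    linarith
  refine hx.eq_zero_of_sol fun p hp => ?_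
  have := hUS p hp
  rw [hS00, zero_mul] at this
  exact norm_le_zero_iff.1 this

/-- An eigenvector has non-zero bed flux by uniqueness, so subtracting the multiple k'/k of it from
another one leaves an eigenvector equation with zero bed flux, whose solution vanishes. -/
theorem K_isGeomSimple (hlam : 0 < lam) {μ : ℂ} (hμ : IsEigenvalue (F.K lam) μ) :
    IsGeomSimple (F.K lam) μ := by
  obtain ⟨x, hx0, hx⟩ := hμ
  obtain ⟨k, hk⟩ := F.exists_isSol_of_domain hlam x
  have hk0 : k ≠ 0 := by
    rintro rfl
    -- The data of an eigenvector are μ times it plus the gravity term, which changes the factor in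
    -- the second component to μ + `gravityCoeff`.
    refine hx0 (hk.eq_zero_of_eigen (μ := μ) (d := μ + F.gravityCoeff) ?_ ?_)
    · simp [hx]
    · simp [hx]
      ring
  have hxe : (x : F.H) ∈ eigenspace (F.K lam) μ := (mem_eigenspace _ _ _).2 ⟨x, rfl, hx⟩
  refine finrank_eq_one (⟨x, hxe⟩ : eigenspace (F.K lam) μ)
    (fun h => hx0 (congrArg Subtype.val h)) ?_
  rintro ⟨y, hy⟩
  obtain ⟨v, rfl, hv⟩ := (mem_eigenspace _ _ _).1 hy
  obtain ⟨k', hk'⟩ := F.exists_isSol_of_domain hlam v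
  have hs := hk.sub_smul hk' (k' / k)
  rw [div_mul_cancel₀ _ hk0, sub_self] at hs
  have := hs.eq_zero_of_eigen (μ := μ) (d := μ + F.gravityCoeff) (by
      simp [hx, hv, smul_sub, smul_comm μ]) (by
      simp [hx, hv]
      ring)
  exact ⟨k' / k, Subtype.ext (sub_eq_zero.1 this).symm⟩

end Flow

namespace Flow

open Filter Topology ComplexConjugate

variable (F : Flow) {lam : ℝ}

/-! ### Positivity -/

theorem energyDensity_eq (hlam : 0 < lam) (h : F.H) (k : ℂ) {p : ℝ} (hp : p ∈ Icc F.p₀ 0) :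
    F.solFlux lam h k p * conj (F.solSlope lam h k p) =
      ((F.a lam p ^ 3 * ‖F.solSlope lam h k p‖ ^ 2 : ℝ) : ℂ) := by
  have ha : (F.a lam p : ℂ) ≠ 0 := Complex.ofReal_ne_zero.2 (F.a_pos hlam hp).ne'
  have e : F.solFlux lam h k p = (F.a lam p : ℂ) ^ 3 * F.solSlope lam h k p := by
    rw [solSlope]
    push_cast
    field_simp
  rw [e, mul_assoc, Complex.mul_conj, Complex.normSq_eq_norm_sq]
  push_cast
  rfl

theorem integrableOn_energyDensity (hlam : 0 < lam) (h : F.H) (k : ℂ) :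
    IntegrableOn (fun p => F.a lam p ^ 3 * ‖F.solSlope lam h k p‖ ^ 2) (Ioo F.p₀ 0) := by
  have h1 := (MemLp.integrable_mul (memLp_conj (F.memLp_solSlope lam h k))
    (F.memLp_solFlux lam h k)).re
  refine h1.congr ?_
  filter_upwards [ae_restrict_mem measurableSet_Ioo] with p hp
  rw [Pi.mul_apply, mul_comm, F.energyDensity_eq hlam h k (Ioo_subset_Icc_self hp)]
  exact Complex.ofReal_re _

/-- The energy identity. -/
theorem form_K_self (hlam : 0 < lam) (u : (F.K lam).domain) : ∃ (h : F.H) (k : ℂ),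
    F.IsSol lam u h k ∧ (F.form lam (F.K lam u) u).re =
      (∫ p in Ioo F.p₀ 0, F.a lam p ^ 3 * ‖F.solSlope lam h k p‖ ^ 2) +
        F.g * F.jumpρ * ‖F.sol lam h k F.p₁‖ ^ 2 := by
  obtain ⟨k, hk⟩ := F.exists_isSol_of_domain hlam u
  refine ⟨_, k, hk, ?_⟩
  have h1 := hk.form_eq (h := F.K lam u + F.gravityCoeff • ((0, (u : F.H).2) : F.H)) k
  set h := F.K lam u + F.gravityCoeff • ((0, (u : F.H).2) : F.H) with hh
  have e1 : ∫ p in F.p₀..0, F.solFlux lam h k p * conj (F.solSlope lam h k p) =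
      ((∫ p in Ioo F.p₀ 0, F.a lam p ^ 3 * ‖F.solSlope lam h k p‖ ^ 2 : ℝ) : ℂ) := by
    rw [← integral_complex_ofReal, intervalIntegral.integral_of_le F.p₀_neg.le,
      integral_Ioc_eq_integral_Ioo]
    exact setIntegral_congr_fun measurableSet_Ioo fun p hp =>
      F.energyDensity_eq hlam h k (Ioo_subset_Icc_self hp)
  have hσ : (F.σ : ℂ) ≠ 0 := Complex.ofReal_ne_zero.2 F.σ_pos.ne'
  have e2 : F.form lam (F.gravityCoeff • ((0, (u : F.H).2) : F.H)) u =
      ((-(F.g * F.jumpρ * ‖F.sol lam h k F.p₁‖ ^ 2) : ℝ) : ℂ) := by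
    rw [map_smul, LinearMap.smul_apply, form_snd_left, ← hk.interface, map_mul,
      Complex.conj_ofReal, gravityCoeff, smul_eq_mul]
    have := Complex.mul_conj (F.sol lam h k F.p₁)
    rw [Complex.normSq_eq_norm_sq] at this
    push_cast at this ⊢
    rw [← this]
    field_simp
  have e3 : F.form lam (F.K lam u) u =
      F.form lam h u - F.form lam (F.gravityCoeff • ((0, (u : F.H).2) : F.H)) u := by
    rw [hh, map_add, LinearMap.add_apply, add_sub_cancel_right]
  rw [e3, h1, e1, e2, Complex.sub_re, Complex.ofReal_re, Complex.ofReal_re]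
  ring

/-- The Cauchy–Schwarz inequality against the constant 1, obtained from the non-negativity of the
variance of ‖v‖ about its mean. -/
theorem norm_intervalIntegral_sq_le {α β : ℝ} (hαβ : α < β) {v : ℝ → ℂ}
    (hv : IntervalIntegrable v volume α β)
    (hv2 : IntervalIntegrable (fun t => ‖v t‖ ^ 2) volume α β) :
    ‖∫ t in α..β, v t‖ ^ 2 ≤ (β - α) * ∫ t in α..β, ‖v t‖ ^ 2 := by
  have hL : 0 < β - α := by linarith
  set I := ∫ t in α..β, ‖v t‖ with hI
  have h1 : ‖∫ t in α..β, v t‖ ≤ I := intervalIntegral.norm_integral_le_integral_norm hαβ.le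
  have h2 : 0 ≤ ∫ t in α..β, (‖v t‖ - I / (β - α)) ^ 2 :=
    intervalIntegral.integral_nonneg hαβ.le fun t _ => sq_nonneg _
  have e : ∫ t in α..β, (‖v t‖ - I / (β - α)) ^ 2 =
      (∫ t in α..β, ‖v t‖ ^ 2) - 2 * (I / (β - α)) * I + (I / (β - α)) ^ 2 * (β - α) := by
    have e' : ∀ t, (‖v t‖ - I / (β - α)) ^ 2 =
        ‖v t‖ ^ 2 - 2 * (I / (β - α)) * ‖v t‖ + (I / (β - α)) ^ 2 := fun t => by ring
    simp only [e']
    rw [intervalIntegral.integral_add (hv2.sub (hv.norm.const_mul _)) (by simp),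
      intervalIntegral.integral_sub hv2 (hv.norm.const_mul _),
      intervalIntegral.integral_const_mul, intervalIntegral.integral_const, smul_eq_mul]
    ring
  rw [e] at h2
  have h3 : (I / (β - α)) ^ 2 * (β - α) = I ^ 2 / (β - α) := by field_simp
  have h4 : 2 * (I / (β - α)) * I = 2 * (I ^ 2 / (β - α)) := by ring
  rw [h3, h4] at h2
  have h5 : I ^ 2 / (β - α) ≤ ∫ t in α..β, ‖v t‖ ^ 2 := by linarith
  rw [div_le_iff₀ hL] at h5
  have h6 : ‖∫ t in α..β, v t‖ ^ 2 ≤ I ^ 2 := pow_le_pow_left₀ (norm_nonneg _) h1 2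
  linarith

/-- The solution vanishes at the bed, so its value at the interface is the integral of its slope
over the water. There a is the constant `lam`, and the Cauchy–Schwarz inequality applies; the energy
of the air is dropped. -/
theorem sol_interface_sq_le (hlam : 0 < lam) (h : F.H) (k : ℂ) :
    lam ^ 3 * ‖F.sol lam h k F.p₁‖ ^ 2 ≤
      (F.p₁ - F.p₀) * ∫ p in Ioo F.p₀ 0, F.a lam p ^ 3 * ‖F.solSlope lam h k p‖ ^ 2 := by
  have hint := F.integrableOn_energyDensity hlam h k
  have hsub : Ioo F.p₀ F.p₁ ⊆ Ioo F.p₀ 0 := Ioo_subset_Ioo_right F.p₁_neg.le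
  have hl : IntegrableOn (fun p => lam ^ 3 * ‖F.solSlope lam h k p‖ ^ 2) (Ioo F.p₀ F.p₁) := by
    refine (hint.mono_set hsub).congr ?_
    filter_upwards [F.a_left lam] with p hp
    rw [hp]
  have hl2 : IntervalIntegrable (fun p => ‖F.solSlope lam h k p‖ ^ 2) volume F.p₀ F.p₁ := by
    rw [intervalIntegrable_iff_integrableOn_Ioo_of_le F.p₀_lt_p₁.le]
    refine (hl.const_mul (lam ^ 3)⁻¹).congr (Eventually.of_forall fun p => ?_)
    simp only
    field_simp
  have h1 := norm_intervalIntegral_sq_le F.p₀_lt_p₁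
    (intervalIntegrable_of_memLp (F.memLp_solSlope lam h k) F.p₀_mem F.p₁_mem) hl2
  have h2 : lam ^ 3 * ∫ p in F.p₀..F.p₁, ‖F.solSlope lam h k p‖ ^ 2 =
      ∫ p in Ioo F.p₀ F.p₁, F.a lam p ^ 3 * ‖F.solSlope lam h k p‖ ^ 2 := by
    rw [← intervalIntegral.integral_const_mul, intervalIntegral.integral_of_le F.p₀_lt_p₁.le,
      integral_Ioc_eq_integral_Ioo]
    refine integral_congr_ae ?_
    filter_upwards [F.a_left lam] with p hp
    rw [hp]
  have h3 : ∫ p in Ioo F.p₀ F.p₁, F.a lam p ^ 3 * ‖F.solSlope lam h k p‖ ^ 2 ≤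
      ∫ p in Ioo F.p₀ 0, F.a lam p ^ 3 * ‖F.solSlope lam h k p‖ ^ 2 := by
    refine setIntegral_mono_set hint ?_ (Eventually.of_forall hsub)
    filter_upwards [ae_restrict_mem measurableSet_Ioo] with p hp
    have := F.a_pos hlam (Ioo_subset_Icc_self hp)
    exact mul_nonneg (pow_nonneg this.le 3) (sq_nonneg _)
  have hL : 0 < F.p₁ - F.p₀ := by linarith [F.p₀_lt_p₁]
  calc lam ^ 3 * ‖F.sol lam h k F.p₁‖ ^ 2
      ≤ lam ^ 3 * ((F.p₁ - F.p₀) * ∫ p in F.p₀..F.p₁, ‖F.solSlope lam h k p‖ ^ 2) := by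
        rw [sol]
        gcongr
    _ = (F.p₁ - F.p₀) * (lam ^ 3 * ∫ p in F.p₀..F.p₁, ‖F.solSlope lam h k p‖ ^ 2) := by ring
    _ ≤ _ := by
        rw [h2]
        gcongr

/-- Zero energy forces zero slope almost everywhere, and the solution starts from zero at the bed.
-/
theorem energy_pos (hlam : 0 < lam) {x h : F.H} {k : ℂ} (hx : F.IsSol lam x h k) (hx0 : x ≠ 0) :
    0 < ∫ p in Ioo F.p₀ 0, F.a lam p ^ 3 * ‖F.solSlope lam h k p‖ ^ 2 := by
  have hnn : 0 ≤ᵐ[volume.restrict (Ioo F.p₀ 0)]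
      fun p => F.a lam p ^ 3 * ‖F.solSlope lam h k p‖ ^ 2 := by
    filter_upwards [ae_restrict_mem measurableSet_Ioo] with p hp
    have := F.a_pos hlam (Ioo_subset_Icc_self hp)
    exact mul_nonneg (pow_nonneg this.le 3) (sq_nonneg _)
  refine lt_of_le_of_ne (integral_nonneg_of_ae hnn) fun h0 => hx0 ?_
  have hae := (integral_eq_zero_iff_of_nonneg_ae hnn
    (F.integrableOn_energyDensity hlam h k)).1 h0.symm
  have hS : ∀ᵐ p ∂volume.restrict (Ioo F.p₀ 0), F.solSlope lam h k p = 0 := by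
    filter_upwards [hae, ae_restrict_mem measurableSet_Ioo] with p h1 hp
    have := F.a_pos hlam (Ioo_subset_Icc_self hp)
    simpa [this.ne'] using h1
  refine hx.eq_zero_of_sol fun p hp => ?_
  rw [sol, intervalIntegral.integral_of_le hp.1, integral_Ioc_eq_integral_Ioo]
  exact integral_eq_zero_of_ae (ae_mono (Measure.restrict_mono (Ioo_subset_Ioo_right hp.2) le_rfl) hS)

theorem K_isPositiveFor (hlam : 0 < lam) {lam₀ : ℝ}
    (h₀ : lam₀ ^ 3 = -F.g * F.jumpρ * (F.p₁ - F.p₀)) (hlt : lam₀ < lam) :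
    IsPositiveFor (F.bracket lam) (F.K lam) := by
  rw [bracket_eq_form]
  intro u hu
  refine ⟨?_, ?_⟩
  · refine Complex.conj_eq_iff_im.1 ?_
    rw [F.conj_form]
    exact (F.form_K_symm hlam u u).symm
  obtain ⟨h, k, hk, e⟩ := F.form_K_self hlam u
  simp only [e]
  have h1 := F.sol_interface_sq_le hlam h k
  have h2 := F.energy_pos hlam hk hu
  set R := ∫ p in Ioo F.p₀ 0, F.a lam p ^ 3 * ‖F.solSlope lam h k p‖ ^ 2
  set U := ‖F.sol lam h k F.p₁‖ ^ 2 with hU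
  have hU0 : 0 ≤ U := sq_nonneg _
  have hL : 0 < F.p₁ - F.p₀ := by linarith [F.p₀_lt_p₁]
  have h3 : lam₀ ^ 3 < lam ^ 3 := (by decide : Odd 3).strictMono_pow hlt
  -- If u(p₁) = 0, the energy itself is positive. Otherwise λ₀³ < λ³ makes the estimate at the
  -- interface strict, and λ₀³ is exactly p₁ - p₀ times the gravity coefficient -g⟦ρ⟧.
  rcases hU0.eq_or_lt with h4 | h4
  · rw [← h4, mul_zero, add_zero]
    exact h2
  · have h5 : lam₀ ^ 3 * U < (F.p₁ - F.p₀) * R := (mul_lt_mul_of_pos_right h3 h4).trans_le h1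
    rw [h₀] at h5
    have h6 : 0 < (F.p₁ - F.p₀) * (R + F.g * F.jumpρ * U) := by linarith
    exact (mul_pos_iff_of_pos_left hL).1 h6

end Flow

end
end WindWave

/-! ### The theorem for the linearized two-layer problem -/

theorem mainTheorem7 (F : WindWave.Flow) (lam : ℝ) (hlam : 0 < lam) :
    WindWave.IsSelfAdjointFor (F.bracket lam) (F.K lam) ∧
    (∀ μ : ℂ, WindWave.IsEigenvalue (F.K lam) μ → WindWave.IsGeomSimple (F.K lam) μ) ∧
    (∀ μ : ℂ, WindWave.IsEigenvalue (F.K lam) μ →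
      (μ.im ≠ 0 ∨ ∃ u ∈ WindWave.eigenspace (F.K lam) μ, F.bracket lam u u ≠ 0) →
      WindWave.IsAlgSimple (F.K lam) μ) ∧
    (∃ M : Submodule ℂ F.H,
      Maximal (WindWave.IsNegSemidef (F.bracket lam)) M ∧
      WindWave.IsInvariant (F.K lam) M ∧ Module.finrank ℂ M = 1) ∧
    (∀ lam₀ : ℝ, lam₀ ^ 3 = -F.g * F.jumpρ * (F.p₁ - F.p₀) → lam₀ < lam →
      WindWave.IsPositiveFor (F.bracket lam) (F.K lam) ∧
      (∃! μ : ℝ, μ < 0 ∧ WindWave.IsEigenvalue (F.K lam) (μ : ℂ)) ∧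
      ∀ μ : ℂ, WindWave.IsEigenvalue (F.K lam) μ → WindWave.IsAlgSimple (F.K lam) μ) := by
  have hT := F.form_K_symm hlam
  have hex := F.exists_nonpos_eigenvector_K hlam
  refine ⟨F.K_isSelfAdjointFor hlam, fun μ hμ => F.K_isGeomSimple hlam hμ, fun μ hμ h => ?_, ?_,
    fun lam₀ h₀ hlt => ?_⟩
  · have hg := F.K_isGeomSimple hlam hμ
    rcases h with h | ⟨u, hu, h⟩
    · exact WindWave.isAlgSimple_of_im_ne_zero (F.conj_form lam) (F.form_pos hlam) hT hg h
    · rw [← F.form_eq_bracket] at h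
      exact WindWave.isAlgSimple_of_form_ne_zero hT hg hu h
  · obtain ⟨x, hx0, hx, μ, hμ⟩ := hex
    refine ⟨Submodule.span ℂ {(x : F.H)}, ?_, WindWave.isInvariant_span_eigenvector hμ,
      finrank_span_singleton hx0⟩
    rw [F.bracket_eq_form]
    exact WindWave.maximal_span_of_nonpos (F.form_pos hlam) hx0 hx
  · have hp := F.K_isPositiveFor hlam h₀ hlt
    have hp' := hp
    rw [F.bracket_eq_form] at hp'
    refine ⟨hp, hp'.existsUnique_neg_eigenvalue (F.conj_form lam) (F.form_pos hlam) hT hex,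
      fun μ hμ => ?_⟩
    have hg := F.K_isGeomSimple hlam hμ
    obtain ⟨u, hu0, hu⟩ := hμ
    exact WindWave.isAlgSimple_of_form_ne_zero hT hg
      ((WindWave.mem_eigenspace _ _ _).2 ⟨u, rfl, hu⟩) (hp'.form_ne_zero hu0 hu)
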